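/- Let $n\ge 2$, $N=2n$, $a'=N+1-a$, and $(\rho_1,\dots,\rho_N)=(n-1,n-2,\dots,1,0,0,-1,\dots,-n+1)$. For $q\in\mathbb C\setminus\{0\}$ let $C_{ab}=q^{-\rho_a}\delta_{ab'}$ (so $C^2=\mathbf 1$) and let $R$ be the orthogonal $R$-matrix, whose nonzero entries are $R^{aa}{}_{aa}=q$; $R^{aa'}{}_{aa'}=q^{-1}$; $R^{ab}{}_{ab}=1$ for $a\ne b,\ a'\neq b$; $R^{ab}{}_{ba}=q-q^{-1}$ for $a>b,\ a'\ne b$; $R^{aa'}{}_{a'a}=(q-q^{-1})(1-q^{\rho_a-\rho_{a'}})$ for $a>a'$; $R^{aa'}{}_{bb'}=-(q-q^{-1})q^{\rho_a-\rho_b}$ for $a>b,\ a'\neq b$. Let $SO_q(2n)$ be the Hopf algebra over $\mathbb C$ generated by the entries of $T=(T^a{}_b)$ with relations $R_{12}T_1T_2=T_2T_1R_{12}$, $TCT^t=C=T^tCT$ and $\det_qT=1$, where the last relation means $T^{i_1}{}_{j_1}\cdots T^{i_N}{}_{j_N}\,\epsilon^{j_1\cdots j_N}=\epsilon^{i_1\cdots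 i_N}$ for every totally $q$-antisymmetric tensor $\epsilon$ (eigenvalue $-q^{-1}$ of $\hat R^{ab}{}_{cd}=R^{ba}{}_{cd}$ on each pair of neighbouring indices; for generic $q$ these are the multiples of the quantum epsilon tensor), and with $\Delta(T^a{}_b)=\sum_c T^a{}_c\otimes T^c{}_b$, $\varepsilon(T^a{}_b)=\delta^a_b$, $\kappa(T)=CT^tC$. A $*$-structure on a Hopf algebra is an antilinear antimultiplicative involution compatible with $\Delta$ and $\varepsilon$; two of them, $*$ and $*'$, are equivalent if $*'=\alpha\circ *\circ\alpha^{-1}$ for a Hopf algebra automorphism $\alpha$. Let $\mathcal D''=i\,\mathrm{diag}(\varepsilon_1,\dots,\varepsilon_{2n})$ with $\varepsilon_j=\pm1$, $\varepsilon_{j'}=-\varepsilon_j$ for all $j$, and $\varepsilon_n=-\varepsilon_{n+1}=1$. Then: 1. For every $q\neq0$: $R_{12}\mathcal D''_1\mathcal D''_2=\mathcal D''_2\mathcal D''_1R_{12}$, $\mathcal D''^tC\mathcal D''=C=\mathcal D''C\mathcal D''^t$, $\mathcal D''^2=-\mathbf 1$, $\overline{\mathcal D''}=C^t\mathcal D''C^t$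 and $\overline{\mathcal D''}=-\mathcal D''$. There is a unique Hopf algebra automorphism $\natural$ of $SO_q(2n)$ with $T^\natural=\mathcal D''T\mathcal D''^{-1}$, and it is an involution. 2. Let $q$ be real. There is a unique $*$-structure $\star$ on $SO_q(2n)$ with $T^\star=C^tTC^t$. It commutes with each $\natural$, and $\star^\natural=\natural\circ\star$ is a $*$-structure, with $T^{\star^\natural}=C^t\mathcal D''T\mathcal D''^{-1}C^t$; it defines the real form $SO_q(2n,\mathcal D'')$. 3. These real forms are deformations of $SO^*(2n)=\{O\in M_{2n}(\mathbb C): O^tO=\mathbf 1,\ \overline O^tJO=J\}$, $J=\begin{pmatrix}0&\mathbf 1_n\\-\mathbf 1_n&0\end{pmatrix}$, in the following sense. For $O^tO=\mathbf 1$ the condition $\overline O^tJO=J$ is equivalent to $\overline O=JOJ^{-1}$. At $q=1$ the algebra $SO_q(2n)$ is commutative; all the conjugations $\star^\natural$ (for the different $\mathcal D''$) are equivalent; and for each of them there is $M\in GL(2n,\mathbb C)$ such that $O=MTM^{-1}$ satisfies $O^tO=\mathbf 1$ and $O^{\star^\natural}=JOJ^{-1}$ (entrywise conjugation), and such that $g\mapsto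 MgM^{-1}$ maps the set of matrices $\chi(T)$ of all real points, i.e. algebra homomorphisms $\chi:SO_{q=1}(2n)\to\mathbb C$ with $\chi(f^{\star^\natural})=\overline{\chi(f)}$ for all $f$, onto $SO^*(2n)$. 4. Let $|q|=1$. There is a unique $*$-structure $\times$ on $SO_q(2n)$ with $T^\times=T$. It commutes with each $\natural$, and $\times^\natural=\natural\circ\times$ is a $*$-structure, with $T^{\times^\natural}=\mathcal D''T\mathcal D''^{-1}$, equivalent to $\times$. -/

import Mathlib

open scoped TensorProduct Kronecker Matrix ComplexConjugate

noncomputable section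

namespace QOrth

/-! ### Numerical data: the vector `ρ`, the metric `C` and the `R`-matrix of `SO_q(2n)`

Indices `1, …, 2n` are represented by `Fin (2 * n)` (shifted by one), so the primed index
`a' = 2n + 1 - a` is `Fin.rev a`. -/

/-- `ρ = (n-1, n-2, …, 1, 0, 0, -1, …, -n+1)`. -/
def rho (n : ℕ) (a : Fin (2 * n)) : ℤ :=
  if (a : ℕ) < n then (n : ℤ) - 1 - (a : ℤ) else (n : ℤ) - (a : ℤ)

/-- The antidiagonal metric `C_{ab} = q^{-ρ_a} δ_{ab'}`; the inverse metric `C^{ab}` has the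
same entries. -/
def metric (n : ℕ) (q : ℂˣ) : Matrix (Fin (2 * n)) (Fin (2 * n)) ℂ :=
  Matrix.of fun a b => if b = Fin.rev a then (q : ℂ) ^ (-rho n a) else 0

/-- The `R`-matrix; the entry at row `(a, b)` and column `(c, d)` is `R^{ab}_{cd}`. -/
def rMatrix (n : ℕ) (q : ℂˣ) :
    Matrix (Fin (2 * n) × Fin (2 * n)) (Fin (2 * n) × Fin (2 * n)) ℂ :=
  Matrix.of fun x y =>
    if y = x then
      (if x.1 = x.2 then (q : ℂ) else if x.2 = Fin.rev x.1 then (q : ℂ)⁻¹ else 1)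
    else if y = x.swap then
      (if x.2 < x.1 then
        (if x.2 = Fin.rev x.1 then
          ((q : ℂ) - (q : ℂ)⁻¹) * (1 - (q : ℂ) ^ (rho n x.1 - rho n x.2))
        else (q : ℂ) - (q : ℂ)⁻¹)
      else 0)
    else if x.2 = Fin.rev x.1 ∧ y.2 = Fin.rev y.1 ∧ y.1 < x.1 then
      -((q : ℂ) - (q : ℂ)⁻¹) * (q : ℂ) ^ (rho n x.1 - rho n y.1)
    else 0

/-- Totally `q`-antisymmetric tensors `e^{i_1 … i_{2n}}`: in each pair of neighbouring indices
`e` lies in the image of the `q`-antisymmetrizer `P_A`, that is, in the eigenspace of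
`R̂^{ab}_{cd} = R^{ba}_{cd}` for the eigenvalue `-q⁻¹`. For generic `q`
these tensors are the multiples of the quantum epsilon tensor. -/
def IsQAntisymm (n : ℕ) (q : ℂˣ) (e : (Fin (2 * n) → Fin (2 * n)) → ℂ) : Prop :=
  ∀ (k l : Fin (2 * n)), (l : ℕ) = (k : ℕ) + 1 → ∀ i : Fin (2 * n) → Fin (2 * n),
    ∑ a, ∑ b, rMatrix n q (i l, i k) (a, b) *
      e (Function.update (Function.update i k a) l b) = -(q : ℂ)⁻¹ * e i

/-! ### Matrices over a noncommutative algebra -/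

section Matrices

variable {ι : Type*} {B : Type*} [Semiring B] [Algebra ℂ B]

/-- A complex matrix seen as a matrix over the algebra `B`. -/
def scal (B : Type*) [Semiring B] [Algebra ℂ B] {κ μ : Type*} (M : Matrix κ μ ℂ) :
    Matrix κ μ B :=
  M.map (algebraMap ℂ B)

/-- `X₁ = X ⊗ 1`. -/
def leg₁ [DecidableEq ι] (X : Matrix ι ι B) : Matrix (ι × ι) (ι × ι) B :=
  X ⊗ₖ (1 : Matrix ι ι B)

/-- `X₂ = 1 ⊗ X`. -/
def leg₂ [DecidableEq ι] (X : Matrix ι ι B) : Matrix (ι × ι) (ι × ι) B :=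
  (1 : Matrix ι ι B) ⊗ₖ X

/-- The matrix with entries `X^{i_1}_{j_1} X^{i_2}_{j_2} ⋯ X^{i_m}_{j_m}`. -/
def tpow (m : ℕ) (X : Matrix ι ι B) : Matrix (Fin m → ι) (Fin m → ι) B :=
  Matrix.of fun i j => (List.ofFn fun k => X (i k) (j k)).prod

end Matrices

/-- `X` is a `q`-orthogonal matrix of quantum determinant one over the algebra `B`. -/
structure IsQOrthogonal (n : ℕ) (q : ℂˣ) {B : Type*} [Semiring B] [Algebra ℂ B]
    (X : Matrix (Fin (2 * n)) (Fin (2 * n)) B) : Prop where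
  /-- `R₁₂ X₁ X₂ = X₂ X₁ R₁₂`. -/
  rtt : scal B (rMatrix n q) * leg₁ X * leg₂ X = leg₂ X * leg₁ X * scal B (rMatrix n q)
  /-- `X C Xᵗ = C`. -/
  ctt : X * scal B (metric n q) * Xᵀ = scal B (metric n q)
  /-- `Xᵗ C X = C`. -/
  ttc : Xᵀ * scal B (metric n q) * X = scal B (metric n q)
  /-- `X^{i_1}_{j_1} ⋯ X^{i_N}_{j_N} ε_q^{j_1 … j_N} = ε_q^{i_1 … i_N}`, that is,
  `det_q X = 1`. -/
  det : ∀ e, IsQAntisymm n q e →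
    tpow (2 * n) X *ᵥ (fun j => algebraMap ℂ B (e j)) = fun i => algebraMap ℂ B (e i)

/-! ### The Hopf algebra `SO_q(2n)` -/

/-- The free algebra on the `(2n)²` symbols `T^a_b`. -/
abbrev FreeAlg (n : ℕ) : Type := FreeAlgebra ℂ (Fin (2 * n) × Fin (2 * n))

/-- The matrix of free generators. -/
def freeGen (n : ℕ) : Matrix (Fin (2 * n)) (Fin (2 * n)) (FreeAlg n) :=
  Matrix.of fun a b => FreeAlgebra.ι ℂ (a, b)

/-- The defining relations of `SO_q(2n)`: the entries of the matrix equations in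
`IsQOrthogonal`, for the matrix of free generators. -/
inductive Rel (n : ℕ) (q : ℂˣ) : FreeAlg n → FreeAlg n → Prop
  | rtt (x y : Fin (2 * n) × Fin (2 * n)) : Rel n q
      ((scal (FreeAlg n) (rMatrix n q) * leg₁ (freeGen n) * leg₂ (freeGen n)) x y)
      ((leg₂ (freeGen n) * leg₁ (freeGen n) * scal (FreeAlg n) (rMatrix n q)) x y)
  | ctt (a b : Fin (2 * n)) : Rel n q
      ((freeGen n * scal (FreeAlg n) (metric n q) * (freeGen n)ᵀ) a b)
      (scal (FreeAlg n) (metric n q) a b)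
  | ttc (a b : Fin (2 * n)) : Rel n q
      (((freeGen n)ᵀ * scal (FreeAlg n) (metric n q) * freeGen n) a b)
      (scal (FreeAlg n) (metric n q) a b)
  | det (e : (Fin (2 * n) → Fin (2 * n)) → ℂ) (he : IsQAntisymm n q e)
      (i : Fin (2 * n) → Fin (2 * n)) : Rel n q
      ((tpow (2 * n) (freeGen n) *ᵥ (fun j => algebraMap ℂ (FreeAlg n) (e j))) i)
      (algebraMap ℂ (FreeAlg n) (e i))

/-- The algebra `SO_q(2n)`. -/
def SOq (n : ℕ) (q : ℂˣ) : Type := RingQuot (Rel n q)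

instance (n : ℕ) (q : ℂˣ) : Ring (SOq n q) := inferInstanceAs (Ring (RingQuot (Rel n q)))

instance (n : ℕ) (q : ℂˣ) : Algebra ℂ (SOq n q) :=
  inferInstanceAs (Algebra ℂ (RingQuot (Rel n q)))

/-- The quotient map from the free algebra. -/
def SOq.mk (n : ℕ) (q : ℂˣ) : FreeAlg n →ₐ[ℂ] SOq n q :=
  RingQuot.mkAlgHom ℂ (Rel n q)

/-- The fundamental matrix `T` of generators of `SO_q(2n)`. -/
def gen (n : ℕ) (q : ℂˣ) : Matrix (Fin (2 * n)) (Fin (2 * n)) (SOq n q) :=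
  (freeGen n).map (SOq.mk n q)

section Helpers

set_option linter.unusedSectionVars false

variable {n : ℕ} {q : ℂˣ} {B : Type*} [Semiring B] [Algebra ℂ B]
  {B' : Type*} [Semiring B'] [Algebra ℂ B'] {ι : Type*}

lemma scal_map {κ μ : Type*} (f : B →ₐ[ℂ] B') (M : Matrix κ μ ℂ) :
    (scal B M).map f = scal B' M := by
  ext i j; simp [scal]

lemma leg₁_map [DecidableEq ι] (f : B →ₐ[ℂ] B') (X : Matrix ι ι B) :
    (leg₁ X).map f = leg₁ (X.map f) := by
  ext i j; simp [leg₁, Matrix.one_apply, apply_ite f]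

lemma leg₂_map [DecidableEq ι] (f : B →ₐ[ℂ] B') (X : Matrix ι ι B) :
    (leg₂ X).map f = leg₂ (X.map f) := by
  ext i j; simp [leg₂, Matrix.one_apply, apply_ite f]

lemma tpow_map (f : B →ₐ[ℂ] B') (m : ℕ) (X : Matrix ι ι B) :
    (tpow m X).map f = tpow m (X.map f) := by
  ext i j
  simp only [tpow, Matrix.map_apply, Matrix.of_apply, map_list_prod, List.map_ofFn]
  rfl

lemma mul_map {κ : Type*} [Fintype κ] (f : B →ₐ[ℂ] B') (X Y : Matrix κ κ B) :
    (X * Y).map f = X.map f * Y.map f := Matrix.map_mul (f := (f : B →+* B'))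

lemma gen_isQOrthogonal (n : ℕ) (q : ℂˣ) : IsQOrthogonal n q (gen n q) := by
  have key : ∀ {x y}, Rel n q x y → SOq.mk n q x = SOq.mk n q y := fun h =>
    RingQuot.mkAlgHom_rel ℂ h
  refine ⟨?_, ?_, ?_, ?_⟩
  · ext x y
    have := key (Rel.rtt x y)
    rw [← Matrix.map_apply (f := SOq.mk n q), ← Matrix.map_apply (f := SOq.mk n q)] at this
    simp only [mul_map, scal_map, leg₁_map, leg₂_map] at this
    exact this
  · ext x y
    have := key (Rel.ctt x y)
    rw [← Matrix.map_apply (f := SOq.mk n q), ← Matrix.map_apply (f := SOq.mk n q)] at this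
    simp only [mul_map, scal_map] at this
    exact this
  · ext x y
    have := key (Rel.ttc x y)
    rw [← Matrix.map_apply (f := SOq.mk n q), ← Matrix.map_apply (f := SOq.mk n q)] at this
    simp only [mul_map, scal_map] at this
    exact this
  · intro e he
    funext i
    have := key (Rel.det e he i)
    simp only [Matrix.mulVec, dotProduct, map_sum, map_mul, AlgHom.commutes] at this ⊢
    rw [← this, gen, ← tpow_map]
    rfl

/-- The universal property of `SO_q(2n)`. -/
def lift (X : Matrix (Fin (2 * n)) (Fin (2 * n)) B) (hX : IsQOrthogonal n q X) :
    SOq n q →ₐ[ℂ] B :=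
  RingQuot.liftAlgHom ℂ ⟨FreeAlgebra.lift ℂ fun p => X p.1 p.2, by
    have hf : (freeGen n).map (FreeAlgebra.lift ℂ fun p : Fin (2 * n) × Fin (2 * n) =>
        X p.1 p.2) = X := by
      ext a b; simp [freeGen]
    intro x y h
    induction h with
    | rtt x y =>
      rw [← Matrix.map_apply (f := FreeAlgebra.lift ℂ _), ← Matrix.map_apply
        (f := FreeAlgebra.lift ℂ _)]
      simp only [mul_map, scal_map, leg₁_map, leg₂_map, hf, hX.rtt]
    | ctt x y =>
      rw [← Matrix.map_apply (f := FreeAlgebra.lift ℂ _), ← Matrix.map_apply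
        (f := FreeAlgebra.lift ℂ _)]
      simp only [mul_map, scal_map, Matrix.transpose_map, hf, hX.ctt]
    | ttc x y =>
      rw [← Matrix.map_apply (f := FreeAlgebra.lift ℂ _), ← Matrix.map_apply
        (f := FreeAlgebra.lift ℂ _)]
      simp only [mul_map, scal_map, Matrix.transpose_map, hf, hX.ttc]
    | det e he i =>
      have h1 := congrFun (hX.det e he) i
      simp only [Matrix.mulVec, dotProduct, map_sum, map_mul, AlgHom.commutes] at h1 ⊢
      rw [← h1]
      refine Finset.sum_congr rfl fun j _ => ?_
      rw [← Matrix.map_apply (f := FreeAlgebra.lift ℂ _), tpow_map, hf]⟩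

@[simp] lemma lift_gen (X : Matrix (Fin (2 * n)) (Fin (2 * n)) B) (hX : IsQOrthogonal n q X)
    (a b : Fin (2 * n)) : lift X hX (gen n q a b) = X a b := by
  simp only [lift, gen, freeGen, SOq.mk, Matrix.map_apply, Matrix.of_apply]
  erw [RingQuot.liftAlgHom_mkAlgHom_apply]
  simp

lemma algHom_ext {f g : SOq n q →ₐ[ℂ] B} (h : ∀ a b, f (gen n q a b) = g (gen n q a b)) :
    f = g := by
  refine RingQuot.ringQuot_ext' ℂ f g ?_
  refine FreeAlgebra.hom_ext ?_
  funext p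
  exact h p.1 p.2

lemma IsQOrthogonal.map {X : Matrix (Fin (2 * n)) (Fin (2 * n)) B} (hX : IsQOrthogonal n q X)
    (f : B →ₐ[ℂ] B') : IsQOrthogonal n q (X.map f) := by
  refine ⟨?_, ?_, ?_, ?_⟩
  · simpa only [mul_map, scal_map, leg₁_map, leg₂_map] using congrArg (fun M => M.map f) hX.rtt
  · simpa only [mul_map, scal_map, Matrix.transpose_map] using congrArg (fun M => M.map f) hX.ctt
  · simpa only [mul_map, scal_map, Matrix.transpose_map] using congrArg (fun M => M.map f) hX.ttc
  · intro e he
    funext i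
    have h1 := congrArg f (congrFun (hX.det e he) i)
    simp only [Matrix.mulVec, dotProduct, map_sum, map_mul, AlgHom.commutes] at h1 ⊢
    rw [← h1, ← tpow_map]
    rfl

lemma tpow_succ_apply (m : ℕ) (X : Matrix ι ι B) (i j : Fin (m + 1) → ι) :
    tpow (m + 1) X i j = X (i 0) (j 0) * tpow m X (Fin.tail i) (Fin.tail j) := by
  simp only [tpow, Matrix.of_apply, List.ofFn_succ, List.prod_cons]
  rfl

lemma one_succ_apply [DecidableEq ι] (m : ℕ) (i j : Fin (m + 1) → ι) :
    (1 : Matrix (Fin (m + 1) → ι) (Fin (m + 1) → ι) B) i j =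
      (1 : Matrix ι ι B) (i 0) (j 0) *
        (1 : Matrix (Fin m → ι) (Fin m → ι) B) (Fin.tail i) (Fin.tail j) := by
  rw [Matrix.one_apply, Matrix.one_apply, Matrix.one_apply]
  by_cases h0 : i 0 = j 0
  · by_cases h1 : Fin.tail i = Fin.tail j
    · have h2 : i = j := by
        funext k
        exact Fin.cases h0 (fun k => congrFun h1 k) k
      subst h2
      simp
    · have h2 : i ≠ j := fun hij => h1 (by rw [hij])
      rw [if_neg h2, if_neg h1, mul_zero]
  · have h2 : i ≠ j := fun hij => h0 (by rw [hij])
    rw [if_neg h0, if_neg h2, zero_mul]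

lemma tpow_one [DecidableEq ι] (m : ℕ) : tpow m (1 : Matrix ι ι B) = 1 := by
  induction m with
  | zero => ext i j; simp [tpow, Matrix.one_apply, Subsingleton.elim i j]
  | succ m ih =>
    ext i j
    rw [tpow_succ_apply, ih, one_succ_apply]

lemma one_isQOrthogonal (n : ℕ) (q : ℂˣ) :
    IsQOrthogonal n q (1 : Matrix (Fin (2 * n)) (Fin (2 * n)) B) := by
  refine ⟨?_, ?_, ?_, ?_⟩
  · simp [leg₁, leg₂]
  · simp
  · simp
  · intro e _
    rw [tpow_one, Matrix.one_mulVec]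

lemma tpow_mul [Fintype ι] (m : ℕ) (X Y : Matrix ι ι B)
    (hc : ∀ a b c d, Commute (X a b) (Y c d)) : tpow m (X * Y) = tpow m X * tpow m Y := by
  induction m with
  | zero => ext i j; simp [tpow, Matrix.mul_apply]
  | succ m ih =>
    ext i j
    have h := congrFun (congrFun ih (Fin.tail i)) (Fin.tail j)
    simp only [tpow, Matrix.of_apply, Fin.tail, Matrix.mul_apply] at h
    simp only [tpow, Matrix.of_apply, List.ofFn_succ, List.prod_cons, Matrix.mul_apply, h]
    rw [← (Fin.consEquiv fun _ : Fin (m + 1) => ι).sum_comp, Fintype.sum_prod_type,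
      Finset.sum_mul]
    refine Finset.sum_congr rfl fun c _ => ?_
    rw [Finset.mul_sum]
    refine Finset.sum_congr rfl fun d _ => ?_
    simp only [Fin.consEquiv, Equiv.coe_fn_mk, Fin.cons_zero, Fin.cons_succ]
    have hcm : Commute (Y c (j 0)) (List.ofFn fun k : Fin m => X (i k.succ) (d k)).prod := by
      refine Commute.list_prod_right _ _ fun x hx => ?_
      obtain ⟨k, rfl⟩ := List.mem_ofFn.1 hx
      exact (hc _ _ _ _).symm
    rw [mul_assoc, ← mul_assoc (Y c (j 0)), hcm.eq]
    simp only [mul_assoc]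

lemma leg₁_mul [Fintype ι] [DecidableEq ι] (X Y : Matrix ι ι B) :
    leg₁ (X * Y) = leg₁ X * leg₁ Y := by
  ext ⟨a, b⟩ ⟨c, d⟩
  simp [leg₁, Matrix.mul_apply, Matrix.one_apply, Fintype.sum_prod_type]

lemma leg₂_mul [Fintype ι] [DecidableEq ι] (X Y : Matrix ι ι B) :
    leg₂ (X * Y) = leg₂ X * leg₂ Y := by
  ext ⟨a, b⟩ ⟨c, d⟩
  simp [leg₂, Matrix.mul_apply, Matrix.one_apply, Fintype.sum_prod_type]

lemma leg₁_mul_leg₂_apply [Fintype ι] [DecidableEq ι] (X Y : Matrix ι ι B) (a b c d : ι) :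
    (leg₁ X * leg₂ Y) (a, b) (c, d) = X a c * Y b d := by
  simp [leg₁, leg₂, Matrix.mul_apply, Matrix.one_apply, Fintype.sum_prod_type]

lemma leg₂_mul_leg₁_apply [Fintype ι] [DecidableEq ι] (X Y : Matrix ι ι B) (a b c d : ι) :
    (leg₂ Y * leg₁ X) (a, b) (c, d) = Y b d * X a c := by
  simp [leg₁, leg₂, Matrix.mul_apply, Matrix.one_apply, Fintype.sum_prod_type]

lemma leg_comm [Fintype ι] [DecidableEq ι] (X Y : Matrix ι ι B)
    (hc : ∀ a b c d, Commute (X a b) (Y c d)) : leg₁ X * leg₂ Y = leg₂ Y * leg₁ X := by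
  ext ⟨a, b⟩ ⟨c, d⟩
  rw [leg₁_mul_leg₂_apply, leg₂_mul_leg₁_apply, (hc _ _ _ _).eq]

/-- The product of two `q`-orthogonal matrices whose entries mutually commute. -/
lemma IsQOrthogonal.mul {X Y : Matrix (Fin (2 * n)) (Fin (2 * n)) B}
    (hX : IsQOrthogonal n q X) (hY : IsQOrthogonal n q Y)
    (hc : ∀ a b c d, Commute (X a b) (Y c d)) : IsQOrthogonal n q (X * Y) := by
  have ht : (X * Y)ᵀ = Yᵀ * Xᵀ := by
    ext a b
    simp only [Matrix.transpose_apply, Matrix.mul_apply]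
    exact Finset.sum_congr rfl fun c _ => (hc _ _ _ _).eq
  refine ⟨?_, ?_, ?_, ?_⟩
  · rw [leg₁_mul, leg₂_mul]
    have h1 : leg₁ Y * leg₂ X = leg₂ X * leg₁ Y :=
      leg_comm Y X fun a b c d => (hc c d a b).symm
    have h2 : leg₁ X * leg₂ Y = leg₂ Y * leg₁ X := leg_comm X Y hc
    set R := scal B (rMatrix n q)
    calc R * (leg₁ X * leg₁ Y) * (leg₂ X * leg₂ Y)
        = R * leg₁ X * (leg₁ Y * leg₂ X) * leg₂ Y := by simp only [mul_assoc]
      _ = (R * leg₁ X * leg₂ X) * leg₁ Y * leg₂ Y := by rw [h1]; simp only [mul_assoc]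
      _ = leg₂ X * leg₁ X * (R * leg₁ Y * leg₂ Y) := by rw [hX.rtt]; simp only [mul_assoc]; rfl
      _ = leg₂ X * (leg₁ X * leg₂ Y) * leg₁ Y * R := by rw [hY.rtt]; simp only [mul_assoc]; rfl
      _ = leg₂ X * leg₂ Y * (leg₁ X * leg₁ Y) * R := by rw [h2]; simp only [mul_assoc]
  · rw [ht]
    calc X * Y * scal B (metric n q) * (Yᵀ * Xᵀ)
        = X * (Y * scal B (metric n q) * Yᵀ) * Xᵀ := by simp only [mul_assoc]
      _ = _ := by rw [hY.ctt, hX.ctt]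
  · rw [ht]
    calc Yᵀ * Xᵀ * scal B (metric n q) * (X * Y)
        = Yᵀ * (Xᵀ * scal B (metric n q) * X) * Y := by simp only [mul_assoc]
      _ = _ := by rw [hX.ttc, hY.ttc]
  · intro e he
    rw [tpow_mul _ _ _ hc, ← Matrix.mulVec_mulVec, hY.det e he, hX.det e he]

lemma rev_rho (a : Fin (2 * n)) : rho n (Fin.rev a) = -rho n a := by
  have := a.2
  simp only [rho, Fin.val_rev]
  split_ifs <;> omega

lemma metric_mul_metric (n : ℕ) (q : ℂˣ) : metric n q * metric n q = 1 := by
  ext a b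
  rw [Matrix.mul_apply, Finset.sum_eq_single (Fin.rev a)]
  · simp only [metric, Matrix.of_apply, if_true, Fin.rev_rev, rev_rho, Matrix.one_apply, neg_neg]
    by_cases h : b = a
    · subst h
      rw [if_pos rfl, if_pos rfl, ← zpow_add₀ (Units.ne_zero q)]
      simp
    · rw [if_neg h, if_neg (Ne.symm h), mul_zero]
  · intro c _ hc
    simp [metric, hc]
  · simp

lemma scal_mul {κ : Type*} [Fintype κ] (M N : Matrix κ κ ℂ) :
    scal B (M * N) = scal B M * scal B N := Matrix.map_mul (f := algebraMap ℂ B)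

lemma scal_metric_sq (n : ℕ) (q : ℂˣ) :
    scal B (metric n q) * scal B (metric n q) = 1 := by
  rw [← scal_mul, metric_mul_metric]
  ext a b
  simp [scal, Matrix.one_apply, apply_ite (algebraMap ℂ B)]

lemma scal_metric_transpose_sq (n : ℕ) (q : ℂˣ) :
    (scal B (metric n q))ᵀ * (scal B (metric n q))ᵀ = 1 := by
  have h : (metric n q)ᵀ * (metric n q)ᵀ = 1 := by
    rw [← Matrix.transpose_mul, metric_mul_metric, Matrix.transpose_one]
  have h2 := congrArg (scal B) h
  rw [scal_mul] at h2
  refine h2.trans ?_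
  ext a b
  simp [scal, Matrix.one_apply, apply_ite (algebraMap ℂ B)]

/-- The matrix `κ(X) = C Xᵗ C`. -/
def coinv (n : ℕ) (q : ℂˣ) (X : Matrix (Fin (2 * n)) (Fin (2 * n)) B) :
    Matrix (Fin (2 * n)) (Fin (2 * n)) B :=
  scal B (metric n q) * Xᵀ * scal B (metric n q)

lemma transpose_scal_mul {κ : Type*} [Fintype κ] (M : Matrix κ κ ℂ) (X : Matrix κ κ B) :
    (scal B M * X)ᵀ = Xᵀ * (scal B M)ᵀ := by
  ext a b
  simp only [Matrix.transpose_apply, Matrix.mul_apply, scal, Matrix.map_apply]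
  exact Finset.sum_congr rfl fun c _ => Algebra.commutes _ _

lemma transpose_mul_scal {κ : Type*} [Fintype κ] (M : Matrix κ κ ℂ) (X : Matrix κ κ B) :
    (X * scal B M)ᵀ = (scal B M)ᵀ * Xᵀ := by
  ext a b
  simp only [Matrix.transpose_apply, Matrix.mul_apply, scal, Matrix.map_apply]
  exact Finset.sum_congr rfl fun c _ => (Algebra.commutes _ _).symm

lemma coinv_transpose (X : Matrix (Fin (2 * n)) (Fin (2 * n)) B) :
    (coinv n q X)ᵀ = (scal B (metric n q))ᵀ * X * (scal B (metric n q))ᵀ := by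
  rw [coinv, transpose_mul_scal, transpose_scal_mul, Matrix.transpose_transpose, mul_assoc]

lemma mul_coinv {X : Matrix (Fin (2 * n)) (Fin (2 * n)) B} (hX : IsQOrthogonal n q X) :
    X * coinv n q X = 1 := by
  rw [coinv, ← mul_assoc, ← mul_assoc, hX.ctt, scal_metric_sq]

lemma coinv_mul {X : Matrix (Fin (2 * n)) (Fin (2 * n)) B} (hX : IsQOrthogonal n q X) :
    coinv n q X * X = 1 := by
  rw [coinv, mul_assoc, mul_assoc, ← mul_assoc Xᵀ, hX.ttc, scal_metric_sq]

open MulOpposite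

lemma leg_op [Fintype ι] [DecidableEq ι] (S : Matrix ι ι B) :
    leg₁ (S.map op) * leg₂ (S.map op) = (leg₂ S * leg₁ S).map op := by
  ext ⟨a, b⟩ ⟨c, d⟩
  rw [Matrix.map_apply, leg₁_mul_leg₂_apply, leg₂_mul_leg₁_apply]
  rfl

lemma leg_op' [Fintype ι] [DecidableEq ι] (S : Matrix ι ι B) :
    leg₂ (S.map op) * leg₁ (S.map op) = (leg₁ S * leg₂ S).map op := by
  ext ⟨a, b⟩ ⟨c, d⟩
  rw [Matrix.map_apply, leg₁_mul_leg₂_apply, leg₂_mul_leg₁_apply]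
  rfl

lemma scal_mul_op {κ : Type*} [Fintype κ] (M : Matrix κ κ ℂ) (Y : Matrix κ κ B) :
    scal Bᵐᵒᵖ M * Y.map op = (scal B M * Y).map op := by
  ext a b
  simp only [Matrix.mul_apply, scal, Matrix.map_apply, Finset.op_sum]
  refine Finset.sum_congr rfl fun c _ => ?_
  rw [Algebra.commutes (M a c) (Y c b)]
  rfl

lemma op_mul_scal {κ : Type*} [Fintype κ] (M : Matrix κ κ ℂ) (Y : Matrix κ κ B) :
    Y.map op * scal Bᵐᵒᵖ M = (Y * scal B M).map op := by
  ext a b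
  simp only [Matrix.mul_apply, scal, Matrix.map_apply, Finset.op_sum]
  refine Finset.sum_congr rfl fun c _ => ?_
  rw [← Algebra.commutes (M c b) (Y a c)]
  rfl

lemma scal_op {κ : Type*} (M : Matrix κ κ ℂ) : (scal B M).map op = scal Bᵐᵒᵖ M := rfl

lemma op_mul_transpose {κ : Type*} [Fintype κ] (X Y : Matrix κ κ B) :
    X.map op * (Y.map op)ᵀ = ((Y * Xᵀ)ᵀ).map op := by
  ext a b
  simp only [Matrix.mul_apply, Matrix.transpose_apply, Matrix.map_apply, Finset.op_sum, op_mul]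

lemma tpow_op_mul [Fintype ι] [DecidableEq ι] (m : ℕ) (S X : Matrix ι ι B) (h : S * X = 1) :
    (tpow m (S.map op)).map unop * tpow m X = 1 := by
  induction m with
  | zero =>
    ext i j
    simp [tpow, Matrix.mul_apply, Matrix.one_apply, Subsingleton.elim i j]
  | succ m ih =>
    ext i j
    have h0 := congrFun (congrFun h (i 0)) (j 0)
    have h1 := congrFun (congrFun ih (Fin.tail i)) (Fin.tail j)
    rw [one_succ_apply, ← h1, Matrix.mul_apply, Matrix.mul_apply,
      ← (Fin.consEquiv fun _ : Fin (m + 1) => ι).sum_comp, Fintype.sum_prod_type,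
      Finset.sum_comm, Finset.mul_sum]
    refine Finset.sum_congr rfl fun d _ => ?_
    have hone : ∀ y z : B, (1 : Matrix ι ι B) (i 0) (j 0) * (y * z)
        = y * (1 : Matrix ι ι B) (i 0) (j 0) * z := by
      intro y z
      by_cases hij : i 0 = j 0 <;> simp [Matrix.one_apply, hij]
    rw [hone, ← h0, Matrix.mul_apply, Finset.mul_sum, Finset.sum_mul]
    refine Finset.sum_congr rfl fun c _ => ?_
    simp only [Fin.consEquiv, Equiv.coe_fn_mk, Matrix.map_apply, tpow_succ_apply, unop_mul,
      unop_op, Fin.cons_zero, Fin.tail_cons, mul_assoc]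

/-- The antipode matrix is `q`-orthogonal over the opposite algebra. -/
lemma IsQOrthogonal.coinv_op {X : Matrix (Fin (2 * n)) (Fin (2 * n)) B}
    (hX : IsQOrthogonal n q X) : IsQOrthogonal n q ((coinv n q X).map op) := by
  have hXS := mul_coinv hX
  have hSX := coinv_mul hX
  have hT := coinv_transpose (q := q) X
  have hone : leg₁ (1 : Matrix (Fin (2 * n)) (Fin (2 * n)) B) = 1 := by simp [leg₁]
  have hone' : leg₂ (1 : Matrix (Fin (2 * n)) (Fin (2 * n)) B) = 1 := by simp [leg₂]
  refine ⟨?_, ?_, ?_, ?_⟩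
  · rw [mul_assoc, leg_op, leg_op', scal_mul_op, op_mul_scal]
    congr 1
    set S := coinv n q X
    set R := scal B (rMatrix n q)
    have a1 : leg₁ X * leg₁ S = 1 := by rw [← leg₁_mul, hXS, hone]
    have a2 : leg₂ X * leg₂ S = 1 := by rw [← leg₂_mul, hXS, hone']
    have b1 : leg₁ S * leg₁ X = 1 := by rw [← leg₁_mul, hSX, hone]
    have b2 : leg₂ S * leg₂ X = 1 := by rw [← leg₂_mul, hSX, hone']
    calc R * (leg₂ S * leg₁ S)
        = leg₁ S * (leg₂ S * leg₂ X) * leg₁ X * R * (leg₂ S * leg₁ S) := by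
          rw [b2, mul_one, b1, one_mul]
      _ = leg₁ S * leg₂ S * (leg₂ X * leg₁ X * R) * leg₂ S * leg₁ S := by
          simp only [mul_assoc]
      _ = leg₁ S * leg₂ S * (R * leg₁ X * leg₂ X) * leg₂ S * leg₁ S := by rw [hX.rtt]
      _ = leg₁ S * leg₂ S * R * (leg₁ X * (leg₂ X * leg₂ S) * leg₁ S) := by
          simp only [mul_assoc]
      _ = leg₁ S * leg₂ S * R := by rw [a2, mul_one, a1, mul_one]
  · have key : coinv n q X * (scal B (metric n q))ᵀ * (coinv n q X)ᵀ
        = (scal B (metric n q))ᵀ := by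
      rw [hT, coinv]
      set C := scal B (metric n q) with hC
      have hCt : Cᵀ * Cᵀ = 1 := scal_metric_transpose_sq n q
      calc C * Xᵀ * C * Cᵀ * (Cᵀ * X * Cᵀ)
          = C * Xᵀ * C * (Cᵀ * Cᵀ) * X * Cᵀ := by simp only [mul_assoc]
        _ = C * (Xᵀ * C * X) * Cᵀ := by rw [hCt]; simp only [mul_assoc, mul_one]
        _ = Cᵀ := by rw [hX.ttc, scal_metric_sq, one_mul]
    rw [op_mul_scal, op_mul_transpose, transpose_mul_scal, ← mul_assoc, key,
      Matrix.transpose_transpose, scal_op]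
  · have key : (coinv n q X)ᵀ * (scal B (metric n q))ᵀ * coinv n q X
        = (scal B (metric n q))ᵀ := by
      rw [hT, coinv]
      set C := scal B (metric n q) with hC
      have hCt : Cᵀ * Cᵀ = 1 := scal_metric_transpose_sq n q
      calc Cᵀ * X * Cᵀ * Cᵀ * (C * Xᵀ * C)
          = Cᵀ * X * (Cᵀ * Cᵀ) * C * Xᵀ * C := by simp only [mul_assoc]
        _ = Cᵀ * (X * C * Xᵀ) * C := by rw [hCt]; simp only [mul_assoc, mul_one]
        _ = Cᵀ := by rw [hX.ctt, mul_assoc, scal_metric_sq, mul_one]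
    have h : (coinv n q X).map op = (((coinv n q X)ᵀ).map op)ᵀ := rfl
    rw [h, Matrix.transpose_transpose, op_mul_scal, op_mul_transpose, transpose_mul_scal,
      Matrix.transpose_transpose, ← mul_assoc, key, Matrix.transpose_transpose, scal_op]
  · intro e he
    have h1 := tpow_op_mul (2 * n) (coinv n q X) X hSX
    have h2 : (tpow (2 * n) ((coinv n q X).map op)).map unop *ᵥ
        (fun j => algebraMap ℂ B (e j)) = fun i => algebraMap ℂ B (e i) := by
      conv_lhs => rw [← hX.det e he]
      rw [Matrix.mulVec_mulVec, h1, Matrix.one_mulVec]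
    funext i
    have h3 := congrArg op (congrFun h2 i)
    simp only [Matrix.mulVec, dotProduct, Matrix.map_apply, Finset.op_sum] at h3 ⊢
    refine Eq.trans (Finset.sum_congr rfl fun j _ => ?_) h3
    rw [← Algebra.commutes, op_mul, op_unop]
    rfl

/-- `T ↦ T ⊗ T` (matrix product of the two factors) is `q`-orthogonal over `A ⊗ A`. -/
lemma comul_isQOrthogonal (n : ℕ) (q : ℂˣ) :
    IsQOrthogonal n q ((gen n q).map (Algebra.TensorProduct.includeLeft (R := ℂ) (S := ℂ)
        (A := SOq n q) (B := SOq n q)) *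
      (gen n q).map (Algebra.TensorProduct.includeRight (R := ℂ) (A := SOq n q)
        (B := SOq n q))) :=
  ((gen_isQOrthogonal n q).map _).mul ((gen_isQOrthogonal n q).map _) fun a b c d => by
    simp [Commute, SemiconjBy]

end Helpers

/-- The coproduct `Δ(T^a_b) = T^a_c ⊗ T^c_b`. -/
def comulHom (n : ℕ) (q : ℂˣ) : SOq n q →ₐ[ℂ] SOq n q ⊗[ℂ] SOq n q :=
  lift _ (comul_isQOrthogonal n q)

/-- The counit `ε(T^a_b) = δ^a_b`. -/
def counitHom (n : ℕ) (q : ℂˣ) : SOq n q →ₐ[ℂ] ℂ := lift 1 (one_isQOrthogonal n q)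

/-- The antipode `κ(T) = C Tᵗ C` as an algebra map into the opposite algebra. -/
def antipodeHom (n : ℕ) (q : ℂˣ) : SOq n q →ₐ[ℂ] (SOq n q)ᵐᵒᵖ :=
  lift _ (gen_isQOrthogonal n q).coinv_op

lemma comulHom_gen (n : ℕ) (q : ℂˣ) (a b : Fin (2 * n)) :
    comulHom n q (gen n q a b) = ∑ c, gen n q a c ⊗ₜ[ℂ] gen n q c b := by
  simp [comulHom, Matrix.mul_apply]

lemma counitHom_gen (n : ℕ) (q : ℂˣ) (a b : Fin (2 * n)) :
    counitHom n q (gen n q a b) = (1 : Matrix _ _ ℂ) a b := lift_gen _ _ a b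

lemma antipodeHom_gen (n : ℕ) (q : ℂˣ) (a b : Fin (2 * n)) :
    antipodeHom n q (gen n q a b) = MulOpposite.op (coinv n q (gen n q) a b) := lift_gen _ _ a b

instance (n : ℕ) (q : ℂˣ) : Bialgebra ℂ (SOq n q) :=
  Bialgebra.ofAlgHom (comulHom n q) (counitHom n q)
    (algHom_ext fun a b => by
      simp only [AlgHom.comp_apply, comulHom_gen, map_sum, Algebra.TensorProduct.map_tmul,
        AlgHom.id_apply, TensorProduct.sum_tmul, TensorProduct.tmul_sum]
      exact Finset.sum_comm)
    (algHom_ext fun a b => by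
      simp only [AlgHom.comp_apply, comulHom_gen, map_sum, Algebra.TensorProduct.map_tmul,
        AlgHom.id_apply, counitHom_gen, Matrix.one_apply, TensorProduct.ite_tmul,
        Finset.sum_ite_eq, Finset.mem_univ, if_true]
      rfl)
    (algHom_ext fun a b => by
      simp only [AlgHom.comp_apply, comulHom_gen, map_sum, Algebra.TensorProduct.map_tmul,
        AlgHom.id_apply, counitHom_gen, Matrix.one_apply, TensorProduct.tmul_ite,
        Finset.sum_ite_eq', Finset.mem_univ, if_true]
      rfl)

/-- The antipode as a linear map. -/
def antipodeLin (n : ℕ) (q : ℂˣ) : SOq n q →ₗ[ℂ] SOq n q :=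
  (MulOpposite.opLinearEquiv ℂ).symm.toLinearMap ∘ₗ (antipodeHom n q).toLinearMap

section Antipode

variable {n : ℕ} {q : ℂˣ}

lemma antipodeLin_gen (a b : Fin (2 * n)) :
    antipodeLin n q (gen n q a b) = coinv n q (gen n q) a b := by
  simp [antipodeLin, antipodeHom_gen]

lemma antipodeLin_mul (x y : SOq n q) :
    antipodeLin n q (x * y) = antipodeLin n q y * antipodeLin n q x := by
  simp [antipodeLin]

lemma antipodeLin_algebraMap (c : ℂ) :
    antipodeLin n q (algebraMap ℂ _ c) = algebraMap ℂ _ c := by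
  simp [antipodeLin]

/-- Induction on elements of `SO_q(2n)`. -/
lemma SOq.induction {P : SOq n q → Prop} (h0 : ∀ c : ℂ, P (algebraMap ℂ _ c))
    (h1 : ∀ a b, P (gen n q a b)) (h2 : ∀ x y, P x → P y → P (x * y))
    (h3 : ∀ x y, P x → P y → P (x + y)) (x : SOq n q) : P x := by
  obtain ⟨y, rfl⟩ : ∃ y, SOq.mk n q y = x := RingQuot.mkAlgHom_surjective ℂ (Rel n q) x
  induction y using FreeAlgebra.induction with
  | grade0 c => rw [AlgHom.commutes]; exact h0 c
  | grade1 p => exact h1 p.1 p.2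
  | mul x y hx hy => rw [map_mul]; exact h2 _ _ hx hy
  | add x y hx hy => rw [map_add]; exact h3 _ _ hx hy

/-- The map `x ⊗ y ↦ κ(x) y`. -/
def mulL (n : ℕ) (q : ℂˣ) : SOq n q ⊗[ℂ] SOq n q →ₗ[ℂ] SOq n q :=
  LinearMap.mul' ℂ (SOq n q) ∘ₗ (antipodeLin n q).rTensor (SOq n q)

/-- The map `x ⊗ y ↦ x κ(y)`. -/
def mulR (n : ℕ) (q : ℂˣ) : SOq n q ⊗[ℂ] SOq n q →ₗ[ℂ] SOq n q :=
  LinearMap.mul' ℂ (SOq n q) ∘ₗ (antipodeLin n q).lTensor (SOq n q)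

lemma mulL_tmul (x y : SOq n q) : mulL n q (x ⊗ₜ y) = antipodeLin n q x * y := by
  simp [mulL]

lemma mulR_tmul (x y : SOq n q) : mulR n q (x ⊗ₜ y) = x * antipodeLin n q y := by
  simp [mulR]

lemma mulL_mul_tmul (u : SOq n q ⊗[ℂ] SOq n q) (x y : SOq n q) :
    mulL n q (u * x ⊗ₜ y) = antipodeLin n q x * mulL n q u * y := by
  induction u using TensorProduct.induction_on with
  | zero => simp
  | tmul a b =>
    rw [Algebra.TensorProduct.tmul_mul_tmul, mulL_tmul, mulL_tmul, antipodeLin_mul]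
    simp only [mul_assoc]
  | add a b ha hb => rw [add_mul, map_add, map_add, ha, hb, mul_add, add_mul]

lemma mulR_tmul_mul (v : SOq n q ⊗[ℂ] SOq n q) (x y : SOq n q) :
    mulR n q (x ⊗ₜ y * v) = x * mulR n q v * antipodeLin n q y := by
  induction v using TensorProduct.induction_on with
  | zero => simp
  | tmul a b =>
    rw [Algebra.TensorProduct.tmul_mul_tmul, mulR_tmul, mulR_tmul, antipodeLin_mul]
    simp only [mul_assoc]
  | add a b ha hb => rw [mul_add, map_add, map_add, ha, hb, mul_add, add_mul]

lemma mulL_mul (u v : SOq n q ⊗[ℂ] SOq n q) (c : ℂ)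
    (hu : mulL n q u = algebraMap ℂ _ c) : mulL n q (u * v) = c • mulL n q v := by
  induction v using TensorProduct.induction_on with
  | zero => simp
  | tmul a b =>
    rw [mulL_mul_tmul, mulL_tmul, hu, ← Algebra.commutes, mul_assoc, Algebra.smul_def]
  | add a b ha hb => rw [mul_add, map_add, map_add, ha, hb, smul_add]

lemma mulR_mul (u v : SOq n q ⊗[ℂ] SOq n q) (c : ℂ)
    (hv : mulR n q v = algebraMap ℂ _ c) : mulR n q (u * v) = c • mulR n q u := by
  induction u using TensorProduct.induction_on with
  | zero => simp
  | tmul a b =>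
    rw [mulR_tmul_mul, mulR_tmul, hv, ← Algebra.commutes, mul_assoc, Algebra.smul_def]
  | add a b ha hb => rw [add_mul, map_add, map_add, ha, hb, smul_add]

lemma mulL_comul (x : SOq n q) :
    mulL n q (comulHom n q x) = algebraMap ℂ _ (counitHom n q x) := by
  induction x using SOq.induction with
  | h0 c =>
    rw [AlgHom.commutes, AlgHom.commutes, Algebra.TensorProduct.algebraMap_apply, mulL_tmul,
      antipodeLin_algebraMap, mul_one]
    rfl
  | h1 a b =>
    rw [comulHom_gen, counitHom_gen, map_sum]
    simp only [mulL_tmul, antipodeLin_gen]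
    have h := congrFun (congrFun (coinv_mul (gen_isQOrthogonal n q)) a) b
    rw [Matrix.mul_apply] at h
    rw [h, Matrix.one_apply, Matrix.one_apply]
    split_ifs <;> simp
  | h2 x y hx hy => rw [map_mul, mulL_mul _ _ _ hx, hy, map_mul, map_mul, Algebra.smul_def]
  | h3 x y hx hy => simp only [map_add, hx, hy]

lemma mulR_comul (x : SOq n q) :
    mulR n q (comulHom n q x) = algebraMap ℂ _ (counitHom n q x) := by
  induction x using SOq.induction with
  | h0 c =>
    rw [AlgHom.commutes, AlgHom.commutes, Algebra.TensorProduct.algebraMap_apply, mulR_tmul,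
      ← map_one (algebraMap ℂ (SOq n q)), antipodeLin_algebraMap, map_one, mul_one]
    rfl
  | h1 a b =>
    rw [comulHom_gen, counitHom_gen, map_sum]
    simp only [mulR_tmul, antipodeLin_gen]
    have h := congrFun (congrFun (mul_coinv (gen_isQOrthogonal n q)) a) b
    rw [Matrix.mul_apply] at h
    rw [h, Matrix.one_apply, Matrix.one_apply]
    split_ifs <;> simp
  | h2 x y hx hy =>
    rw [map_mul, mulR_mul _ _ _ hy, hx, map_mul, map_mul, Algebra.smul_def, Algebra.commutes]
  | h3 x y hx hy => simp only [map_add, hx, hy]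

end Antipode

instance (n : ℕ) (q : ℂˣ) : HopfAlgebra ℂ (SOq n q) where
  antipode := antipodeLin n q
  mul_antipode_rTensor_comul := LinearMap.ext fun x => mulL_comul x
  mul_antipode_lTensor_comul := LinearMap.ext fun x => mulR_comul x

/-! ### Star structures -/

section Star

variable {A : Type*} [Ring A] [HopfAlgebra ℂ A]

/-- A `*`-structure (conjugation) on a Hopf algebra: an antilinear, antimultiplicative
involution compatible with coproduct and counit. -/
structure IsStarStructure (s : A →ₛₗ[starRingEnd ℂ] A) : Prop where
  map_mul : ∀ x y, s (x * y) = s y * s x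
  involutive : ∀ x, s (s x) = x
  comul : ∀ x, Coalgebra.comul (R := ℂ) (s x) =
    TensorProduct.map s s (Coalgebra.comul (R := ℂ) x)
  counit : ∀ x, Coalgebra.counit (R := ℂ) (s x) = conj (Coalgebra.counit (R := ℂ) x)

/-- A bialgebra automorphism is a Hopf algebra automorphism when it is compatible with the
antipode. -/
def IsHopfAut (φ : A ≃ₐc[ℂ] A) : Prop :=
  ∀ x, φ (HopfAlgebra.antipode ℂ x) = HopfAlgebra.antipode ℂ (φ x)

/-- The star structures `s` and `s'` are equivalent: `s' = α ∘ s ∘ α⁻¹` for a Hopf algebra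
automorphism `α`. -/
def StarEquivalent (s s' : A →ₛₗ[starRingEnd ℂ] A) : Prop :=
  ∃ α : A ≃ₐc[ℂ] A, IsHopfAut α ∧ ∀ x, s' x = α (s (α.symm x))

/-- The composition `φ ∘ s`. -/
def compStar (φ : A ≃ₐc[ℂ] A) (s : A →ₛₗ[starRingEnd ℂ] A) : A →ₛₗ[starRingEnd ℂ] A where
  toFun x := φ (s x)
  map_add' x y := by simp
  map_smul' c x := by simp

end Star

/-! ### The conjugations `⋆` and `×` and the automorphisms `T ↦ D T D⁻¹` -/

/-- The conjugation `⋆`: `T^⋆ = κ(T)ᵗ = Cᵗ T Cᵗ`. -/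
def IsMetricStar (n : ℕ) (q : ℂˣ) (s : SOq n q →ₛₗ[starRingEnd ℂ] SOq n q) : Prop :=
  IsStarStructure s ∧
    (gen n q).map s = scal _ (metric n q)ᵀ * gen n q * scal _ (metric n q)ᵀ

/-- The conjugation `×`: `T^× = T`. -/
def IsTrivialStar (n : ℕ) (q : ℂˣ) (s : SOq n q →ₛₗ[starRingEnd ℂ] SOq n q) : Prop :=
  IsStarStructure s ∧ (gen n q).map s = gen n q

/-- The automorphism `T ↦ D T D⁻¹`. -/
def IsConjBy (n : ℕ) (q : ℂˣ) (D : Matrix (Fin (2 * n)) (Fin (2 * n)) ℂ)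
    (φ : SOq n q ≃ₐc[ℂ] SOq n q) : Prop :=
  (gen n q).map φ = scal _ D * gen n q * scal _ D⁻¹

/-- Sign vectors with `ε_j² = 1`, `ε_{j'} = -ε_j` and `ε_n = -ε_{n+1} = 1`. -/
structure IsSignVector (n : ℕ) (ε : Fin (2 * n) → ℝ) : Prop where
  sq : ∀ j, ε j ^ 2 = 1
  rev : ∀ j, ε (Fin.rev j) = -ε j
  left : ∀ j : Fin (2 * n), (j : ℕ) + 1 = n → ε j = 1
  right : ∀ j : Fin (2 * n), (j : ℕ) = n → ε j = -1

/-- The matrix `𝒟'' = i diag(ε_1, …, ε_{2n})`. -/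
def dMatrix (n : ℕ) (ε : Fin (2 * n) → ℝ) : Matrix (Fin (2 * n)) (Fin (2 * n)) ℂ :=
  Matrix.diagonal fun j => Complex.I * (ε j : ℂ)

/-! ### The classical group `SO*(2n)` -/

/-- `J = (0, 1_n; -1_n, 0)`. -/
def jMatrix (n : ℕ) : Matrix (Fin (2 * n)) (Fin (2 * n)) ℂ :=
  Matrix.of fun a b =>
    if (b : ℕ) = (a : ℕ) + n then 1 else if (a : ℕ) = (b : ℕ) + n then -1 else 0

/-- `SO*(2n)`: the complex matrices `O` with `Oᵗ O = 1` and `Ōᵗ J O = J`. -/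
def SOStar (n : ℕ) : Set (Matrix (Fin (2 * n)) (Fin (2 * n)) ℂ) :=
  {O | Oᵀ * O = 1 ∧ Oᴴ * jMatrix n * O = jMatrix n}

/-- The real form of `SO(2n, ℂ)` determined by a conjugation `s` on the algebra `SO_q(2n)`
at `q = 1`: the points `χ` with `f^s(χ) = conj (f(χ))` for all functions `f`, given by their
matrices `T(χ)`. -/
def realPoints (n : ℕ) (s : SOq n 1 →ₛₗ[starRingEnd ℂ] SOq n 1) :
    Set (Matrix (Fin (2 * n)) (Fin (2 * n)) ℂ) :=
  {g | ∃ χ : SOq n 1 →ₐ[ℂ] ℂ, (∀ f, χ (s f) = conj (χ f)) ∧ g = (gen n 1).map χ}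

end QOrth
end

noncomputable section

namespace QOrth

/-! ### Twisting matrices by monomial transformations -/

section Twist

variable {ι κ : Type*} {B : Type*} [Semiring B] [Algebra ℂ B]

/-! Every map in the theorem sends `T` to `D T D⁻¹` with `D` a monomial matrix (diagonal times
permutation), linearly and multiplicatively for the automorphisms, antilinearly and
antimultiplicatively for the conjugations. So everything reduces to a few symmetries of the
numerical data `R`, `C` and of the space of q-antisymmetric tensors, and the universal property of
the algebra does the rest.

Automorphisms: `R` preserves weights (`rMatrix_weight`), so a diagonal `D` with `d_a d_{a'} = 1`
commutes with `R` in the tensor square and is orthogonal for `C`. The entries `i ε_a` qualify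
because the two signs, from `i²` and from `ε_a ε_{a'}`, cancel. The determinant relation survives
because `D⁻¹` in every slot preserves q-antisymmetry; uniqueness of the epsilon tensor is never
needed.

Conjugations: an antilinear antihomomorphism is an algebra map into the opposite algebra with
conjugated scalars (`ConjOp`). Hence the conjugate of `R`, transformed by `D`, must satisfy the RTT
relation with `T₁T₂` and `T₂T₁` exchanged. Two matrices do: `R₂₁` and `R⁻¹`. For real `q`, `R` is
real and `Cᵗ` carries `R₂₁` to `R` (`rMatrix_swap_swap`), which gives `⋆`. For `|q| = 1`, the
conjugate of `R(q)` is `R(q⁻¹) = R(q)⁻¹` (`rMatrix_mul_rMatrix_inv`), which gives `×`. Compatibility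
with the Hopf structure and commutation with `♮` are checked on generators. The equivalence of `×`
and `×^♮` is conjugation by a unitary diagonal square root of `𝒟''`.

Classical limit: at `q = 1` one has `R = 1`, so the algebra is commutative, and permutations
exchanging some `a` with `a'` relate the different sign vectors. A matrix `M` with `MᵗM = C` and `M̄
C 𝒟'' = J M` (`basisChange`) turns the relations and the conjugation into the conditions of
`SO*(2n)`. Real points map into `SO*(2n)` by evaluating matrix identities. For surjectivity a point
must have determinant one, which the definition of `SO*(2n)` does not ask for; it follows from the
quaternionic structure `x ↦ J x̄` (`det_eq_one_of_quaternionic`): nonreal eigenvalues come in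
conjugate pairs and real ones have even multiplicity, so the determinant is nonnegative, and its
square is one. -/

/-- The conjugate `M X M⁻¹` of `X` by the monomial matrix `M` with `M_{a, τ a} = w a`. -/
def twist (w : κ → ℂ) (τ : Equiv.Perm κ) (X : Matrix κ κ B) : Matrix κ κ B :=
  Matrix.of fun a b => (w a * (w b)⁻¹) • X (τ a) (τ b)

lemma twist_apply (w : κ → ℂ) (τ : Equiv.Perm κ) (X : Matrix κ κ B) (a b : κ) :
    twist w τ X a b = (w a * (w b)⁻¹) • X (τ a) (τ b) := rfl

lemma twist_mul [Fintype κ] {w : κ → ℂ} (hw : ∀ a, w a ≠ 0) (τ : Equiv.Perm κ)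
    (X Y : Matrix κ κ B) : twist w τ (X * Y) = twist w τ X * twist w τ Y := by
  ext a b
  simp only [twist_apply, Matrix.mul_apply, Finset.smul_sum]
  rw [← Equiv.sum_comp τ]
  refine Finset.sum_congr rfl fun c _ => ?_
  rw [smul_mul_smul_comm]
  congr 1
  have := hw c
  field_simp

lemma twist_scal (w : κ → ℂ) (τ : Equiv.Perm κ) (M : Matrix κ κ ℂ) :
    twist w τ (scal B M) = scal B (twist w τ M) := by
  ext a b
  simp [twist_apply, scal, Algebra.smul_def]

lemma twist_one_one (X : Matrix κ κ B) : twist 1 1 X = X := by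
  ext a b
  simp [twist_apply]

/-- The weight of a pair of indices. -/
def pairWeight (v : ι → ℂ) (x : ι × ι) : ℂ := v x.1 * v x.2

/-- The tensor square of a monomial matrix is again monomial, so both products in the RTT relation
transform by a single twist on pairs of indices. -/
lemma leg₁_mul_leg₂_twist [Fintype ι] [DecidableEq ι] (v : ι → ℂ) (σ : Equiv.Perm ι)
    (X : Matrix ι ι B) :
    leg₁ (twist v σ X) * leg₂ (twist v σ X) =
      twist (pairWeight v) (σ.prodCongr σ) (leg₁ X * leg₂ X) := by
  ext ⟨a, b⟩ ⟨c, d⟩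
  rw [twist_apply, leg₁_mul_leg₂_apply, Equiv.prodCongr_apply, Prod.map_apply, Prod.map_apply,
    leg₁_mul_leg₂_apply, twist_apply, twist_apply, smul_mul_smul_comm]
  simp only [pairWeight, mul_inv]
  congr 1
  ring

lemma leg₂_mul_leg₁_twist [Fintype ι] [DecidableEq ι] (v : ι → ℂ) (σ : Equiv.Perm ι)
    (X : Matrix ι ι B) :
    leg₂ (twist v σ X) * leg₁ (twist v σ X) =
      twist (pairWeight v) (σ.prodCongr σ) (leg₂ X * leg₁ X) := by
  ext ⟨a, b⟩ ⟨c, d⟩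
  rw [twist_apply, leg₂_mul_leg₁_apply, Equiv.prodCongr_apply, Prod.map_apply, Prod.map_apply,
    leg₂_mul_leg₁_apply, twist_apply, twist_apply, smul_mul_smul_comm]
  simp only [pairWeight, mul_inv]
  congr 1
  ring

lemma tpow_twist (m : ℕ) (v : ι → ℂ) (σ : Equiv.Perm ι) (X : Matrix ι ι B)
    (i j : Fin m → ι) :
    tpow m (twist v σ X) i j =
      ((∏ k, v (i k)) * (∏ k, v (j k))⁻¹) • tpow m X (σ ∘ i) (σ ∘ j) := by
  induction m with
  | zero => simp [tpow]
  | succ m ih =>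
    rw [tpow_succ_apply, tpow_succ_apply, ih, twist_apply, smul_mul_smul_comm, Fin.prod_univ_succ,
      Fin.prod_univ_succ]
    congr 1
    simp only [mul_inv, Fin.tail]
    ring

/-- With `D` the monomial matrix, `hM` reads `M' = D M Dᵗ`, and the inner factors cancel around `M`.
A different `M'` is allowed because for conjugations it is the conjugate transpose of `C`. -/
lemma twist_mul_scal_mul_transpose [Fintype ι] (v : ι → ℂ) (hv : ∀ a, v a ≠ 0)
    (σ : Equiv.Perm ι) (X : Matrix ι ι B) {M M' : Matrix ι ι ℂ}
    (hM : ∀ a b, v a * v b * M (σ a) (σ b) = M' a b)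
    (hX : X * scal B M * Xᵀ = scal B M) :
    twist v σ X * scal B M' * (twist v σ X)ᵀ = scal B M' := by
  ext a b
  have h := congrFun (congrFun hX (σ a)) (σ b)
  simp only [Matrix.mul_apply, Finset.sum_mul, Matrix.transpose_apply, scal,
    Matrix.map_apply, twist_apply] at h ⊢
  rw [← hM, map_mul, ← h, Finset.mul_sum]
  conv_rhs => rw [← Equiv.sum_comp σ]
  refine Finset.sum_congr rfl fun c _ => ?_
  rw [Finset.mul_sum]
  conv_rhs => rw [← Equiv.sum_comp σ]
  refine Finset.sum_congr rfl fun d _ => ?_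
  rw [← hM, ← Algebra.commutes, ← Algebra.commutes, ← Algebra.smul_def, ← Algebra.smul_def,
    ← Algebra.smul_def]
  simp only [smul_mul_assoc, mul_smul_comm, smul_smul]
  congr 1
  have := hv c
  have := hv d
  field_simp

/-- Here `hM` reads `Dᵗ M' D = M`, the contragredient of the rule for `X M Xᵗ`. -/
lemma transpose_mul_scal_mul_twist [Fintype ι] (v : ι → ℂ) (hv : ∀ a, v a ≠ 0)
    (σ : Equiv.Perm ι) (X : Matrix ι ι B) {M M' : Matrix ι ι ℂ}
    (hM : ∀ a b, v a * v b * M' a b = M (σ a) (σ b))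
    (hX : Xᵀ * scal B M * X = scal B M) :
    (twist v σ X)ᵀ * scal B M' * twist v σ X = scal B M' := by
  ext a b
  have hM' : ∀ a b, (v a * v b)⁻¹ * M (σ a) (σ b) = M' a b := fun a b => by
    rw [← hM]
    have := hv a
    have := hv b
    field_simp
  have h := congrFun (congrFun hX (σ a)) (σ b)
  simp only [Matrix.mul_apply, Finset.sum_mul, Matrix.transpose_apply, scal,
    Matrix.map_apply, twist_apply] at h ⊢
  rw [← hM', map_mul, ← h, Finset.mul_sum]
  conv_rhs => rw [← Equiv.sum_comp σ]
  refine Finset.sum_congr rfl fun c _ => ?_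
  rw [Finset.mul_sum]
  conv_rhs => rw [← Equiv.sum_comp σ]
  refine Finset.sum_congr rfl fun d _ => ?_
  rw [← hM', ← Algebra.commutes, ← Algebra.commutes, ← Algebra.smul_def, ← Algebra.smul_def,
    ← Algebra.smul_def]
  simp only [smul_mul_assoc, mul_smul_comm, smul_smul]
  congr 1
  have := hv c
  have := hv d
  field_simp

end Twist

/-! ### Tensors that are eigenvectors in each pair of neighbouring indices -/

section LocalEigen

variable {ι : Type*} [Fintype ι] {m : ℕ}

/-- `e` is an eigenvector of `M` for the eigenvalue `c` in each pair of neighbouring indices. -/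
def LocalEigen (M : Matrix (ι × ι) (ι × ι) ℂ) (c : ℂ) (e : (Fin m → ι) → ℂ) : Prop :=
  ∀ (k l : Fin m), (l : ℕ) = (k : ℕ) + 1 → ∀ i : Fin m → ι,
    ∑ x : ι × ι, M (i k, i l) x * e (Function.update (Function.update i k x.1) l x.2) = c * e i

/-- Swapping the row index only turns `R` into its braid form `R̂`; in this form the transformations
of local eigenvectors can be studied for arbitrary matrices. -/
lemma isQAntisymm_iff {n : ℕ} {q : ℂˣ} {e : (Fin (2 * n) → Fin (2 * n)) → ℂ} :
    IsQAntisymm n q e ↔ LocalEigen ((rMatrix n q).submatrix Prod.swap id) (-(q : ℂ)⁻¹) e := by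
  simp only [IsQAntisymm, LocalEigen, Fintype.sum_prod_type, Matrix.submatrix_apply,
    Prod.swap_prod_mk, id]

variable {M : Matrix (ι × ι) (ι × ι) ℂ} {c : ℂ} {e : (Fin m → ι) → ℂ}

lemma LocalEigen.conj (h : LocalEigen M c e) :
    LocalEigen (M.map conj) (conj c) (fun i => conj (e i)) := by
  intro k l hkl i
  have := congrArg (starRingEnd ℂ) (h k l hkl i)
  simpa only [map_sum, map_mul, Matrix.map_apply] using this

lemma LocalEigen.inverse [DecidableEq ι] (h : LocalEigen M c e) (hc : c ≠ 0)
    {N : Matrix (ι × ι) (ι × ι) ℂ} (hN : N * M = 1) : LocalEigen N c⁻¹ e := by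
  intro k l hkl i
  have hne : k ≠ l := by
    rintro rfl
    omega
  -- The eigenvalue equation at each modified index is solved for the entry of `e`; the second pair
  -- of updates overwrites the first, so `M` and `N` compose as matrices.
  have h1 : ∀ x : ι × ι, e (Function.update (Function.update i k x.1) l x.2) =
      c⁻¹ * ∑ y : ι × ι, M x y * e (Function.update (Function.update i k y.1) l y.2) := by
    intro x
    have h2 := h k l hkl (Function.update (Function.update i k x.1) l x.2)
    rw [eq_inv_mul_iff_mul_eq₀ hc, ← h2]
    refine Finset.sum_congr rfl fun y _ => ?_
    rw [Function.update_self, Function.update_of_ne hne, Function.update_self,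
      Function.update_comm hne.symm, Function.update_idem, Function.update_idem]
  calc ∑ x : ι × ι, N (i k, i l) x * e (Function.update (Function.update i k x.1) l x.2)
      = ∑ x : ι × ι, ∑ y : ι × ι, c⁻¹ * (N (i k, i l) x * M x y *
          e (Function.update (Function.update i k y.1) l y.2)) := by
        refine Finset.sum_congr rfl fun x _ => ?_
        rw [h1 x, Finset.mul_sum, Finset.mul_sum]
        exact Finset.sum_congr rfl fun y _ => by ring
    _ = ∑ y : ι × ι, c⁻¹ * ((N * M) (i k, i l) y *
          e (Function.update (Function.update i k y.1) l y.2)) := by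
        rw [Finset.sum_comm]
        refine Finset.sum_congr rfl fun y _ => ?_
        rw [Matrix.mul_apply, Finset.sum_mul, Finset.mul_sum]
    _ = c⁻¹ * e i := by
        rw [Finset.sum_eq_single (i k, i l)]
        · simp [hN]
        · intro y _ hy
          rw [hN, Matrix.one_apply_ne (Ne.symm hy), zero_mul, mul_zero]
        · simp

/-- `hM` is an intertwining relation in two slots. Acting by the monomial matrix in all slots only
adds the weights of the remaining ones, which are a common factor. -/
lemma LocalEigen.twist (h : LocalEigen M c e) (t : ι → ℂ) (τ : Equiv.Perm ι)
    {M' : Matrix (ι × ι) (ι × ι) ℂ}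
    (hM : ∀ x y, M' x y * pairWeight t y =
      pairWeight t x * M (τ x.1, τ x.2) (τ y.1, τ y.2)) :
    LocalEigen M' c (fun i => (∏ k, t (i k)) * e (τ ∘ i)) := by
  classical
  intro k l hkl i
  have hne : k ≠ l := by
    rintro rfl
    omega
  have hsplit : ∀ j : Fin m → ι, ∏ k, t (j k) =
      t (j k) * t (j l) * ∏ r ∈ (Finset.univ.erase k).erase l, t (j r) := by
    intro j
    rw [← Finset.mul_prod_erase _ _ (Finset.mem_univ k),
      ← Finset.mul_prod_erase _ _ (Finset.mem_erase.2 ⟨hne.symm, Finset.mem_univ l⟩), mul_assoc]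
  have h1 := h k l hkl (τ ∘ i)
  rw [← (τ.prodCongr τ).sum_comp] at h1
  simp only [mul_left_comm c, ← h1, Finset.mul_sum]
  refine Finset.sum_congr rfl fun x _ => ?_
  rw [hsplit, hsplit, Function.update_self, Function.update_of_ne hne, Function.update_self]
  have h2 : ∏ r ∈ (Finset.univ.erase k).erase l,
      t (Function.update (Function.update i k x.1) l x.2 r) =
      ∏ r ∈ (Finset.univ.erase k).erase l, t (i r) := by
    refine Finset.prod_congr rfl fun r hr => ?_
    simp only [Finset.mem_erase, Finset.mem_univ, and_true] at hr
    rw [Function.update_of_ne hr.1, Function.update_of_ne hr.2]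
  have h3 : τ ∘ Function.update (Function.update i k x.1) l x.2 =
      Function.update (Function.update (τ ∘ i) k (τ x.1)) l (τ x.2) := by
    rw [Function.comp_update, Function.comp_update]
  have h4 := hM (i k, i l) x
  simp only [pairWeight] at h4
  rw [h2, h3]
  simp only [Equiv.prodCongr_apply, Function.comp_apply,
    Prod.map]
  linear_combination (∏ r ∈ (Finset.univ.erase k).erase l, t (i r)) *
    e (Function.update (Function.update (τ ∘ i) k (τ x.1)) l (τ x.2)) * h4

/-- Reversal sends the neighbouring slots `k, l` to `l', k'`, which exchanges the two tensor factors
of `M`. It is needed because antihomomorphisms reverse words. -/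
lemma LocalEigen.reverse (h : LocalEigen M c e) :
    LocalEigen (M.submatrix Prod.swap Prod.swap) c (fun i => e (i ∘ Fin.rev)) := by
  intro k l hkl i
  have hne : k ≠ l := by
    rintro rfl
    omega
  have h1 := h l.rev k.rev (by simp only [Fin.val_rev]; omega) (i ∘ Fin.rev)
  rw [← (Equiv.prodComm ι ι).sum_comp] at h1
  simp only [← h1]
  refine Finset.sum_congr rfl fun x _ => ?_
  simp only [Matrix.submatrix_apply, Prod.swap_prod_mk, Function.comp_apply, Fin.rev_rev,
    Equiv.prodComm_apply]
  congr 2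
  funext r
  simp only [Function.comp_apply, Function.update_apply, Fin.rev_eq_iff,
    Prod.fst_swap, Prod.snd_swap]
  have : r = k.rev → r ≠ l.rev := by
    rintro rfl hr
    exact hne (Fin.rev_injective hr)
  split_ifs <;> simp_all

end LocalEigen

lemma tpow_map_op {ι B : Type*} [Semiring B] (m : ℕ) (X : Matrix ι ι B) (i j : Fin m → ι) :
    tpow m (X.map MulOpposite.op) i j =
      MulOpposite.op (tpow m X (i ∘ Fin.rev) (j ∘ Fin.rev)) := by
  simp only [tpow, Matrix.of_apply, Matrix.map_apply, Function.comp_apply]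
  apply MulOpposite.unop_injective
  rw [MulOpposite.unop_list_prod, MulOpposite.unop_op, List.map_ofFn]
  congr 1
  apply List.ext_getElem <;> simp
  intro r h1
  congr 2 <;> exact Fin.ext (by simp only [Fin.val_rev]; omega)

/-! ### Symmetries of the `R`-matrix and the metric -/

section RMatrix

variable {n : ℕ}

lemma rev_ne_self (a : Fin (2 * n)) : Fin.rev a ≠ a := by
  intro h
  have := congrArg Fin.val h
  rw [Fin.val_rev] at this
  omega

lemma rMatrix_apply (q : ℂˣ) (a b c d : Fin (2 * n)) :
    rMatrix n q (a, b) (c, d) =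
      if c = a ∧ d = b then
        (if a = b then (q : ℂ) else if b = Fin.rev a then (q : ℂ)⁻¹ else 1)
      else if c = b ∧ d = a then
        (if b < a then
          (if b = Fin.rev a then ((q : ℂ) - (q : ℂ)⁻¹) * (1 - (q : ℂ) ^ (rho n a - rho n b))
          else (q : ℂ) - (q : ℂ)⁻¹)
        else 0)
      else if b = Fin.rev a ∧ d = Fin.rev c ∧ c < a then
        -((q : ℂ) - (q : ℂ)⁻¹) * (q : ℂ) ^ (rho n a - rho n c)
      else 0 := by
  simp only [rMatrix, Matrix.of_apply, Prod.swap_prod_mk, Prod.mk.injEq]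

/-- The `R`-matrix preserves weights. -/
lemma rMatrix_weight (q : ℂˣ) (v : Fin (2 * n) → ℂ) (hv : ∀ a, v a * v (Fin.rev a) = 1)
    (x y : Fin (2 * n) × Fin (2 * n)) :
    rMatrix n q x y * pairWeight v y = pairWeight v x * rMatrix n q x y := by
  obtain ⟨a, b⟩ := x
  obtain ⟨c, d⟩ := y
  by_cases h : pairWeight v (c, d) = pairWeight v (a, b)
  · rw [h, mul_comm]
  · have h1 : ¬ (c = a ∧ d = b) := by rintro ⟨rfl, rfl⟩; exact h rfl
    have h2 : ¬ (c = b ∧ d = a) := by rintro ⟨rfl, rfl⟩; exact h (mul_comm _ _)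
    have h3 : ¬ (b = Fin.rev a ∧ d = Fin.rev c ∧ c < a) := by
      rintro ⟨rfl, rfl, -⟩
      exact h ((hv c).trans (hv a).symm)
    rw [rMatrix_apply, if_neg h1, if_neg h2, if_neg h3]
    simp

/-- The map `a ↦ a'` reverses the order and changes the sign of `ρ`, so it matches the cases of `R`
with those of its flip. This is the symmetry behind `⋆`. -/
lemma rMatrix_swap_swap (q : ℂˣ) (a b c d : Fin (2 * n)) :
    rMatrix n q (b, a) (d, c) =
      rMatrix n q (Fin.rev a, Fin.rev b) (Fin.rev c, Fin.rev d) := by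
  rw [rMatrix_apply, rMatrix_apply]
  by_cases hab : b = Fin.rev a
  · subst hab
    by_cases hcd : d = Fin.rev c
    · subst hcd
      simp only [Fin.rev_rev, rev_rho, Fin.rev_lt_rev, Fin.rev_eq_iff]
    · simp only [Fin.rev_rev, rev_rho, Fin.rev_eq_iff]
      have h1 : ¬ (d = a.rev ∧ c = a) := by rintro ⟨rfl, rfl⟩; exact hcd rfl
      have h2 : ¬ (d = a ∧ c = a.rev) := by rintro ⟨rfl, rfl⟩; simp at hcd
      have h4 : ¬ (c = d.rev) := by rintro rfl; simp at hcd
      simp only [h1, h2, and_comm (a := c = a), and_comm (a := c = a.rev), h4, hcd, false_and, and_false, if_false]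
  · have h4 : ¬ (a = b.rev) := by rintro rfl; simp at hab
    simp only [Fin.rev_rev, rev_rho, Fin.rev_lt_rev, Fin.rev_eq_iff, hab, h4,
      and_comm (a := d = b), and_comm (a := d = a), eq_comm (a := b) (b := a), false_and, if_false]

lemma rMatrix_one : rMatrix n 1 = 1 := by
  ext ⟨a, b⟩ ⟨c, d⟩
  rw [rMatrix_apply, Matrix.one_apply]
  simp [eq_comm]

/-- The entries are Laurent polynomials in `q` with real coefficients. -/
lemma rMatrix_map_conj {q q' : ℂˣ} (h : conj (q : ℂ) = (q' : ℂ)) :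
    (rMatrix n q).map conj = rMatrix n q' := by
  ext ⟨a, b⟩ ⟨c, d⟩
  rw [Matrix.map_apply, rMatrix_apply, rMatrix_apply]
  simp only [apply_ite (starRingEnd ℂ), map_mul, map_sub, map_neg, map_inv₀, map_zpow₀, map_one,
    map_zero, h]

/-- The sum `∑_{j < a} (q - q⁻¹) q^{-2ρ_j}`. -/
lemma sum_rho (q : ℂˣ) (a : Fin (2 * n)) :
    ∑ b ∈ Finset.univ.filter (· < a), ((q : ℂ) - (q : ℂ)⁻¹) * (q : ℂ) ^ (-2 * rho n b) =
      (q : ℂ) ^ (-1 - 2 * rho n a) + (if (a : ℕ) < n then 0 else (q : ℂ) - (q : ℂ)⁻¹) -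
        (q : ℂ) ^ (1 - 2 * (n : ℤ)) := by
  have hq : (q : ℂ) ≠ 0 := q.ne_zero
  obtain ⟨a, ha⟩ := a
  induction a with
  | zero =>
    have hn : 0 < n := by omega
    rw [Finset.filter_false_of_mem (fun x _ => by simp [Fin.lt_def]), Finset.sum_empty, if_pos hn]
    simp only [rho, hn, if_true]
    rw [add_zero, eq_comm, sub_eq_zero]
    congr 1
    push_cast
    ring
  | succ a ih =>
    have h1 : Finset.univ.filter (· < (⟨a + 1, ha⟩ : Fin (2 * n))) =
        insert ⟨a, by omega⟩ (Finset.univ.filter (· < (⟨a, by omega⟩ : Fin (2 * n)))) := by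
      ext x
      simp only [Finset.mem_filter, Finset.mem_univ, true_and, Finset.mem_insert, Fin.lt_def,
        Fin.ext_iff]
      omega
    rw [h1, Finset.sum_insert (by simp), ih (by omega)]
    have h2 : ((q : ℂ) - (q : ℂ)⁻¹) * (q : ℂ) ^ (-2 * rho n ⟨a, by omega⟩) =
        (q : ℂ) ^ (1 - 2 * rho n ⟨a, by omega⟩) - (q : ℂ) ^ (-1 - 2 * rho n ⟨a, by omega⟩) := by
      rw [sub_mul, sub_eq_add_neg 1, zpow_add₀ hq, sub_eq_add_neg (-1), zpow_add₀ hq, neg_mul,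
        zpow_one, zpow_neg_one]
    rw [h2]
    -- The sum telescopes because `ρ` drops by one at each step, except in the middle, where it
    -- vanishes at two consecutive indices; that step leaves the correction `q - q⁻¹`.
    rcases lt_trichotomy (a + 1) n with h | h | h
    · have h' : a < n := by omega
      have : 1 - 2 * rho n ⟨a, by omega⟩ = -1 - 2 * rho n ⟨a + 1, ha⟩ := by
        simp only [rho, if_pos h, if_pos h']
        push_cast
        ring
      rw [if_pos h', if_pos h, this]
      ring
    · have h' : a < n := by omega
      have e1 : rho n ⟨a, by omega⟩ = 0 := by
        simp only [rho, if_pos h']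
        omega
      have e2 : rho n ⟨a + 1, ha⟩ = 0 := by
        simp only [rho, if_neg (not_lt.2 h.ge)]
        omega
      rw [e1, e2, if_pos h', if_neg (not_lt.2 h.ge), mul_zero, sub_zero, sub_zero, zpow_one,
        zpow_neg_one]
      ring
    · have h' : ¬ a < n := by omega
      have h'' : ¬ a + 1 < n := by omega
      have : 1 - 2 * rho n ⟨a, by omega⟩ = -1 - 2 * rho n ⟨a + 1, ha⟩ := by
        simp only [rho, if_neg h', if_neg h'']
        push_cast
        ring
      rw [if_neg h', if_neg h'', this]
      ring

end RMatrix

/-! ### The inverse of the `R`-matrix, one weight space at a time. -/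

section RInverse

variable {n : ℕ}

/-- Away from the zero weight space a row of `R` involves only `(a, b)` and `(b, a)`, so `R` is
there a sum of triangular blocks of size at most two. -/
lemma rMatrix_apply_of_ne (q : ℂˣ) {a b : Fin (2 * n)} (hab : b ≠ Fin.rev a)
    (y : Fin (2 * n) × Fin (2 * n)) :
    rMatrix n q (a, b) y = (if y = (a, b) then (if a = b then (q : ℂ) else 1) else 0) +
      (if y = (b, a) then (if b < a then (q : ℂ) - (q : ℂ)⁻¹ else 0) else 0) := by
  obtain ⟨c, d⟩ := y
  rw [rMatrix_apply]
  simp only [hab, if_false, false_and, Prod.mk.injEq]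
  by_cases h1 : c = a ∧ d = b
  · obtain ⟨rfl, rfl⟩ := h1
    rcases eq_or_ne c d with h | h
    · subst h
      simp
    · simp [h]
  · rw [if_neg h1, if_neg h1, zero_add]

/-- The entries of the `R`-matrix on the zero weight space. -/
def zeroWeightEntry (n : ℕ) (q : ℂˣ) (a c : Fin (2 * n)) : ℂ :=
  (if c = a then (q : ℂ)⁻¹ else 0) +
    (if c < a then ((q : ℂ) - (q : ℂ)⁻¹) *
      ((if c = Fin.rev a then 1 else 0) - (q : ℂ) ^ (rho n a - rho n c)) else 0)

lemma rMatrix_apply_rev (q : ℂˣ) (a : Fin (2 * n)) (y : Fin (2 * n) × Fin (2 * n)) :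
    rMatrix n q (a, Fin.rev a) y =
      if y.2 = Fin.rev y.1 then zeroWeightEntry n q a y.1 else 0 := by
  obtain ⟨c, d⟩ := y
  rw [rMatrix_apply]
  have h0 : a ≠ Fin.rev a := (rev_ne_self a).symm
  by_cases hd : d = Fin.rev c
  · subst hd
    simp only [Fin.rev_inj, and_self, h0, if_false, if_true, true_and, Fin.rev_inj,
      zeroWeightEntry]
    by_cases h1 : c = a
    · simp [h1]
    · simp only [h1, if_false, zero_add]
      by_cases h2 : c = a.rev
      · subst h2
        simp
      · rw [if_neg h2, if_neg fun h => h2 h.1]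
        split_ifs <;> ring
  · have h1 : ¬ (c = a ∧ d = Fin.rev a) := by rintro ⟨rfl, rfl⟩; exact hd rfl
    have h2 : ¬ (c = Fin.rev a ∧ d = a) := by rintro ⟨rfl, rfl⟩; simp at hd
    simp only [h1, h2, hd, if_false, false_and, and_false]

lemma sum_ite_lt_lt {a d : Fin (2 * n)} (h : d < a) (f : Fin (2 * n) → ℂ) :
    ∑ c, (if d < c ∧ c < a then f c else 0) =
      ∑ c ∈ Finset.univ.filter (· < a), f c - ∑ c ∈ Finset.univ.filter (· < d), f c - f d := by
  rw [Finset.sum_filter, Finset.sum_filter, eq_sub_iff_add_eq, eq_sub_iff_add_eq]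
  have h1 : f d = ∑ c, if c = d then f c else 0 := by simp
  conv_lhs => rw [h1]
  rw [← Finset.sum_add_distrib, ← Finset.sum_add_distrib]
  refine Finset.sum_congr rfl fun c _ => ?_
  rcases lt_trichotomy c d with h2 | h2 | h2
  · simp [h2, h2.ne, h2.trans h, not_lt.2 h2.le]
  · simp [h2, h]
  · simp [h2, h2.ne', not_lt.2 h2.le]

/-- Both factors are triangular, so for `d < a` only `c = a`, `c = d` and `d < c < a` contribute.
The interior is a geometric sum given by `sum_rho`, plus Kronecker corrections at `c = a'` and `c =
d'`. -/
lemma sum_zeroWeightEntry (q : ℂˣ) (a d : Fin (2 * n)) :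
    ∑ c, zeroWeightEntry n q a c * zeroWeightEntry n q⁻¹ c d = if d = a then 1 else 0 := by
  have hq : (q : ℂ) ≠ 0 := q.ne_zero
  set l := (q : ℂ) - (q : ℂ)⁻¹ with hl
  -- The product of the two Kronecker symbols would force `a = d`, so it drops out in the interior.
  -- Since `ρ_{a'} = -ρ_a`, both remaining corrections carry the common factor `q^(ρ_a + ρ_d)`.
  have hexp : ∀ c, zeroWeightEntry n q a c * zeroWeightEntry n q⁻¹ c d =
      (if c = a then (q : ℂ)⁻¹ * zeroWeightEntry n q⁻¹ a d else 0) +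
      (if c = d then (if d < a then l * ((if d = Fin.rev a then 1 else 0) -
          (q : ℂ) ^ (rho n a - rho n d)) * q else 0) else 0) +
      (if d < c ∧ c < a then -l * (q : ℂ) ^ (rho n a + rho n d) *
        (l * (q : ℂ) ^ (-2 * rho n c) - (if c = Fin.rev a then l else 0) -
          (if c = Fin.rev d then l else 0)) else 0) := by
    intro c
    by_cases hca : c = a
    · subst hca
      have h1 : zeroWeightEntry n q c c = (q : ℂ)⁻¹ := by simp [zeroWeightEntry]
      rw [h1]
      by_cases hcd : c = d
      · simp [hcd]
      · simp [hcd]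
    · by_cases hcd : c = d
      · subst hcd
        simp only [zeroWeightEntry, hca, lt_irrefl, if_true, if_false, false_and]
        simp [hl]
      · simp only [zeroWeightEntry, hca, hcd, Ne.symm hcd, if_false, zero_add]
        by_cases h1 : c < a
        · by_cases h2 : d < c
          · simp only [h1, h2, if_true, and_self]
            have hda : d ≠ a := (h2.trans h1).ne
            have e0 : ((q⁻¹ : ℂˣ) : ℂ) - ((q⁻¹ : ℂˣ) : ℂ)⁻¹ = -l := by simp [hl]
            have e1 : ((q⁻¹ : ℂˣ) : ℂ) ^ (rho n c - rho n d) = (q : ℂ) ^ (rho n d - rho n c) := by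
              rw [Units.val_inv_eq_inv_val, inv_zpow, ← zpow_neg, neg_sub]
            rw [e0, e1]
            by_cases h3 : c = Fin.rev a
            · have h4 : d ≠ Fin.rev c := by
                rw [h3, Fin.rev_rev]
                exact hda
              have h5 : c ≠ Fin.rev d := by
                rintro rfl
                simp at h4
              rw [if_pos h3, if_neg h4, if_pos h3, if_neg h5]
              have e2 : rho n c = -rho n a := by rw [h3, rev_rho]
              rw [e2, show rho n a - -rho n a = rho n a + rho n a by ring,
                show rho n d - -rho n a = rho n d + rho n a by ring,
                show -2 * -rho n a = rho n a + rho n a by ring, zpow_add₀ hq, zpow_add₀ hq,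
                zpow_add₀ hq]
              ring
            · by_cases h4 : c = Fin.rev d
              · have h5 : d = Fin.rev c := by rw [h4, Fin.rev_rev]
                rw [if_neg h3, if_neg h3, if_pos h4, if_pos h5]
                have e2 : rho n c = -rho n d := by rw [h4, rev_rho]
                rw [e2, show rho n a - -rho n d = rho n a + rho n d by ring,
                  show rho n d - -rho n d = rho n d + rho n d by ring,
                  show -2 * -rho n d = rho n d + rho n d by ring, zpow_add₀ hq, zpow_add₀ hq]
                ring
              · have h5 : d ≠ Fin.rev c := by
                  rintro rfl
                  simp at h4
                rw [if_neg h3, if_neg h3, if_neg h4, if_neg h5]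
                rw [zero_sub, zero_sub, sub_zero, sub_zero, zpow_sub₀ hq, zpow_sub₀ hq,
                  zpow_add₀ hq, show -2 * rho n c = -rho n c + -rho n c by ring, zpow_add₀ hq,
                  zpow_neg]
                ring
          · simp [h2]
        · simp [h1]
  rw [Finset.sum_congr rfl fun c _ => hexp c, Finset.sum_add_distrib, Finset.sum_add_distrib,
    Finset.sum_ite_eq' Finset.univ a, if_pos (Finset.mem_univ _),
    Finset.sum_ite_eq' Finset.univ d, if_pos (Finset.mem_univ _)]
  by_cases hda : d < a
  · rw [sum_ite_lt_lt hda, ← Finset.mul_sum, ← Finset.mul_sum, Finset.sum_sub_distrib,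
      Finset.sum_sub_distrib, Finset.sum_sub_distrib, Finset.sum_sub_distrib, sum_rho, sum_rho,
      Finset.sum_ite_eq', Finset.sum_ite_eq', Finset.sum_ite_eq', Finset.sum_ite_eq']
    have hda' : (d : ℕ) < a := hda
    have ha := a.2
    have hd := d.2
    have e0 : ((q⁻¹ : ℂˣ) : ℂ) - ((q⁻¹ : ℂˣ) : ℂ)⁻¹ = -l := by simp [hl]
    have e1 : ((q⁻¹ : ℂˣ) : ℂ) ^ (rho n a - rho n d) = (q : ℂ) ^ (rho n d - rho n a) := by
      rw [Units.val_inv_eq_inv_val, inv_zpow, ← zpow_neg, neg_sub]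
    simp only [zeroWeightEntry, hda, hda.ne, (rev_ne_self d).symm, if_true, if_false, zero_add,
      e0, e1, Finset.mem_filter, Finset.mem_univ, true_and]
    have hu : (q : ℂ) ^ rho n a ≠ 0 := zpow_ne_zero _ hq
    have hw : (q : ℂ) ^ rho n d ≠ 0 := zpow_ne_zero _ hq
    rw [zpow_sub₀ hq, zpow_sub₀ hq, zpow_sub₀ hq, zpow_sub₀ hq (-1), zpow_add₀ hq,
      show 2 * rho n a = rho n a + rho n a by ring, show 2 * rho n d = rho n d + rho n d by ring,
      show -2 * rho n d = -(rho n d + rho n d) by ring, zpow_neg_one, zpow_neg, zpow_add₀ hq,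
      zpow_add₀ hq, ← hl]
    generalize (q : ℂ) ^ (1 - 2 * (n : ℤ)) = K
    simp only [Fin.lt_def, Fin.val_rev, Fin.ext_iff]
    -- The case `d = a'` has an extra term in the entry `(a, d)`. Otherwise the indicators depend on
    -- the halves containing `a` and `d` and, if these differ, on the order of `d` and `a'`.
    by_cases h1 : (d : ℕ) = 2 * n - (a + 1)
    · have e2 : rho n d = -rho n a := by
        rw [← rev_rho]
        congr 1
        exact Fin.ext (by rw [Fin.val_rev]; exact h1)
      have c1 : ¬ (a : ℕ) < n := by omega
      have c2 : (d : ℕ) < n := by omega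
      rw [e2, zpow_neg]
      have c3 : 2 * n - ((a : ℕ) + 1) < a := by omega
      have c4 : ¬ 2 * n - ((a : ℕ) + 1) < d := by omega
      have c5 : ¬ 2 * n - ((d : ℕ) + 1) < a := by omega
      have c6 : ¬ 2 * n - ((d : ℕ) + 1) < d := by omega
      simp only [c1, c2, c3, c4, c5, c6, eq_true h1, if_true, if_false]
      rw [hl]
      field_simp
      ring
    · by_cases c1 : (a : ℕ) < n
      · have c2 : (d : ℕ) < n := by omega
        have c3 : ¬ 2 * n - ((a : ℕ) + 1) < a := by omega
        have c4 : ¬ 2 * n - ((a : ℕ) + 1) < d := by omega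
        have c5 : ¬ 2 * n - ((d : ℕ) + 1) < a := by omega
        have c6 : ¬ 2 * n - ((d : ℕ) + 1) < d := by omega
        simp only [c1, c2, c3, c4, c5, c6, h1, if_true, if_false]
        rw [hl]
        field_simp
        ring
      · by_cases c2 : (d : ℕ) < n
        · by_cases c0 : (d : ℕ) < 2 * n - (a + 1)
          · have c3 : 2 * n - ((a : ℕ) + 1) < a := by omega
            have c4 : ¬ 2 * n - ((a : ℕ) + 1) < d := by omega
            have c5 : ¬ 2 * n - ((d : ℕ) + 1) < a := by omega
            have c6 : ¬ 2 * n - ((d : ℕ) + 1) < d := by omega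
            simp only [c1, c2, c3, c4, c5, c6, h1, if_true, if_false]
            rw [hl]
            field_simp
            ring
          · have c3 : 2 * n - ((a : ℕ) + 1) < a := by omega
            have c4 : 2 * n - ((a : ℕ) + 1) < d := by omega
            have c5 : 2 * n - ((d : ℕ) + 1) < a := by omega
            have c6 : ¬ 2 * n - ((d : ℕ) + 1) < d := by omega
            simp only [c1, c2, c3, c4, c5, c6, h1, if_true, if_false]
            rw [hl]
            field_simp
            ring
        · have c3 : 2 * n - ((a : ℕ) + 1) < a := by omega
          have c4 : 2 * n - ((a : ℕ) + 1) < d := by omega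
          have c5 : 2 * n - ((d : ℕ) + 1) < a := by omega
          have c6 : 2 * n - ((d : ℕ) + 1) < d := by omega
          simp only [c1, c2, c3, c4, c5, c6, h1, if_true, if_false]
          rw [hl]
          field_simp
          ring
  · rw [if_neg hda, add_zero]
    have h1 : ∑ c, (if d < c ∧ c < a then -l * (q : ℂ) ^ (rho n a + rho n d) *
        (l * (q : ℂ) ^ (-2 * rho n c) - (if c = Fin.rev a then l else 0) -
          (if c = Fin.rev d then l else 0)) else 0) = 0 :=
      Finset.sum_eq_zero fun c _ => if_neg fun h => hda (h.1.trans h.2)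
    rw [h1, add_zero]
    simp only [zeroWeightEntry, hda, if_false, add_zero]
    split_ifs <;> simp

/-- The inverse of the `R`-matrix is obtained by inverting `q`. -/
lemma rMatrix_mul_rMatrix_inv (q : ℂˣ) : rMatrix n q * rMatrix n q⁻¹ = 1 := by
  ext ⟨a, b⟩ y
  rw [Matrix.mul_apply, Matrix.one_apply]
  by_cases hab : b = Fin.rev a
  · subst hab
    simp only [rMatrix_apply_rev, Fintype.sum_prod_type, ite_mul, zero_mul]
    simp only [Finset.sum_ite_eq', Finset.mem_univ, if_true, rMatrix_apply_rev, mul_ite, mul_zero]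
    obtain ⟨c, d⟩ := y
    by_cases hd : d = Fin.rev c
    · subst hd
      simp only [if_true, sum_zeroWeightEntry, Prod.mk.injEq, Fin.rev_inj, and_self, eq_comm]
    · have : ¬ ((a, Fin.rev a) = (c, d)) := by
        rintro h
        obtain ⟨rfl, rfl⟩ := Prod.mk.inj h
        exact hd rfl
      simp only [hd, this, if_false, Finset.sum_const_zero]
  · have hba : a ≠ Fin.rev b := by rintro rfl; simp at hab
    simp only [rMatrix_apply_of_ne q hab, add_mul, ite_mul, zero_mul, Finset.sum_add_distrib,
      Finset.sum_ite_eq', Finset.mem_univ, if_true, rMatrix_apply_of_ne q⁻¹ hab,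
      rMatrix_apply_of_ne q⁻¹ hba, one_mul]
    rcases lt_trichotomy a b with h | h | h
    · simp [h.ne, not_lt.2 h.le, eq_comm]
    · subst h
      simp [eq_comm]
    · simp only [h, h.ne, h.ne', not_lt.2 h.le, eq_comm (a := y), if_true, if_false]
      by_cases h1 : (a, b) = y
      · have h2 : (b, a) ≠ y := by
          rintro rfl
          exact h.ne (Prod.mk.inj h1).2
        simp [h1, h2]
      · by_cases h2 : (b, a) = y <;> simp [h1, h2]

end RInverse

/-! ### Automorphisms given by monomial matrices -/

/-- Conjugation by the monomial matrix `M_{a, σ a} = v a` preserves the `R`-matrix and the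
metric. -/
structure IsMonomialSymmetry (n : ℕ) (q : ℂˣ) (v : Fin (2 * n) → ℂ)
    (σ : Equiv.Perm (Fin (2 * n))) : Prop where
  ne_zero : ∀ a, v a ≠ 0
  apply_rMatrix : ∀ x y, rMatrix n q x y * pairWeight v y =
    pairWeight v x * rMatrix n q (σ x.1, σ x.2) (σ y.1, σ y.2)
  apply_metric : ∀ a b, v a * v b * metric n q (σ a) (σ b) = metric n q a b
  apply_metric' : ∀ a b, v a * v b * metric n q a b = metric n q (σ a) (σ b)

section Automorphism

variable {n : ℕ} {q : ℂˣ} {v : Fin (2 * n) → ℂ} {σ : Equiv.Perm (Fin (2 * n))}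
  {B : Type*} [Semiring B] [Algebra ℂ B]

lemma IsMonomialSymmetry.symm (h : IsMonomialSymmetry n q v σ) :
    IsMonomialSymmetry n q (fun a => (v (σ.symm a))⁻¹) σ.symm where
  ne_zero a := inv_ne_zero (h.ne_zero _)
  apply_rMatrix x y := by
    have h1 := h.apply_rMatrix (σ.symm x.1, σ.symm x.2) (σ.symm y.1, σ.symm y.2)
    have h2 := h.ne_zero (σ.symm x.1)
    have h3 := h.ne_zero (σ.symm x.2)
    have h4 := h.ne_zero (σ.symm y.1)
    have h5 := h.ne_zero (σ.symm y.2)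
    simp only [Equiv.apply_symm_apply, pairWeight] at h1 ⊢
    field_simp
    linear_combination -h1
  apply_metric a b := by
    have h1 := h.apply_metric (σ.symm a) (σ.symm b)
    have h2 := h.ne_zero (σ.symm a)
    have h3 := h.ne_zero (σ.symm b)
    simp only [Equiv.apply_symm_apply] at h1
    rw [← h1]
    field_simp
  apply_metric' a b := by
    have h1 := h.apply_metric' (σ.symm a) (σ.symm b)
    have h2 := h.ne_zero (σ.symm a)
    have h3 := h.ne_zero (σ.symm b)
    simp only [Equiv.apply_symm_apply] at h1
    rw [← h1]
    field_simp

lemma IsMonomialSymmetry.twist_rMatrix (h : IsMonomialSymmetry n q v σ) :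
    twist (pairWeight v) (σ.prodCongr σ) (QOrth.rMatrix n q) = QOrth.rMatrix n q := by
  ext x y
  have h1 := h.apply_rMatrix x y
  have h2 : pairWeight v y ≠ 0 := mul_ne_zero (h.ne_zero _) (h.ne_zero _)
  rw [twist_apply, smul_eq_mul]
  field_simp
  exact h1.symm.trans (mul_comm _ _)

/-- The action of a tensor power of a monomially conjugated matrix. -/
lemma tpow_twist_mulVec (m : ℕ) (X : Matrix (Fin (2 * n)) (Fin (2 * n)) B)
    (e : (Fin m → Fin (2 * n)) → ℂ) (i : Fin m → Fin (2 * n)) :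
    ∑ j, tpow m (twist v σ X) i j * algebraMap ℂ B (e j) =
      (∏ k, v (i k)) • ∑ j, tpow m X (σ ∘ i) j *
        algebraMap ℂ B ((∏ k, (v (σ.symm (j k)))⁻¹) * e (σ.symm ∘ j)) := by
  rw [Finset.smul_sum]
  conv_rhs => rw [← Equiv.sum_comp (Equiv.arrowCongr (Equiv.refl (Fin m)) σ)]
  refine Finset.sum_congr rfl fun j _ => ?_
  have h1 : Equiv.arrowCongr (Equiv.refl (Fin m)) σ j = σ ∘ j := rfl
  have h2 : σ.symm ∘ σ ∘ j = j := by
    funext k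
    simp
  rw [tpow_twist, h1, h2]
  simp only [Function.comp_apply, Equiv.symm_apply_apply]
  rw [← Algebra.commutes, ← Algebra.commutes, ← Algebra.smul_def, ← Algebra.smul_def, smul_smul,
    smul_smul]
  congr 1
  rw [Finset.prod_inv_distrib]
  ring

/-- `D ⊗ D` commutes with `R` and with the flip, hence with `R̂`, so the inverse of `D` acting in
every slot preserves the eigenspaces. -/
lemma IsMonomialSymmetry.isQAntisymm (h : IsMonomialSymmetry n q v σ)
    {e : (Fin (2 * n) → Fin (2 * n)) → ℂ} (he : IsQAntisymm n q e) :
    IsQAntisymm n q (fun j => (∏ k, (v (σ.symm (j k)))⁻¹) * e (σ.symm ∘ j)) := by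
  rw [isQAntisymm_iff] at he
  refine isQAntisymm_iff.2 (LocalEigen.twist he (fun a => (v (σ.symm a))⁻¹) σ.symm
    fun x y => ?_)
  have h1 := h.symm.apply_rMatrix x.swap y
  simp only [Matrix.submatrix_apply, id, Prod.swap_prod_mk, Prod.fst_swap, Prod.snd_swap] at h1 ⊢
  rw [h1]
  simp only [pairWeight, Prod.fst_swap, Prod.snd_swap]
  ring

/-- In the determinant relation the innermost factor `D⁻¹` in every slot produces another
q-antisymmetric tensor; `X` fixes it and the outer `D` restores the original one. -/
lemma IsQOrthogonal.twist {X : Matrix (Fin (2 * n)) (Fin (2 * n)) B} (hX : IsQOrthogonal n q X)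
    (h : IsMonomialSymmetry n q v σ) : IsQOrthogonal n q (twist v σ X) := by
  have hw : ∀ x, pairWeight v x ≠ 0 := fun x => mul_ne_zero (h.ne_zero _) (h.ne_zero _)
  refine ⟨?_, twist_mul_scal_mul_transpose v h.ne_zero σ X h.apply_metric hX.ctt,
    transpose_mul_scal_mul_twist v h.ne_zero σ X h.apply_metric' hX.ttc, ?_⟩
  · rw [mul_assoc, leg₁_mul_leg₂_twist, leg₂_mul_leg₁_twist, ← h.twist_rMatrix, ← twist_scal,
      ← twist_mul hw, ← twist_mul hw, ← mul_assoc, hX.rtt]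
  · intro e he
    funext i
    have h1 := congrFun (hX.det _ (h.isQAntisymm he)) (σ ∘ i)
    simp only [Matrix.mulVec, dotProduct] at h1 ⊢
    have h2 : σ.symm ∘ σ ∘ i = i := by
      funext k
      simp
    rw [tpow_twist_mulVec, h1, h2, Algebra.smul_def, ← map_mul, ← mul_assoc,
      ← Finset.prod_mul_distrib]
    simp [h.ne_zero]

lemma comul_gen (a b : Fin (2 * n)) : Coalgebra.comul (R := ℂ) (gen n q a b) =
    ∑ c, gen n q a c ⊗ₜ[ℂ] gen n q c b := comulHom_gen n q a b

lemma counit_gen (a b : Fin (2 * n)) : Coalgebra.counit (R := ℂ) (gen n q a b) =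
    (1 : Matrix _ _ ℂ) a b := counitHom_gen n q a b

lemma antipode_gen (a b : Fin (2 * n)) : HopfAlgebra.antipode ℂ (gen n q a b) =
    coinv n q (gen n q) a b := antipodeLin_gen a b

lemma sum_twist_tmul_twist (h : ∀ a, v a ≠ 0) (a b : Fin (2 * n)) :
    ∑ c, twist v σ (gen n q) a c ⊗ₜ[ℂ] twist v σ (gen n q) c b =
      (v a * (v b)⁻¹) • ∑ c, gen n q (σ a) c ⊗ₜ[ℂ] gen n q c (σ b) := by
  rw [Finset.smul_sum]
  conv_rhs => rw [← Equiv.sum_comp σ]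
  refine Finset.sum_congr rfl fun c _ => ?_
  rw [twist_apply, twist_apply, TensorProduct.smul_tmul_smul]
  congr 1
  have := h c
  field_simp

lemma smul_one_apply_perm (h : ∀ a, v a ≠ 0) (a b : Fin (2 * n)) :
    (v a * (v b)⁻¹) * (1 : Matrix (Fin (2 * n)) (Fin (2 * n)) ℂ) (σ a) (σ b) =
      (1 : Matrix _ _ ℂ) a b := by
  by_cases hab : a = b
  · subst hab
    simp [h]
  · rw [Matrix.one_apply_ne hab, Matrix.one_apply_ne (σ.injective.ne hab), mul_zero]

/-- The bialgebra endomorphism `T ↦ M T M⁻¹`. -/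
def IsMonomialSymmetry.hom (h : IsMonomialSymmetry n q v σ) : SOq n q →ₐc[ℂ] SOq n q :=
  BialgHom.ofAlgHom (lift _ ((gen_isQOrthogonal n q).twist h))
    (algHom_ext fun a b => by
      rw [AlgHom.comp_apply, lift_gen, twist_apply, map_smul, Bialgebra.counitAlgHom_apply,
        Bialgebra.counitAlgHom_apply, counit_gen, counit_gen, smul_eq_mul,
        smul_one_apply_perm h.ne_zero])
    (algHom_ext fun a b => by
      rw [AlgHom.comp_apply, AlgHom.comp_apply, lift_gen, twist_apply, map_smul,
        Bialgebra.comulAlgHom_apply, Bialgebra.comulAlgHom_apply, comul_gen, comul_gen, map_sum,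
        ← sum_twist_tmul_twist h.ne_zero]
      simp only [Algebra.TensorProduct.map_tmul, lift_gen])

lemma IsMonomialSymmetry.hom_gen (h : IsMonomialSymmetry n q v σ) (a b : Fin (2 * n)) :
    h.hom (gen n q a b) = twist v σ (gen n q) a b := lift_gen _ _ a b

lemma bialgHom_ext {f g : SOq n q →ₐc[ℂ] SOq n q}
    (h : ∀ a b, f (gen n q a b) = g (gen n q a b)) : f = g := by
  have h1 : (f : SOq n q →ₐ[ℂ] SOq n q) = g := algHom_ext h
  exact DFunLike.ext _ _ fun x => DFunLike.congr_fun h1 x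

/-- The bialgebra automorphism `T ↦ M T M⁻¹`. -/
def IsMonomialSymmetry.equiv (h : IsMonomialSymmetry n q v σ) : SOq n q ≃ₐc[ℂ] SOq n q :=
  BialgEquiv.ofBialgHom h.hom h.symm.hom
    (bialgHom_ext fun a b => by
      have h1 := h.ne_zero (σ.symm a)
      have h2 := h.ne_zero (σ.symm b)
      rw [BialgHom.comp_apply, h.symm.hom_gen, twist_apply, map_smul, h.hom_gen, twist_apply,
        smul_smul, Equiv.apply_symm_apply, Equiv.apply_symm_apply]
      rw [show (v (σ.symm a))⁻¹ * (v (σ.symm b))⁻¹⁻¹ * (v (σ.symm a) * (v (σ.symm b))⁻¹) = 1 by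
        field_simp, one_smul]
      rfl)
    (bialgHom_ext fun a b => by
      have h1 := h.ne_zero a
      have h2 := h.ne_zero b
      rw [BialgHom.comp_apply, h.hom_gen, twist_apply, map_smul, h.symm.hom_gen, twist_apply,
        smul_smul, Equiv.symm_apply_apply, Equiv.symm_apply_apply]
      rw [show v a * (v b)⁻¹ * ((v a)⁻¹ * (v b)⁻¹⁻¹) = 1 by field_simp, one_smul]
      rfl)

lemma IsMonomialSymmetry.equiv_gen (h : IsMonomialSymmetry n q v σ) (a b : Fin (2 * n)) :
    h.equiv (gen n q a b) = twist v σ (gen n q) a b := h.hom_gen a b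

lemma antipode_mul (x y : SOq n q) : HopfAlgebra.antipode ℂ (x * y) =
    HopfAlgebra.antipode ℂ y * HopfAlgebra.antipode ℂ x := antipodeLin_mul x y

/-- Both sides invert the twisted generator matrix, one from the left and one from the right. -/
lemma coinv_twist (h : IsMonomialSymmetry n q v σ) :
    coinv n q (twist v σ (gen n q)) = twist v σ (coinv n q (gen n q)) := by
  have h1 := coinv_mul ((gen_isQOrthogonal n q).twist h)
  have h2 : twist v σ (gen n q) * twist v σ (coinv n q (gen n q)) = 1 := by
    rw [← twist_mul h.ne_zero, mul_coinv (gen_isQOrthogonal n q)]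
    ext a b
    by_cases hab : a = b
    · subst hab
      simp [twist_apply, h.ne_zero]
    · rw [Matrix.one_apply_ne hab, twist_apply, Matrix.one_apply_ne (σ.injective.ne hab), smul_zero]
  exact left_inv_eq_right_inv h1 h2

lemma isHopfAut_of_gen (h : IsMonomialSymmetry n q v σ) {φ : SOq n q ≃ₐc[ℂ] SOq n q}
    (hφ : ∀ a b, φ (gen n q a b) = twist v σ (gen n q) a b) : IsHopfAut φ := by
  intro x
  induction x using SOq.induction with
  | h0 c =>
    have h1 : φ (algebraMap ℂ _ c) = algebraMap ℂ _ c := AlgHomClass.commutes φ c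
    have h2 : HopfAlgebra.antipode ℂ (algebraMap ℂ (SOq n q) c) = algebraMap ℂ _ c :=
      antipodeLin_algebraMap c
    rw [h1, h2, h1]
  | h1 a b =>
    have h3 : (gen n q).map φ = twist v σ (gen n q) := by
      ext a b
      exact hφ a b
    have h4 : ∀ M : Matrix (Fin (2 * n)) (Fin (2 * n)) ℂ, (scal (SOq n q) M).map φ =
        scal _ M := fun M => by
      ext a b
      exact AlgHomClass.commutes φ (M a b)
    have h5 : (coinv n q (gen n q)).map φ = coinv n q ((gen n q).map φ) := by
      rw [coinv, coinv, Matrix.map_mul, Matrix.map_mul, h4, Matrix.transpose_map]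
    have h6 : φ (coinv n q (gen n q) a b) = coinv n q ((gen n q).map φ) a b := by
      rw [← h5]
      rfl
    rw [antipode_gen, h6, h3, coinv_twist h, hφ, twist_apply, twist_apply, map_smul, antipode_gen]
  | h2 x y hx hy => rw [antipode_mul, map_mul, map_mul, hx, hy, antipode_mul]
  | h3 x y hx hy => rw [map_add, map_add, map_add, hx, hy, map_add]

lemma bialgEquiv_ext {φ ψ : SOq n q ≃ₐc[ℂ] SOq n q}
    (h : ∀ a b, φ (gen n q a b) = ψ (gen n q a b)) : φ = ψ := by
  have h1 : (φ : SOq n q →ₐ[ℂ] SOq n q) = (ψ : SOq n q →ₐ[ℂ] SOq n q) := algHom_ext h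
  exact BialgEquiv.ext fun x => DFunLike.congr_fun h1 x

end Automorphism

/-! ### Antilinear antihomomorphisms of `SO_q(2n)` -/

/-- The opposite algebra with the complex conjugate scalar action. -/
def ConjOp (B : Type*) : Type _ := Bᵐᵒᵖ

instance (B : Type*) [Semiring B] : Semiring (ConjOp B) := inferInstanceAs (Semiring Bᵐᵒᵖ)

instance (B : Type*) [Semiring B] [Algebra ℂ B] : Algebra ℂ (ConjOp B) :=
  RingHom.toAlgebra' (S := Bᵐᵒᵖ) ((algebraMap ℂ Bᵐᵒᵖ).comp (starRingEnd ℂ))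
    fun c x => Algebra.commutes (conj c) x

section ConjOp

variable {n : ℕ} {q : ℂˣ} {B : Type*} [Semiring B] [Algebra ℂ B]

/-- A monomial conjugate of a `q`-orthogonal matrix is `q`-orthogonal over the conjugate opposite
algebra, provided the monomial matrix intertwines the complex conjugate of the `R`-matrix with a
matrix `R'` that satisfies the opposite `RTT` relations. -/
lemma IsQOrthogonal.twist_conjOp {X : Matrix (Fin (2 * n)) (Fin (2 * n)) B}
    (hX : IsQOrthogonal n q X) {v : Fin (2 * n) → ℂ} {σ : Equiv.Perm (Fin (2 * n))}
    (hv : ∀ a, v a ≠ 0)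
    {R' : Matrix (Fin (2 * n) × Fin (2 * n)) (Fin (2 * n) × Fin (2 * n)) ℂ}
    (hR' : scal B R' * (leg₂ X * leg₁ X) = leg₁ X * leg₂ X * scal B R')
    (hR : QOrth.twist (pairWeight v) (σ.prodCongr σ) R' = (rMatrix n q).map conj)
    (hC : ∀ a b, v a * v b * metric n q (σ a) (σ b) = conj (metric n q b a))
    (hC' : ∀ a b, v a * v b * conj (metric n q b a) = metric n q (σ a) (σ b))
    (hdet : ∀ e, IsQAntisymm n q e → IsQAntisymm n q
      (fun j => (∏ k, (v (σ.symm (j k)))⁻¹) * conj (e (σ.symm ∘ j ∘ Fin.rev)))) :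
    IsQOrthogonal n q (B := ConjOp B) ((QOrth.twist v σ X).map MulOpposite.op) := by
  have hw : ∀ x, pairWeight v x ≠ 0 := fun x => mul_ne_zero (hv _) (hv _)
  set Y := QOrth.twist v σ X with hY
  have hCt : (scal B ((metric n q).map conj))ᵀ = scal B (((metric n q).map conj)ᵀ) := rfl
  refine ⟨?_, ?_, ?_, ?_⟩
  · change scal Bᵐᵒᵖ ((rMatrix n q).map conj) * leg₁ (Y.map MulOpposite.op) *
      leg₂ (Y.map MulOpposite.op) = leg₂ (Y.map MulOpposite.op) * leg₁ (Y.map MulOpposite.op) *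
      scal Bᵐᵒᵖ ((rMatrix n q).map conj)
    rw [mul_assoc, leg_op, leg_op', scal_mul_op, op_mul_scal, hY, leg₁_mul_leg₂_twist,
      leg₂_mul_leg₁_twist, ← hR, ← twist_scal, ← twist_mul hw, ← twist_mul hw, hR']
  · change Y.map MulOpposite.op * scal Bᵐᵒᵖ ((metric n q).map conj) *
      (Y.map MulOpposite.op)ᵀ = scal Bᵐᵒᵖ ((metric n q).map conj)
    rw [op_mul_scal, op_mul_transpose, transpose_mul_scal, ← mul_assoc, hCt, hY,
      twist_mul_scal_mul_transpose v hv σ X (M' := ((metric n q).map conj)ᵀ) hC hX.ctt]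
    rfl
  · change (Y.map MulOpposite.op)ᵀ * scal Bᵐᵒᵖ ((metric n q).map conj) *
      Y.map MulOpposite.op = scal Bᵐᵒᵖ ((metric n q).map conj)
    have h1 : Y.map MulOpposite.op = ((Yᵀ).map MulOpposite.op)ᵀ := rfl
    rw [h1, Matrix.transpose_transpose, op_mul_scal, op_mul_transpose, transpose_mul_scal,
      Matrix.transpose_transpose, ← mul_assoc, hCt, hY,
      transpose_mul_scal_mul_twist v hv σ X (M' := ((metric n q).map conj)ᵀ) hC' hX.ttc]
    rfl
  · intro e he
    funext i
    -- Words are read backwards in the opposite algebra, so the tensor to be fixed by `X` is `e`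
    -- conjugated, reversed and transformed by the inverse monomial matrix.
    have h1 := congrFun (hX.det _ (hdet e he)) (σ ∘ i ∘ Fin.rev)
    simp only [Matrix.mulVec, dotProduct] at h1
    have h2 := tpow_twist_mulVec (v := v) (σ := σ) (2 * n) X (fun j => conj (e (j ∘ Fin.rev)))
      (i ∘ Fin.rev)
    simp only [Function.comp_assoc] at h2
    have h3 : σ.symm ∘ (σ ∘ i ∘ Fin.rev) ∘ Fin.rev = i := by
      funext k
      simp
    have h4 : (∏ k, v ((i ∘ Fin.rev) k)) *
        ((∏ k, (v (σ.symm ((σ ∘ i ∘ Fin.rev) k)))⁻¹)) = 1 := by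
      rw [← Finset.prod_mul_distrib]
      simp [hv]
    have h5 : ∑ j, tpow (2 * n) Y (i ∘ Fin.rev) (j ∘ Fin.rev) * algebraMap ℂ B (conj (e j)) =
        algebraMap ℂ B (conj (e i)) := by
      rw [← Equiv.sum_comp (Equiv.arrowCongr Fin.revPerm (Equiv.refl (Fin (2 * n))))]
      have h6 : ∀ j : Fin (2 * n) → Fin (2 * n),
          (Equiv.arrowCongr Fin.revPerm (Equiv.refl (Fin (2 * n))) j) ∘ Fin.rev = j := by
        intro j
        funext k
        simp [Equiv.arrowCongr]
      have h7 : ∀ j : Fin (2 * n) → Fin (2 * n),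
          (Equiv.arrowCongr Fin.revPerm (Equiv.refl (Fin (2 * n))) j) = j ∘ Fin.rev := by
        intro j
        funext k
        simp [Equiv.arrowCongr]
      simp only [h6]
      simp only [h7]
      rw [hY, h2, h1, h3, Algebra.smul_def, ← map_mul, ← mul_assoc, h4, one_mul]
    have h8 : ∀ j, tpow (2 * n) (Y.map MulOpposite.op) i j *
        algebraMap ℂ Bᵐᵒᵖ (conj (e j)) = MulOpposite.op (tpow (2 * n) Y (i ∘ Fin.rev)
          (j ∘ Fin.rev) * algebraMap ℂ B (conj (e j))) := by
      intro j
      rw [tpow_map_op, ← Algebra.commutes, MulOpposite.op_mul]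
      rfl
    change ∑ j, tpow (2 * n) (Y.map MulOpposite.op) i j * algebraMap ℂ Bᵐᵒᵖ (conj (e j)) =
      MulOpposite.op (algebraMap ℂ B (conj (e i)))
    rw [← h5, Finset.op_sum]
    exact Finset.sum_congr rfl fun j _ => h8 j

/-- The antilinear antihomomorphism with prescribed values on the generators. -/
def conjLift (Y : Matrix (Fin (2 * n)) (Fin (2 * n)) (SOq n q))
    (hY : IsQOrthogonal n q (B := ConjOp (SOq n q)) (Y.map MulOpposite.op)) :
    SOq n q →ₛₗ[starRingEnd ℂ] SOq n q where
  toFun x := MulOpposite.unop (lift (B := ConjOp (SOq n q)) _ hY x)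
  map_add' x y := by
    rw [map_add]
    rfl
  map_smul' c x := by
    rw [Algebra.smul_def, map_mul, AlgHom.commutes, Algebra.smul_def, Algebra.commutes]
    rfl

variable {Y : Matrix (Fin (2 * n)) (Fin (2 * n)) (SOq n q)}
  (hY : IsQOrthogonal n q (B := ConjOp (SOq n q)) (Y.map MulOpposite.op))

lemma conjLift_gen (a b : Fin (2 * n)) : conjLift Y hY (gen n q a b) = Y a b := by
  change MulOpposite.unop (lift (B := ConjOp (SOq n q)) _ hY (gen n q a b)) = Y a b
  rw [lift_gen]
  rfl

lemma conjLift_mul (x y : SOq n q) :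
    conjLift Y hY (x * y) = conjLift Y hY y * conjLift Y hY x := by
  change MulOpposite.unop (lift (B := ConjOp (SOq n q)) _ hY (x * y)) = _
  rw [map_mul]
  rfl

end ConjOp

/-! ### Star structures checked on the generators. -/

section AntiHom

variable {n : ℕ} {q : ℂˣ} {s : SOq n q →ₛₗ[starRingEnd ℂ] SOq n q}

/-- Unitality is not an axiom: apply antimultiplicativity to `s(1) · 1`, then use the involution. -/
lemma IsStarStructure.map_one {A : Type*} [Ring A] [HopfAlgebra ℂ A]
    {s : A →ₛₗ[starRingEnd ℂ] A} (hs : IsStarStructure s) : s 1 = 1 := by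
  have h := hs.map_mul (s 1) 1
  rw [mul_one, hs.involutive, mul_one] at h
  exact h.symm

lemma map_algebraMap_of_map_one (h1 : s 1 = 1) (c : ℂ) :
    s (algebraMap ℂ _ c) = algebraMap ℂ _ (conj c) := by
  rw [Algebra.algebraMap_eq_smul_one, Algebra.algebraMap_eq_smul_one, s.map_smulₛₗ, h1]

lemma conjLift_one {Y : Matrix (Fin (2 * n)) (Fin (2 * n)) (SOq n q)}
    (hY : IsQOrthogonal n q (B := ConjOp (SOq n q)) (Y.map MulOpposite.op)) :
    conjLift Y hY 1 = 1 := by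
  change MulOpposite.unop (lift (B := ConjOp (SOq n q)) _ hY 1) = _
  rw [map_one]
  rfl

/-- Star structures on `SO_q(2n)` are determined by their values on the generators. -/
lemma IsStarStructure.ext_gen {s t : SOq n q →ₛₗ[starRingEnd ℂ] SOq n q}
    (hs : IsStarStructure s) (ht : IsStarStructure t)
    (h : ∀ a b, s (gen n q a b) = t (gen n q a b)) (x : SOq n q) : s x = t x := by
  induction x using SOq.induction with
  | h0 c => rw [map_algebraMap_of_map_one hs.map_one, map_algebraMap_of_map_one ht.map_one]
  | h1 a b => exact h a b
  | h2 x y hx hy => rw [hs.map_mul, ht.map_mul, hx, hy]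
  | h3 x y hx hy => rw [map_add, map_add, hx, hy]

lemma map_tmul_mul_of_antiHom {A : Type*} [Ring A] [HopfAlgebra ℂ A]
    {s : A →ₛₗ[starRingEnd ℂ] A} (hs : ∀ x y, s (x * y) = s y * s x) (u w : A ⊗[ℂ] A) :
    TensorProduct.map s s (u * w) = TensorProduct.map s s w * TensorProduct.map s s u := by
  induction u using TensorProduct.induction_on with
  | zero => simp
  | tmul a b =>
    induction w using TensorProduct.induction_on with
    | zero => simp
    | tmul c d =>
      rw [Algebra.TensorProduct.tmul_mul_tmul, TensorProduct.map_tmul, TensorProduct.map_tmul,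
        TensorProduct.map_tmul, Algebra.TensorProduct.tmul_mul_tmul, hs, hs]
    | add c d hc hd => rw [mul_add, map_add, map_add, hc, hd, add_mul]
  | add a b ha hb => rw [add_mul, map_add, map_add, ha, hb, mul_add]

/-- An antilinear antihomomorphism that acts on the generators as an involutive monomial
conjugation is a star structure. -/
lemma isStarStructure_of_gen {v : Fin (2 * n) → ℂ} {σ : Equiv.Perm (Fin (2 * n))}
    (hv : ∀ a, v a ≠ 0) (hσ : ∀ a, σ (σ a) = a) (hvσ : ∀ a, conj (v a) * v (σ a) = 1)
    (hmul : ∀ x y, s (x * y) = s y * s x) (hone : s 1 = 1)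
    (hgen : ∀ a b, s (gen n q a b) = twist v σ (gen n q) a b) : IsStarStructure s where
  map_mul := hmul
  involutive x := by
    induction x using SOq.induction with
    | h0 c => rw [map_algebraMap_of_map_one hone, map_algebraMap_of_map_one hone, Complex.conj_conj]
    | h1 a b =>
      rw [hgen, twist_apply, s.map_smulₛₗ, hgen, twist_apply, smul_smul, hσ, hσ, map_mul,
        map_inv₀]
      -- Applied twice, the map rescales `T_ab` by the ratio of `conj (v a) * v (σ a)` to the same
      -- expression in `b`; `hvσ` makes both equal to one.
      rw [show conj (v a) * (conj (v b))⁻¹ * (v (σ a) * (v (σ b))⁻¹) =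
        (conj (v a) * v (σ a)) * (conj (v b) * v (σ b))⁻¹ by rw [mul_inv]; ring, hvσ, hvσ]
      simp
    | h2 x y hx hy => rw [hmul, hmul, hx, hy]
    | h3 x y hx hy => rw [map_add, map_add, hx, hy]
  comul x := by
    induction x using SOq.induction with
    | h0 c =>
      rw [map_algebraMap_of_map_one hone, Bialgebra.comul_algebraMap, Bialgebra.comul_algebraMap,
        Algebra.TensorProduct.algebraMap_apply, Algebra.TensorProduct.algebraMap_apply,
        TensorProduct.map_tmul, map_algebraMap_of_map_one hone, hone]
    | h1 a b =>
      rw [hgen, twist_apply, map_smul, comul_gen, ← sum_twist_tmul_twist hv, comul_gen, map_sum]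
      simp only [TensorProduct.map_tmul, hgen]
    | h2 x y hx hy =>
      rw [hmul, Bialgebra.comul_mul, hx, hy, Bialgebra.comul_mul, map_tmul_mul_of_antiHom hmul]
    | h3 x y hx hy => rw [map_add, map_add, map_add, hx, hy, map_add]
  counit x := by
    induction x using SOq.induction with
    | h0 c =>
      rw [map_algebraMap_of_map_one hone, Bialgebra.counit_algebraMap, Bialgebra.counit_algebraMap]
    | h1 a b =>
      rw [hgen, twist_apply, map_smul, counit_gen, counit_gen, smul_eq_mul,
        smul_one_apply_perm hv, Matrix.one_apply]
      split_ifs <;> simp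
    | h2 x y hx hy =>
      rw [hmul, Bialgebra.counit_mul, hx, hy, Bialgebra.counit_mul, map_mul, mul_comm]
    | h3 x y hx hy => rw [map_add, map_add, map_add, hx, hy, map_add]

/-- The composition of a star structure with a commuting involutive automorphism. -/
lemma IsStarStructure.compStar {A : Type*} [Ring A] [HopfAlgebra ℂ A]
    {s : A →ₛₗ[starRingEnd ℂ] A} (hs : IsStarStructure s) {φ : A ≃ₐc[ℂ] A}
    (hφ : ∀ x, φ (φ x) = x) (hφs : ∀ x, φ (s x) = s (φ x)) :
    IsStarStructure (compStar φ s) where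
  map_mul x y := by
    change φ (s (x * y)) = φ (s y) * φ (s x)
    rw [hs.map_mul, _root_.map_mul]
  involutive x := by
    change φ (s (φ (s x))) = x
    rw [hφs, hφ, hs.involutive]
  comul x := by
    change Coalgebra.comul (R := ℂ) (φ (s x)) = _
    rw [← CoalgHomClass.map_comp_comul_apply φ (s x), hs.comul]
    induction Coalgebra.comul (R := ℂ) x using TensorProduct.induction_on with
    | zero => simp
    | tmul a b => rfl
    | add a b ha hb => rw [map_add, map_add, ha, hb, map_add]
  counit x := by
    change Coalgebra.counit (R := ℂ) (φ (s x)) = _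
    rw [CoalgHomClass.counit_comp_apply, hs.counit]

lemma IsStarStructure.commute_of_gen (hs : IsStarStructure s) {φ : SOq n q ≃ₐc[ℂ] SOq n q}
    (h : ∀ a b, φ (s (gen n q a b)) = s (φ (gen n q a b))) (x : SOq n q) :
    φ (s x) = s (φ x) := by
  induction x using SOq.induction with
  | h0 c =>
    have h1 : ∀ c : ℂ, φ (algebraMap ℂ _ c) = algebraMap ℂ _ c := AlgHomClass.commutes φ
    rw [map_algebraMap_of_map_one hs.map_one, h1, h1, map_algebraMap_of_map_one hs.map_one]
  | h1 a b => exact h a b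
  | h2 x y hx hy => rw [hs.map_mul, _root_.map_mul, hx, hy, _root_.map_mul, hs.map_mul]
  | h3 x y hx hy => rw [map_add, map_add, hx, hy, map_add, map_add]

/-- Two star structures are equivalent if an automorphism intertwines them on the generators. -/
lemma starEquivalent_of_gen {s t : SOq n q →ₛₗ[starRingEnd ℂ] SOq n q}
    (hs : IsStarStructure s) (ht : IsStarStructure t) {α : SOq n q ≃ₐc[ℂ] SOq n q}
    (hα : IsHopfAut α) (h : ∀ a b, t (α (gen n q a b)) = α (s (gen n q a b))) :
    StarEquivalent s t := by
  refine ⟨α, hα, ?_⟩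
  have h2 : ∀ y, t (α y) = α (s y) := by
    intro y
    have h1 : ∀ c : ℂ, α (algebraMap ℂ _ c) = algebraMap ℂ _ c := AlgHomClass.commutes α
    induction y using SOq.induction with
    | h0 c => rw [h1, map_algebraMap_of_map_one ht.map_one, map_algebraMap_of_map_one hs.map_one, h1]
    | h1 a b => exact h a b
    | h2 x y hx hy => rw [map_mul, ht.map_mul, hx, hy, hs.map_mul, map_mul]
    | h3 x y hx hy => rw [map_add, map_add, map_add, hx, hy, map_add]
  intro x
  rw [← h2, BialgEquiv.apply_symm_apply]

end AntiHom

/-! ### The automorphisms `T ↦ 𝒟'' T 𝒟''⁻¹` -/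

section Diagonal

variable {n : ℕ} {q : ℂˣ} {B : Type*} [Semiring B] [Algebra ℂ B]

lemma metric_eq_zero {a b : Fin (2 * n)} (h : b ≠ Fin.rev a) : metric n q a b = 0 := if_neg h

lemma metric_rev (a : Fin (2 * n)) : metric n q a (Fin.rev a) = (q : ℂ) ^ (-rho n a) := if_pos rfl

/-- Such diagonal matrices form the torus preserving `C`, and weight conservation makes them commute
with `R`. -/
lemma isMonomialSymmetry_diagonal {v : Fin (2 * n) → ℂ} (hv : ∀ a, v a * v (Fin.rev a) = 1) :
    IsMonomialSymmetry n q v 1 := by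
  have h1 : ∀ a b, v a * v b * metric n q a b = metric n q a b := by
    intro a b
    by_cases h : b = Fin.rev a
    · rw [h, hv, one_mul]
    · rw [metric_eq_zero h, mul_zero]
  exact ⟨fun a h => by simpa [h] using hv a, rMatrix_weight q v hv, h1, h1⟩

lemma inv_diagonal_of_ne_zero {v : Fin (2 * n) → ℂ} (hv : ∀ a, v a ≠ 0) :
    (Matrix.diagonal v)⁻¹ = Matrix.diagonal fun a => (v a)⁻¹ := by
  refine Matrix.inv_eq_right_inv ?_
  rw [Matrix.diagonal_mul_diagonal, ← Matrix.diagonal_one]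
  congr 1
  funext a
  exact mul_inv_cancel₀ (hv a)

lemma scal_diagonal_mul_mul_inv {v : Fin (2 * n) → ℂ} (hv : ∀ a, v a ≠ 0)
    (X : Matrix (Fin (2 * n)) (Fin (2 * n)) B) :
    scal B (Matrix.diagonal v) * X * scal B (Matrix.diagonal v)⁻¹ = twist v 1 X := by
  have h : ∀ w : Fin (2 * n) → ℂ,
      scal B (Matrix.diagonal w) = Matrix.diagonal fun a => algebraMap ℂ B (w a) := fun w => by
    rw [scal, Matrix.diagonal_map (map_zero _)]
  ext a b
  rw [inv_diagonal_of_ne_zero hv, h, h, Matrix.mul_diagonal, Matrix.diagonal_mul, twist_apply,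
    ← Algebra.commutes, ← Algebra.smul_def, ← Algebra.smul_def, smul_smul, mul_comm]
  rfl

variable {ε : Fin (2 * n) → ℝ}

/-- The diagonal entries of `𝒟''`. -/
def dEntry (n : ℕ) (ε : Fin (2 * n) → ℝ) (a : Fin (2 * n)) : ℂ := Complex.I * (ε a : ℂ)

lemma dMatrix_eq : dMatrix n ε = Matrix.diagonal (dEntry n ε) := rfl

lemma IsSignVector.mul_self (h : IsSignVector n ε) (a : Fin (2 * n)) :
    (ε a : ℂ) * (ε a : ℂ) = 1 := by
  rw [← pow_two, ← Complex.ofReal_pow, h.sq, Complex.ofReal_one]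

lemma IsSignVector.ofReal_rev (h : IsSignVector n ε) (a : Fin (2 * n)) :
    (ε (Fin.rev a) : ℂ) = -(ε a : ℂ) := by rw [h.rev, Complex.ofReal_neg]

lemma IsSignVector.dEntry_mul_self (h : IsSignVector n ε) (a : Fin (2 * n)) :
    dEntry n ε a * dEntry n ε a = -1 := by
  rw [dEntry]
  linear_combination (Complex.I * Complex.I) * h.mul_self a + Complex.I_mul_I

lemma IsSignVector.dEntry_rev (h : IsSignVector n ε) (a : Fin (2 * n)) :
    dEntry n ε (Fin.rev a) = -dEntry n ε a := by
  rw [dEntry, dEntry, h.ofReal_rev, mul_neg]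

/-- This is where the factor `i` matters: the bare signs satisfy `ε_a ε_{a'} = -1` and would change
the sign of `C`. -/
lemma IsSignVector.dEntry_mul_rev (h : IsSignVector n ε) (a : Fin (2 * n)) :
    dEntry n ε a * dEntry n ε (Fin.rev a) = 1 := by
  rw [h.dEntry_rev, mul_neg, h.dEntry_mul_self, neg_neg]

lemma conj_dEntry (a : Fin (2 * n)) : conj (dEntry n ε a) = -dEntry n ε a := by
  simp [dEntry]

lemma IsSignVector.isMonomialSymmetry (h : IsSignVector n ε) (q : ℂˣ) :
    IsMonomialSymmetry n q (dEntry n ε) 1 := isMonomialSymmetry_diagonal h.dEntry_mul_rev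

lemma IsSignVector.dEntry_ne_zero (h : IsSignVector n ε) (a : Fin (2 * n)) : dEntry n ε a ≠ 0 :=
  (h.isMonomialSymmetry 1).ne_zero a

lemma isConjBy_iff (h : IsSignVector n ε) (φ : SOq n q ≃ₐc[ℂ] SOq n q) :
    IsConjBy n q (dMatrix n ε) φ ↔
      ∀ a b, φ (gen n q a b) = twist (dEntry n ε) 1 (gen n q) a b := by
  rw [IsConjBy, dMatrix_eq, scal_diagonal_mul_mul_inv h.dEntry_ne_zero, ← Matrix.ext_iff]
  rfl

lemma IsSignVector.rMatrix_mul_leg (h : IsSignVector n ε) (q : ℂˣ) :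
    rMatrix n q * leg₁ (dMatrix n ε) * leg₂ (dMatrix n ε) =
      leg₂ (dMatrix n ε) * leg₁ (dMatrix n ε) * rMatrix n q := by
  have h1 : leg₁ (dMatrix n ε) * leg₂ (dMatrix n ε) =
      Matrix.diagonal (pairWeight (dEntry n ε)) := by
    ext ⟨a, b⟩ ⟨c, d⟩
    rw [leg₁_mul_leg₂_apply, dMatrix_eq]
    by_cases hac : a = c <;> by_cases hbd : b = d <;>
      simp [hac, hbd, pairWeight]
  rw [← leg_comm _ _ fun a b c d => Commute.all _ _, mul_assoc, h1]
  ext x y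
  rw [Matrix.mul_diagonal, Matrix.diagonal_mul]
  exact (h.isMonomialSymmetry q).apply_rMatrix x y

lemma IsSignVector.diagonal_mul_metric_mul (h : IsSignVector n ε) (q : ℂˣ) :
    dMatrix n ε * metric n q * dMatrix n ε = metric n q := by
  ext a b
  rw [dMatrix_eq, Matrix.mul_diagonal, Matrix.diagonal_mul, mul_right_comm]
  exact (h.isMonomialSymmetry q).apply_metric a b

lemma IsSignVector.dMatrix_mul_self (h : IsSignVector n ε) :
    dMatrix n ε * dMatrix n ε = -1 := by
  rw [dMatrix_eq, Matrix.diagonal_mul_diagonal, ← Matrix.diagonal_one, Matrix.diagonal_neg]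
  congr 1
  funext a
  exact h.dEntry_mul_self a

lemma dMatrix_map_conj : (dMatrix n ε).map conj = -dMatrix n ε := by
  rw [dMatrix_eq, Matrix.diagonal_map (map_zero _), Matrix.diagonal_neg]
  congr 1
  funext a
  exact conj_dEntry a

/-- The monomial coefficients of `Cᵗ`. -/
def metricWeight (n : ℕ) (q : ℂˣ) (a : Fin (2 * n)) : ℂ := (q : ℂ) ^ rho n a

lemma metricWeight_ne_zero (a : Fin (2 * n)) : metricWeight n q a ≠ 0 :=
  zpow_ne_zero _ q.ne_zero

lemma metricWeight_mul_rev (a : Fin (2 * n)) :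
    metricWeight n q a * metricWeight n q (Fin.rev a) = 1 := by
  rw [metricWeight, metricWeight, rev_rho, ← zpow_add₀ q.ne_zero, add_neg_cancel, zpow_zero]

/-- `Cᵗ` is monomial and squares to one, so multiplying by it on both sides is a conjugation. -/
lemma scal_metric_mul_mul (X : Matrix (Fin (2 * n)) (Fin (2 * n)) B) :
    scal B (metric n q)ᵀ * X * scal B (metric n q)ᵀ =
      twist (metricWeight n q) Fin.revPerm X := by
  ext a b
  have h1 : ∀ c d, scal B (metric n q)ᵀ c d =
      if d = Fin.rev c then algebraMap ℂ B (metricWeight n q c) else 0 := by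
    intro c d
    simp only [scal, Matrix.map_apply, Matrix.transpose_apply]
    by_cases h : d = Fin.rev c
    · subst h
      have h2 := metric_rev (q := q) (Fin.rev c)
      rw [Fin.rev_rev, rev_rho, neg_neg] at h2
      rw [h2, if_pos rfl]
      rfl
    · rw [metric_eq_zero (fun h2 => h (by rw [h2, Fin.rev_rev])), if_neg h, map_zero]
  rw [Matrix.mul_apply, Finset.sum_eq_single (Fin.rev b)]
  · rw [Matrix.mul_apply, Finset.sum_eq_single (Fin.rev a)]
    · rw [h1, h1, if_pos rfl, if_pos (Fin.rev_rev b).symm, twist_apply, ← Algebra.commutes,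
        ← Algebra.smul_def, ← Algebra.smul_def, smul_smul]
      have h3 := metricWeight_mul_rev (q := q) b
      have h4 : metricWeight n q (Fin.rev b) = (metricWeight n q b)⁻¹ :=
        eq_inv_of_mul_eq_one_right h3
      rw [h4, mul_comm]
      rfl
    · intro c _ hc
      rw [h1, if_neg hc, zero_mul]
    · simp
  · intro c _ hc
    rw [h1 c b, if_neg fun h => hc (by rw [h, Fin.rev_rev]), mul_zero]
  · simp

lemma IsSignVector.metric_mul_dMatrix_mul (h : IsSignVector n ε) (q : ℂˣ) :
    (metric n q)ᵀ * dMatrix n ε * (metric n q)ᵀ = -dMatrix n ε := by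
  have h1 := scal_metric_mul_mul (q := q) (dMatrix n ε)
  have h2 : scal ℂ (metric n q)ᵀ = (metric n q)ᵀ := rfl
  rw [h2] at h1
  rw [h1]
  ext a b
  rw [twist_apply, dMatrix_eq, Matrix.neg_apply, Fin.revPerm_apply, Fin.revPerm_apply]
  by_cases hab : a = b
  · subst hab
    rw [Matrix.diagonal_apply_eq, Matrix.diagonal_apply_eq, h.dEntry_rev,
      mul_inv_cancel₀ (metricWeight_ne_zero a), one_smul]
  · rw [Matrix.diagonal_apply_ne _ hab, Matrix.diagonal_apply_ne _ (Fin.rev_injective.ne hab),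
      smul_zero, neg_zero]

lemma IsSignVector.existsUnique_isConjBy (h : IsSignVector n ε) (q : ℂˣ) :
    ∃! φ : SOq n q ≃ₐc[ℂ] SOq n q, IsConjBy n q (dMatrix n ε) φ := by
  refine ⟨(h.isMonomialSymmetry q).equiv, (isConjBy_iff h _).2
    (h.isMonomialSymmetry q).equiv_gen, fun ψ hψ => bialgEquiv_ext fun a b => ?_⟩
  rw [(isConjBy_iff h _).1 hψ, (h.isMonomialSymmetry q).equiv_gen]

lemma IsSignVector.dEntry_div_mul_self (h : IsSignVector n ε) (a b : Fin (2 * n)) :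
    dEntry n ε a * (dEntry n ε b)⁻¹ * (dEntry n ε a * (dEntry n ε b)⁻¹) = 1 := by
  rw [mul_mul_mul_comm, ← mul_inv, h.dEntry_mul_self, h.dEntry_mul_self]
  norm_num

lemma IsSignVector.involutive (h : IsSignVector n ε) {φ : SOq n q ≃ₐc[ℂ] SOq n q}
    (hφ : IsConjBy n q (dMatrix n ε) φ) (x : SOq n q) : φ (φ x) = x := by
  rw [isConjBy_iff h] at hφ
  induction x using SOq.induction with
  | h0 c =>
    have h1 : ∀ c : ℂ, φ (algebraMap ℂ _ c) = algebraMap ℂ _ c := AlgHomClass.commutes φ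
    rw [h1, h1]
  | h1 a b =>
    rw [hφ, twist_apply, map_smul, Equiv.Perm.one_apply, Equiv.Perm.one_apply, hφ, twist_apply,
      smul_smul, h.dEntry_div_mul_self, one_smul]
    rfl
  | h2 x y hx hy => rw [map_mul, map_mul, hx, hy]
  | h3 x y hx hy => rw [map_add, map_add, hx, hy]

end Diagonal

/-! ### The conjugations `⋆` and `×` -/

section Stars

variable {n : ℕ} {q : ℂˣ} {ε : Fin (2 * n) → ℝ}
  {s : SOq n q →ₛₗ[starRingEnd ℂ] SOq n q} {φ : SOq n q ≃ₐc[ℂ] SOq n q}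

/-- Common to `⋆` and `×`: existence is the universal property with values in `ConjOp`, uniqueness
holds because the entries of `T` generate the algebra. -/
lemma existsUnique_of_gen {P : (SOq n q →ₛₗ[starRingEnd ℂ] SOq n q) → Prop}
    {v : Fin (2 * n) → ℂ} {σ : Equiv.Perm (Fin (2 * n))}
    (hv : ∀ a, v a ≠ 0) (hσ : ∀ a, σ (σ a) = a) (hvσ : ∀ a, conj (v a) * v (σ a) = 1)
    (hY : IsQOrthogonal n q (B := ConjOp (SOq n q))
      ((twist v σ (gen n q)).map MulOpposite.op))
    (hP : ∀ s, P s ↔ IsStarStructure s ∧ ∀ a b, s (gen n q a b) = twist v σ (gen n q) a b) :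
    ∃! s, P s := by
  refine ⟨conjLift _ hY, (hP _).2 ⟨isStarStructure_of_gen hv hσ hvσ (conjLift_mul hY)
    (conjLift_one hY) (conjLift_gen hY), conjLift_gen hY⟩, fun t ht => ?_⟩
  replace ht := (hP t).1 ht
  refine LinearMap.ext fun x => ht.1.ext_gen (isStarStructure_of_gen hv hσ hvσ (conjLift_mul hY)
    (conjLift_one hY) (conjLift_gen hY)) (fun a b => ?_) x
  rw [ht.2, conjLift_gen]

lemma isMetricStar_iff : IsMetricStar n q s ↔ IsStarStructure s ∧
    ∀ a b, s (gen n q a b) = twist (metricWeight n q) Fin.revPerm (gen n q) a b := by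
  rw [IsMetricStar, scal_metric_mul_mul, ← Matrix.ext_iff]
  rfl

lemma isTrivialStar_iff : IsTrivialStar n q s ↔ IsStarStructure s ∧
    ∀ a b, s (gen n q a b) = twist 1 1 (gen n q) a b := by
  rw [IsTrivialStar, twist_one_one, ← Matrix.ext_iff]
  rfl

lemma leg₂_mul_leg₁_eq_submatrix {ι B : Type*} [Fintype ι] [DecidableEq ι] [Semiring B]
    [Algebra ℂ B] (X : Matrix ι ι B) :
    leg₂ X * leg₁ X = (leg₁ X * leg₂ X).submatrix (Equiv.prodComm ι ι) (Equiv.prodComm ι ι) := by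
  ext ⟨a, b⟩ ⟨c, d⟩
  rw [leg₂_mul_leg₁_apply, Matrix.submatrix_apply]
  exact (leg₁_mul_leg₂_apply X X b a d c).symm

/-- The RTT relation conjugated by the flip: `R₂₁` satisfies the opposite relation, which is the one
used for real `q`. -/
lemma IsQOrthogonal.rtt_swap {B : Type*} [Semiring B] [Algebra ℂ B]
    {X : Matrix (Fin (2 * n)) (Fin (2 * n)) B} (hX : IsQOrthogonal n q X) :
    scal B ((rMatrix n q).submatrix (Equiv.prodComm _ _) (Equiv.prodComm _ _)) *
      (leg₂ X * leg₁ X) = leg₁ X * leg₂ X *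
      scal B ((rMatrix n q).submatrix (Equiv.prodComm _ _) (Equiv.prodComm _ _)) := by
  have h1 : scal B ((rMatrix n q).submatrix (Equiv.prodComm _ _) (Equiv.prodComm _ _)) =
      (scal B (rMatrix n q)).submatrix (Equiv.prodComm _ _) (Equiv.prodComm _ _) := rfl
  have h2 : leg₁ X * leg₂ X = (leg₂ X * leg₁ X).submatrix (Equiv.prodComm _ _)
      (Equiv.prodComm _ _) := by
    rw [leg₂_mul_leg₁_eq_submatrix, Matrix.submatrix_submatrix]
    ext x y
    simp
  rw [h1, leg₂_mul_leg₁_eq_submatrix, Matrix.submatrix_mul_equiv, ← mul_assoc, hX.rtt,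
    ← Matrix.submatrix_mul_equiv _ _ _ (Equiv.prodComm _ _), ← h2]

/-- The RTT relation multiplied by `R⁻¹ = R(q⁻¹)` on both sides, used for `|q| = 1`. -/
lemma IsQOrthogonal.rtt_inv {B : Type*} [Semiring B] [Algebra ℂ B]
    {X : Matrix (Fin (2 * n)) (Fin (2 * n)) B} (hX : IsQOrthogonal n q X) :
    scal B (rMatrix n q⁻¹) * (leg₂ X * leg₁ X) =
      leg₁ X * leg₂ X * scal B (rMatrix n q⁻¹) := by
  have hone : scal B (1 : Matrix (Fin (2 * n) × Fin (2 * n)) (Fin (2 * n) × Fin (2 * n)) ℂ) = 1 :=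
    Matrix.map_one _ (map_zero _) (map_one _)
  have h1 : scal B (rMatrix n q) * scal B (rMatrix n q⁻¹) = 1 := by
    rw [← scal_mul, rMatrix_mul_rMatrix_inv, hone]
  have h2 : scal B (rMatrix n q⁻¹) * scal B (rMatrix n q) = 1 := by
    have := rMatrix_mul_rMatrix_inv (n := n) q⁻¹
    rw [inv_inv] at this
    rw [← scal_mul, this, hone]
  set R := scal B (rMatrix n q)
  set R' := scal B (rMatrix n q⁻¹)
  calc R' * (leg₂ X * leg₁ X) = R' * (leg₂ X * leg₁ X * R) * R' := by
        simp only [mul_assoc, h1, mul_one]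
    _ = R' * (R * leg₁ X * leg₂ X) * R' := by rw [hX.rtt]
    _ = (R' * R) * (leg₁ X * leg₂ X) * R' := by simp only [mul_assoc]
    _ = leg₁ X * leg₂ X * R' := by rw [h2, one_mul]

lemma conj_metricWeight (hq : conj (q : ℂ) = q) (a : Fin (2 * n)) :
    conj (metricWeight n q a) = metricWeight n q a := by
  rw [metricWeight, map_zpow₀, hq]

/-- For real `q` both `R` and `C` are real. Conjugation by `Cᵗ` in both factors carries `R₂₁` to
`R`: the permutation part is `rMatrix_swap_swap`, the scalar part cancels by weight conservation. -/
lemma existsUnique_isMetricStar (hq : conj (q : ℂ) = q) : ∃! s, IsMetricStar n q s := by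
  refine existsUnique_of_gen metricWeight_ne_zero (fun a => Fin.rev_rev a) (fun a => ?_) ?_
    fun s => isMetricStar_iff
  · rw [conj_metricWeight hq]
    exact metricWeight_mul_rev a
  · have hc : ∀ a b, metric n q (Fin.rev a) (Fin.rev b) = metric n q b a := by
      intro a b
      by_cases h : b = Fin.rev a
      · subst h
        rw [Fin.rev_rev]
      · rw [metric_eq_zero fun h2 => h (Fin.rev_injective h2),
          metric_eq_zero fun h2 => h (by rw [h2, Fin.rev_rev])]
    have hcc : ∀ a b, conj (metric n q a b) = metric n q a b := by
      intro a b
      by_cases h : b = Fin.rev a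
      · subst h
        rw [metric_rev, map_zpow₀, hq]
      · rw [metric_eq_zero h, map_zero]
    have hvv : ∀ a b, metricWeight n q a * metricWeight n q b * metric n q b a =
        metric n q b a := by
      intro a b
      by_cases h : a = Fin.rev b
      · subst h
        rw [mul_comm (metricWeight n q _), metricWeight_mul_rev, one_mul]
      · rw [metric_eq_zero h, mul_zero]
    have hw : ∀ x, pairWeight (metricWeight n q) x ≠ 0 := fun x =>
      mul_ne_zero (metricWeight_ne_zero _) (metricWeight_ne_zero _)
    refine (gen_isQOrthogonal n q).twist_conjOp metricWeight_ne_zero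
      (gen_isQOrthogonal n q).rtt_swap ?_ ?_ ?_ ?_
    · rw [rMatrix_map_conj hq]
      ext ⟨a, b⟩ ⟨c, d⟩
      have h1 := rMatrix_weight q (metricWeight n q) metricWeight_mul_rev (a, b) (c, d)
      have h2 := rMatrix_swap_swap q (Fin.rev a) (Fin.rev b) (Fin.rev c) (Fin.rev d)
      rw [Fin.rev_rev, Fin.rev_rev, Fin.rev_rev, Fin.rev_rev] at h2
      have h3 := hw (c, d)
      have h4 : twist (pairWeight (metricWeight n q)) (Fin.revPerm.prodCongr Fin.revPerm)
          ((rMatrix n q).submatrix (Equiv.prodComm _ _) (Equiv.prodComm _ _)) (a, b) (c, d) =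
          pairWeight (metricWeight n q) (a, b) * (pairWeight (metricWeight n q) (c, d))⁻¹ *
            rMatrix n q (Fin.rev b, Fin.rev a) (Fin.rev d, Fin.rev c) := rfl
      rw [h4, h2]
      field_simp
      linear_combination -h1
    · intro a b
      rw [hcc, Fin.revPerm_apply, Fin.revPerm_apply, hc, hvv]
    · intro a b
      rw [hcc, Fin.revPerm_apply, Fin.revPerm_apply, hc, hvv]
    · intro e he
      rw [isQAntisymm_iff] at he
      have h1 := he.conj
      have h2 : ((rMatrix n q).submatrix Prod.swap id).map conj =
          (rMatrix n q).submatrix Prod.swap id := by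
        rw [← Matrix.submatrix_map, rMatrix_map_conj hq]
      rw [h2, map_neg, map_inv₀, hq] at h1
      -- Conjugation keeps both `R̂` and its eigenvalue; reversing the slots flips the tensor
      -- factors, and the substitution `a ↦ a'` flips them back.
      have h3 := (LocalEigen.twist h1.reverse
        (fun a => (metricWeight n q (Fin.rev a))⁻¹) Fin.revPerm
        (M' := (rMatrix n q).submatrix Prod.swap id) ?_)
      · exact isQAntisymm_iff.2 h3
      · rintro ⟨a, b⟩ ⟨c, d⟩
        have h4 := rMatrix_weight q (fun a => (metricWeight n q (Fin.rev a))⁻¹)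
          (fun a => by rw [← mul_inv, metricWeight_mul_rev, inv_one]) (b, a) (c, d)
        have h6 := rMatrix_swap_swap q (Fin.rev b) (Fin.rev a) (Fin.rev c) (Fin.rev d)
        rw [Fin.rev_rev, Fin.rev_rev, Fin.rev_rev, Fin.rev_rev] at h6
        simp only [pairWeight, Matrix.submatrix_apply, Prod.swap_prod_mk, id,
          Fin.revPerm_apply] at h4 ⊢
        rw [h4, h6]
        ring

/-- For `|q| = 1` conjugation inverts `q`, so the conjugate of `R` is `R⁻¹` and the conjugate
transpose of `C` is `C`; no monomial matrix is needed. -/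
lemma existsUnique_isTrivialStar (hq : conj (q : ℂ) = ((q⁻¹ : ℂˣ) : ℂ)) :
    ∃! s, IsTrivialStar n q s := by
  refine existsUnique_of_gen (v := 1) (σ := 1) (fun a => one_ne_zero) (fun a => rfl) (fun a => ?_)
    ?_ fun s => isTrivialStar_iff
  · simp
  · have hcc : ∀ a b, conj (metric n q b a) = metric n q a b := by
      intro a b
      by_cases h : b = Fin.rev a
      · subst h
        have h1 := metric_rev (q := q) (Fin.rev a)
        rw [Fin.rev_rev, rev_rho, neg_neg] at h1
        rw [h1, metric_rev, map_zpow₀, hq, Units.val_inv_eq_inv_val, inv_zpow, zpow_neg]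
      · rw [metric_eq_zero h, metric_eq_zero fun h2 => h (by rw [h2, Fin.rev_rev]), map_zero]
    refine (gen_isQOrthogonal n q).twist_conjOp (fun a => one_ne_zero)
      (gen_isQOrthogonal n q).rtt_inv ?_ ?_ ?_ ?_
    · rw [rMatrix_map_conj hq]
      ext x y
      have h1 : twist (pairWeight 1) (Equiv.prodCongr 1 1) (rMatrix n q⁻¹) x y =
          pairWeight 1 x * (pairWeight 1 y)⁻¹ * rMatrix n q⁻¹ x y := rfl
      rw [h1]
      simp [pairWeight]
    · intro a b
      simp [hcc]
    · intro a b
      simp [hcc]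
    · intro e he
      rw [isQAntisymm_iff] at he
      have h1 := he.conj.reverse
      have h2 : ((rMatrix n q).submatrix Prod.swap id).map conj =
          (rMatrix n q⁻¹).submatrix Prod.swap id := by
        rw [← Matrix.submatrix_map, rMatrix_map_conj hq]
      -- The conjugated and reversed tensor has eigenvalue `-q` for the inverse of `R̂`; inverting
      -- returns `R̂` and the eigenvalue `-q⁻¹`.
      have h3 := h1.inverse (N := (rMatrix n q).submatrix Prod.swap id)
        (by simp) (by
          have h4 : ((rMatrix n q⁻¹).submatrix Prod.swap id).submatrix Prod.swap Prod.swap =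
              (rMatrix n q⁻¹).submatrix id Prod.swap := by
            ext x y
            simp
          rw [h2, h4]
          have h5 := Matrix.submatrix_mul_equiv (rMatrix n q) (rMatrix n q⁻¹) Prod.swap
            (Equiv.refl _) Prod.swap
          have h6 : (rMatrix n q).submatrix Prod.swap id * (rMatrix n q⁻¹).submatrix id Prod.swap =
            (rMatrix n q * rMatrix n q⁻¹).submatrix Prod.swap Prod.swap := h5
          rw [h6, rMatrix_mul_rMatrix_inv]
          exact Matrix.submatrix_one_equiv (Equiv.prodComm _ _))
      rw [map_neg, map_inv₀, hq] at h3
      have h7 : (-(((q⁻¹ : ℂˣ) : ℂ))⁻¹)⁻¹ = -(q : ℂ)⁻¹ := by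
        rw [Units.val_inv_eq_inv_val, inv_inv, inv_neg]
      have h8 : (fun j : Fin (2 * n) → Fin (2 * n) =>
          (∏ k, ((1 : Fin (2 * n) → ℂ) ((1 : Equiv.Perm (Fin (2 * n))).symm (j k)))⁻¹) *
            conj (e ((1 : Equiv.Perm (Fin (2 * n))).symm ∘ j ∘ Fin.rev))) =
          fun j => conj (e (j ∘ Fin.rev)) := by
        funext j
        simp only [Pi.one_apply, inv_one, Finset.prod_const_one, one_mul]
        rfl
      rw [h7] at h3
      rw [isQAntisymm_iff, h8]
      exact h3

/-- Complex conjugation and `a ↦ a'` each change the sign of the entries of `𝒟''`; only ratios of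
two entries occur, so these signs cancel. -/
lemma IsMetricStar.comm (hs : IsMetricStar n q s) (h : IsSignVector n ε)
    (hφ : IsConjBy n q (dMatrix n ε) φ) (x : SOq n q) : φ (s x) = s (φ x) := by
  rw [isMetricStar_iff] at hs
  rw [isConjBy_iff h] at hφ
  refine hs.1.commute_of_gen (fun a b => ?_) x
  rw [hs.2, hφ, twist_apply, map_smul, hφ, twist_apply, twist_apply, s.map_smulₛₗ,
    Equiv.Perm.one_apply, Equiv.Perm.one_apply, hs.2, twist_apply, smul_smul, smul_smul]
  simp only [Fin.revPerm_apply, Equiv.Perm.one_apply]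
  congr 1
  rw [h.dEntry_rev, h.dEntry_rev, map_mul, map_inv₀, conj_dEntry, conj_dEntry]
  ring

lemma IsTrivialStar.comm (hs : IsTrivialStar n q s) (h : IsSignVector n ε)
    (hφ : IsConjBy n q (dMatrix n ε) φ) (x : SOq n q) : φ (s x) = s (φ x) := by
  rw [isConjBy_iff h] at hφ
  rw [isTrivialStar_iff, twist_one_one] at hs
  refine hs.1.commute_of_gen (fun a b => ?_) x
  rw [hs.2, hφ, twist_apply, s.map_smulₛₗ, Equiv.Perm.one_apply, Equiv.Perm.one_apply, hs.2,
    map_mul, map_inv₀, conj_dEntry, conj_dEntry, inv_neg, neg_mul_neg]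

lemma IsMetricStar.map_gen_compStar (hs : IsMetricStar n q s)
    (hφ : IsConjBy n q (dMatrix n ε) φ) :
    (gen n q).map (compStar φ s) = scal _ ((metric n q)ᵀ * dMatrix n ε) * gen n q *
      scal _ ((dMatrix n ε)⁻¹ * (metric n q)ᵀ) := by
  have h1 : (gen n q).map (compStar φ s) =
      twist (metricWeight n q) Fin.revPerm ((gen n q).map φ) := by
    rw [isMetricStar_iff] at hs
    ext a b
    change φ (s (gen n q a b)) = _
    rw [hs.2, twist_apply, map_smul]
    rfl
  rw [h1, hφ, ← scal_metric_mul_mul, scal_mul, scal_mul]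
  simp only [mul_assoc]

/-- The square root of `dEntry`. -/
def dRoot (n : ℕ) (ε : Fin (2 * n) → ℝ) (a : Fin (2 * n)) : ℂ :=
  (1 + Complex.I * (ε a : ℂ)) * ((Real.sqrt 2 : ℝ) : ℂ)⁻¹

lemma ofReal_sqrt_two_mul_self : ((Real.sqrt 2 : ℝ) : ℂ) * ((Real.sqrt 2 : ℝ) : ℂ) = 2 := by
  rw [← Complex.ofReal_mul, Real.mul_self_sqrt zero_le_two, Complex.ofReal_ofNat]

lemma ofReal_sqrt_two_ne_zero : ((Real.sqrt 2 : ℝ) : ℂ) ≠ 0 := by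
  simp

lemma IsSignVector.dRoot_mul_rev (h : IsSignVector n ε) (a : Fin (2 * n)) :
    dRoot n ε a * dRoot n ε (Fin.rev a) = 1 := by
  have h1 := ofReal_sqrt_two_ne_zero
  have h2 := ofReal_sqrt_two_mul_self
  rw [dRoot, dRoot, h.ofReal_rev]
  field_simp
  linear_combination -h2 - Complex.I ^ 2 * h.mul_self a - Complex.I_mul_I

/-- The root `w` has modulus one and `w² = d`, whence `w̄ d = w`. -/
lemma IsSignVector.conj_dRoot_mul (h : IsSignVector n ε) (a : Fin (2 * n)) :
    conj (dRoot n ε a) * dEntry n ε a = dRoot n ε a := by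
  rw [dRoot, dEntry]
  simp only [map_mul, map_add, map_one, map_inv₀, Complex.conj_I, Complex.conj_ofReal]
  linear_combination (-(Complex.I ^ 2) * h.mul_self a - Complex.I_mul_I) *
    ((Real.sqrt 2 : ℝ) : ℂ)⁻¹

/-- The intertwiner is conjugation by the diagonal square root of `𝒟''`: `×` replaces each root by
its conjugate and `♮` multiplies by `d`, which together restore the root. -/
lemma IsTrivialStar.starEquivalent (hs : IsTrivialStar n q s) (h : IsSignVector n ε)
    (hφ : IsConjBy n q (dMatrix n ε) φ) : StarEquivalent s (compStar φ s) := by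
  have hsym := isMonomialSymmetry_diagonal (q := q) h.dRoot_mul_rev
  refine starEquivalent_of_gen hs.1 (hs.1.compStar (h.involutive hφ) (hs.comm h hφ))
    (isHopfAut_of_gen hsym hsym.equiv_gen) fun a b => ?_
  rw [isConjBy_iff h] at hφ
  rw [isTrivialStar_iff, twist_one_one] at hs
  rw [hs.2, hsym.equiv_gen, twist_apply, Equiv.Perm.one_apply, Equiv.Perm.one_apply]
  change φ (s _) = _
  rw [s.map_smulₛₗ, hs.2, map_smul, hφ, twist_apply, Equiv.Perm.one_apply, Equiv.Perm.one_apply,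
    smul_smul]
  congr 1
  have h1 := h.conj_dRoot_mul a
  have h2 := h.conj_dRoot_mul b
  rw [map_mul, map_inv₀, mul_mul_mul_comm, ← mul_inv, h1, h2]

end Stars

/-! ### Determinants of quaternionic orthogonal matrices -/

section Quaternionic

/-- A complex vector space with a quaternionic structure has even dimension. -/
lemma even_finrank_of_quaternionic {W : Type*} [AddCommGroup W] [Module ℂ W]
    [FiniteDimensional ℂ W] (j : W →ₛₗ[starRingEnd ℂ] W) (hj : ∀ x, j (j x) = -x) :
    Even (Module.finrank ℂ W) := by
  set b := Module.finBasis ℂ W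
  set A : Matrix (Fin (Module.finrank ℂ W)) (Fin (Module.finrank ℂ W)) ℂ :=
    Matrix.of fun i k => b.repr (j (b k)) i with hA
  have hjb : ∀ k, j (b k) = ∑ i, A i k • b i := fun k => (b.sum_repr (j (b k))).symm
  -- `A` is the matrix of `j`; moving its coefficients through the antilinear map conjugates them.
  have h1 : A * A.map conj = -1 := by
    ext l k
    have h2 : j (j (b k)) = ∑ i, conj (A i k) • j (b i) := by
      conv_lhs => rw [hjb k]
      rw [map_sum]
      exact Finset.sum_congr rfl fun i _ => j.map_smulₛₗ _ _
    have h3 := congrArg (fun x => b.repr x l) h2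
    simp only [hj, map_neg, map_sum, map_smul, Finsupp.coe_neg, Pi.neg_apply,
      Finsupp.coe_finsetSum, Finset.sum_apply, Finsupp.coe_smul, Pi.smul_apply, smul_eq_mul,
      Module.Basis.repr_self] at h3
    rw [Matrix.mul_apply, Matrix.neg_apply, Matrix.one_apply]
    rw [Finsupp.single_apply] at h3
    simp only [eq_comm (a := k)] at h3
    rw [h3]
    refine Finset.sum_congr rfl fun i _ => ?_
    rw [Matrix.map_apply, mul_comm]
    rfl
  -- Determinants give `|det A|² = (-1)^dim`, impossible in odd dimension.
  have h4 := congrArg Matrix.det h1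
  have h5 : (A.map conj).det = conj A.det := (RingHom.map_det (starRingEnd ℂ) A).symm
  rw [Matrix.det_mul, h5, Complex.mul_conj, Matrix.det_neg, Matrix.det_one, mul_one,
    Fintype.card_fin] at h4
  by_contra hodd
  rw [Nat.not_even_iff_odd] at hodd
  rw [hodd.neg_one_pow] at h4
  have h6 : Complex.normSq A.det = -1 := by exact_mod_cast h4
  have := Complex.normSq_nonneg A.det
  linarith

variable {ι : Type*} [Fintype ι] [DecidableEq ι]

/-- The antilinear map `x ↦ J x̄`. -/
def conjMulVec (J : Matrix ι ι ℂ) : (ι → ℂ) →ₛₗ[starRingEnd ℂ] (ι → ℂ) where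
  toFun x := J *ᵥ (fun i => conj (x i))
  map_add' x y := by
    rw [← Matrix.mulVec_add]
    congr 1
    funext i
    simp
  map_smul' c x := by
    rw [← Matrix.mulVec_smul]
    congr 1
    funext i
    simp

lemma conjMulVec_mulVec {ι : Type*} [Fintype ι] {O J : Matrix ι ι ℂ} (hO : O * J = J * O.map conj) (x : ι → ℂ) :
    conjMulVec J (O *ᵥ x) = O *ᵥ conjMulVec J x := by
  change J *ᵥ (fun i => conj ((O *ᵥ x) i)) = O *ᵥ (J *ᵥ (fun i => conj (x i)))
  rw [Matrix.mulVec_mulVec, hO, ← Matrix.mulVec_mulVec]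
  congr 1
  funext i
  simp [Matrix.mulVec, dotProduct]

/-- Real eigenvalues of quaternionic matrices have even multiplicity. -/
lemma even_rootMultiplicity_of_quaternionic {O J : Matrix ι ι ℂ} (hJ : J * J.map conj = -1)
    (hO : O * J = J * O.map conj) {r : ℂ} (hr : conj r = r) :
    Even (O.charpoly.rootMultiplicity r) := by
  have hjj : ∀ x, conjMulVec J (conjMulVec J x) = -x := by
    intro x
    change J *ᵥ (fun i => conj ((J *ᵥ (fun i => conj (x i))) i)) = -x
    have h1 : (fun i => conj ((J *ᵥ (fun i => conj (x i))) i)) = J.map conj *ᵥ x := by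
      funext i
      simp [Matrix.mulVec, dotProduct]
    rw [h1, Matrix.mulVec_mulVec, hJ, Matrix.neg_mulVec, Matrix.one_mulVec]
  set f : Module.End ℂ (ι → ℂ) := Matrix.toLin' O with hf
  -- Since `r` is real, the antilinear map `x ↦ J x̄` commutes with `O - r` and its powers, so it
  -- restricts to a quaternionic structure on the generalized eigenspace.
  have hcomm : ∀ (k : ℕ) (x : ι → ℂ),
      ((f - algebraMap ℂ _ r) ^ k) (conjMulVec J x) =
        conjMulVec J (((f - algebraMap ℂ _ r) ^ k) x) := by
    intro k
    induction k with
    | zero => intro x; rfl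
    | succ k ih =>
      intro x
      rw [pow_succ, Module.End.mul_apply, Module.End.mul_apply, ← ih]
      congr 1
      simp only [LinearMap.sub_apply, Module.algebraMap_end_apply, hf, Matrix.toLin'_apply]
      rw [map_sub, LinearMap.map_smulₛₗ, hr, conjMulVec_mulVec hO]
  have hmem : ∀ x ∈ f.maxGenEigenspace r, conjMulVec J x ∈ f.maxGenEigenspace r := by
    intro x hx
    rw [Module.End.mem_maxGenEigenspace] at hx ⊢
    obtain ⟨k, hk⟩ := hx
    refine ⟨k, ?_⟩
    have := hcomm k x
    rw [Algebra.algebraMap_eq_smul_one] at this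
    rw [this, hk, map_zero]
  have h1 := even_finrank_of_quaternionic (W := f.maxGenEigenspace r)
    { toFun := fun x => ⟨conjMulVec J x, hmem x x.2⟩
      map_add' := fun x y => Subtype.ext (map_add (conjMulVec J) _ _)
      map_smul' := fun c x => Subtype.ext ((conjMulVec J).map_smulₛₗ _ _) }
    fun x => Subtype.ext (hjj x)
  rwa [LinearMap.finrank_maxGenEigenspace_eq, hf, Matrix.charpoly_toLin'] at h1

/-- Orthogonal matrices over the quaternions, seen as complex matrices, have determinant one. -/
lemma det_eq_one_of_quaternionic {O J : Matrix ι ι ℂ} (hJ : J * J.map conj = -1)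
    (hO : O * J = J * O.map conj) (horth : Oᵀ * O = 1) : O.det = 1 := by
  have hdet : O.det * O.det = 1 := by
    have := congrArg Matrix.det horth
    rwa [Matrix.det_mul, Matrix.det_transpose, Matrix.det_one] at this
  have hdet0 : O.det ≠ 0 := left_ne_zero_of_mul_eq_one hdet
  have hJu : IsUnit J.det := by
    have h1 := congrArg Matrix.det hJ
    rw [Matrix.det_mul, Matrix.det_neg, Matrix.det_one, mul_one] at h1
    exact isUnit_iff_ne_zero.2 fun h => by
      rw [h, zero_mul] at h1
      exact pow_ne_zero _ (neg_ne_zero.2 one_ne_zero) h1.symm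
  -- The conjugate of `O` is similar to `O` through `J`, so the characteristic polynomial is real
  -- and multiplicities are invariant under conjugation.
  have hchar : O.charpoly.map (starRingEnd ℂ) = O.charpoly := by
    rw [← Matrix.charpoly_map]
    have h1 : O.map conj = J⁻¹ * (O * J) := by
      rw [hO, Matrix.nonsing_inv_mul_cancel_left _ _ hJu]
    have h2 : (starRingEnd ℂ).mapMatrix O = O.map conj := rfl
    rw [h1, Matrix.charpoly_mul_comm, mul_assoc, Matrix.mul_nonsing_inv _ hJu, mul_one]
  set m : ℂ → ℕ := fun r => O.charpoly.rootMultiplicity r with hm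
  have hmconj : ∀ r, m (conj r) = m r := by
    intro r
    have h1 := Polynomial.eq_rootMultiplicity_map (p := O.charpoly)
      (starRingEnd ℂ).injective r
    rw [hchar] at h1
    exact h1.symm
  have hprod : O.det = ∏ r ∈ O.charpoly.roots.toFinset, r ^ m r := by
    rw [Matrix.det_eq_prod_roots_charpoly, Finset.prod_multiset_count]
    exact Finset.prod_congr rfl fun r _ => by rw [Polynomial.count_roots]
  have hne : ∀ r ∈ O.charpoly.roots.toFinset, r ≠ 0 := by
    rintro r hr rfl
    rw [Multiset.mem_toFinset] at hr
    exact hdet0 (by rw [Matrix.det_eq_prod_roots_charpoly, Multiset.prod_eq_zero hr])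
  -- Conjugate roots have inverse phases and equal multiplicities; a real root has phase `±1` and
  -- even multiplicity. Hence the determinant is the product of the moduli.
  have hphase : ∏ r ∈ O.charpoly.roots.toFinset, (r / (‖r‖ : ℂ)) ^ m r = 1 := by
    refine Finset.prod_involution (fun r _ => conj r) ?_ ?_ ?_ ?_
    · intro r hr
      have h1 : (‖r‖ : ℂ) ≠ 0 := by simpa using hne r hr
      rw [hmconj, ← mul_pow, Complex.norm_conj, div_mul_div_comm, Complex.mul_conj,
        Complex.normSq_eq_norm_sq, Complex.ofReal_pow, sq, div_self (mul_ne_zero h1 h1), one_pow]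
    · intro r hr h1 h2
      apply h1
      have h3 : Even (m r) := even_rootMultiplicity_of_quaternionic hJ hO h2
      obtain ⟨k, hk⟩ := h3
      have h4 : (‖r‖ : ℂ) ≠ 0 := by simpa using hne r hr
      rw [hk, ← two_mul, pow_mul, div_pow, sq r]
      have h5 : r * r = (‖r‖ : ℂ) ^ 2 := by
        conv_lhs => rw [← h2]
        rw [h2, ← Complex.ofReal_pow, ← Complex.normSq_eq_norm_sq, ← Complex.mul_conj, h2]
      rw [h5, div_self (pow_ne_zero 2 h4), one_pow]
    · intro r hr
      rw [Multiset.mem_toFinset, Polynomial.mem_roots (Matrix.charpoly_monic O).ne_zero] at hr ⊢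
      have h1 : 0 < m r := (Polynomial.rootMultiplicity_pos (Matrix.charpoly_monic O).ne_zero).2 hr
      rw [← hmconj] at h1
      exact (Polynomial.rootMultiplicity_pos (Matrix.charpoly_monic O).ne_zero).1 h1
    · intro r hr
      exact Complex.conj_conj r
  have hreal : O.det = ((∏ r ∈ O.charpoly.roots.toFinset, ‖r‖ ^ m r : ℝ) : ℂ) := by
    have h5 : ∏ r ∈ O.charpoly.roots.toFinset, ((‖r‖ ^ m r : ℝ) : ℂ) =
        (∏ r ∈ O.charpoly.roots.toFinset, (r / (‖r‖ : ℂ)) ^ m r) *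
          ∏ r ∈ O.charpoly.roots.toFinset, ((‖r‖ ^ m r : ℝ) : ℂ) := by rw [hphase, one_mul]
    rw [Complex.ofReal_prod, hprod, h5, ← Finset.prod_mul_distrib]
    refine Finset.prod_congr rfl fun r hr => ?_
    have h4 : (‖r‖ : ℂ) ≠ 0 := by simpa using hne r hr
    rw [Complex.ofReal_pow, ← mul_pow, div_mul_cancel₀ _ h4]
  have hnonneg : 0 ≤ ∏ r ∈ O.charpoly.roots.toFinset, ‖r‖ ^ m r :=
    Finset.prod_nonneg fun r _ => pow_nonneg (norm_nonneg r) _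
  rcases mul_self_eq_one_iff.1 hdet with h | h
  · exact h
  · rw [h] at hreal
    have h1 : (-1 : ℝ) = ∏ r ∈ O.charpoly.roots.toFinset, ‖r‖ ^ m r := by exact_mod_cast hreal
    linarith

end Quaternionic

/-! ### Antisymmetric tensors and determinants -/

section Antisymm

/-- Adjacent transpositions generate the symmetric group. -/
lemma antisymm_comp_perm {ι : Type*} {N : ℕ} {e : (Fin N → ι) → ℂ}
    (he : ∀ k l : Fin N, (l : ℕ) = (k : ℕ) + 1 → ∀ i, e (i ∘ Equiv.swap k l) = -e i)
    (π : Equiv.Perm (Fin N)) : ∀ i, e (i ∘ π) = (Equiv.Perm.sign π : ℤ) * e i := by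
  cases N with
  | zero =>
    intro i
    rw [Subsingleton.elim π 1]
    simp
  | succ N =>
    have hπ : π ∈ Submonoid.closure
        (Set.range fun i : Fin N => Equiv.swap i.castSucc i.succ) := by
      rw [Equiv.Perm.mclosure_swap_castSucc_succ]
      trivial
    induction hπ using Submonoid.closure_induction with
    | mem x hx =>
      obtain ⟨k, rfl⟩ := hx
      intro i
      rw [he _ _ (by simp), Equiv.Perm.sign_swap (Fin.castSucc_lt_succ).ne]
      simp
    | one => intro i; simp
    | mul x y _ _ hx hy =>
      intro i
      rw [Equiv.Perm.coe_mul, ← Function.comp_assoc, hy, hx, Equiv.Perm.sign_mul]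
      push_cast
      ring

variable {N : ℕ} {e : (Fin N → Fin N) → ℂ}

lemma antisymm_eq_zero
    (he : ∀ k l : Fin N, (l : ℕ) = (k : ℕ) + 1 → ∀ i, e (i ∘ Equiv.swap k l) = -e i)
    {i : Fin N → Fin N} (hi : ¬ Function.Injective i) : e i = 0 := by
  rw [Function.not_injective_iff] at hi
  obtain ⟨a, b, hab, hne⟩ := hi
  have h1 := antisymm_comp_perm he (Equiv.swap a b) i
  have h2 : i ∘ Equiv.swap a b = i := by
    funext k
    rw [Function.comp_apply, Equiv.swap_apply_def]
    split_ifs with h3 h4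
    · rw [h3, hab]
    · rw [h4, hab]
    · rfl
  rw [h2, Equiv.Perm.sign_swap hne] at h1
  push_cast at h1
  linear_combination h1 / 2

/-- A matrix acts on antisymmetric tensors of top degree by its determinant. -/
lemma sum_prod_mul_antisymm
    (he : ∀ k l : Fin N, (l : ℕ) = (k : ℕ) + 1 → ∀ i, e (i ∘ Equiv.swap k l) = -e i)
    (g : Matrix (Fin N) (Fin N) ℂ) (i : Fin N → Fin N) :
    ∑ j : Fin N → Fin N, (∏ k, g (i k) (j k)) * e j = g.det * e i := by
  have h1 : ∑ j : Fin N → Fin N, (∏ k, g (i k) (j k)) * e j =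
      (g.submatrix i id).det * e id := by
    rw [← Matrix.det_transpose, Matrix.det_apply', Finset.sum_mul]
    symm
    -- The Leibniz formula: the tensor vanishes on non-injective multi-indices, and the injective
    -- ones are permutations.
    refine Finset.sum_of_injOn (fun π : Equiv.Perm (Fin N) => (π : Fin N → Fin N))
      (fun _ _ _ _ h => DFunLike.coe_injective h) (fun _ _ => by simp) ?_ ?_
    · intro j _ hj
      rw [antisymm_eq_zero he, mul_zero]
      intro hinj
      exact hj ⟨Equiv.ofBijective j (Finite.injective_iff_bijective.1 hinj), by simp, rfl⟩
    · intro π _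
      have h2 := antisymm_comp_perm he π id
      rw [Function.id_comp] at h2
      rw [h2]
      simp only [Matrix.transpose_apply, Matrix.submatrix_apply, id]
      ring
  rw [h1]
  by_cases hi : Function.Injective i
  · set π := Equiv.ofBijective i (Finite.injective_iff_bijective.1 hi) with hπ
    have h2 : i = id ∘ π := rfl
    have h3 : g.submatrix i id = g.submatrix π id := rfl
    rw [h3, Matrix.det_permute, h2, antisymm_comp_perm he]
    ring
  · rw [antisymm_eq_zero he hi, mul_zero]
    rw [Function.not_injective_iff] at hi
    obtain ⟨a, b, hab, hne⟩ := hi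
    rw [Matrix.det_zero_of_row_eq hne, zero_mul]
    funext c
    simp [hab]

end Antisymm

/-! ### The classical limit -/

section Classical

variable {n : ℕ}

lemma metric_one_apply (a b : Fin (2 * n)) : metric n 1 a b = if b = Fin.rev a then 1 else 0 := by
  by_cases h : b = Fin.rev a
  · subst h
    simp [metric_rev]
  · rw [metric_eq_zero h, if_neg h]

lemma metric_one_transpose : (metric n 1)ᵀ = metric n 1 := by
  ext a b
  rw [Matrix.transpose_apply, metric_one_apply, metric_one_apply]
  have h : a = Fin.rev b ↔ b = Fin.rev a :=
    ⟨fun h => by rw [h, Fin.rev_rev], fun h => by rw [h, Fin.rev_rev]⟩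
  simp only [h]

lemma scal_one {B κ : Type*} [Semiring B] [Algebra ℂ B] [DecidableEq κ] :
    scal B (1 : Matrix κ κ ℂ) = 1 :=
  Matrix.map_one _ (map_zero _) (map_one _)

/-- At `q = 1` the algebra `SO_q(2n)` is commutative. -/
lemma mul_comm_of_one (x y : SOq n 1) : x * y = y * x := by
  have hgen : ∀ a b c d, gen n 1 a b * gen n 1 c d = gen n 1 c d * gen n 1 a b := by
    intro a b c d
    have h := (gen_isQOrthogonal n 1).rtt
    rw [rMatrix_one, scal_one, one_mul, mul_one] at h
    have h1 := congrFun (congrFun h (a, c)) (b, d)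
    rwa [leg₁_mul_leg₂_apply, leg₂_mul_leg₁_apply] at h1
  have hgen' : ∀ a b y, gen n 1 a b * y = y * gen n 1 a b := by
    intro a b y
    induction y using SOq.induction with
    | h0 c => exact (Algebra.commutes c _).symm
    | h1 c d => exact hgen a b c d
    | h2 x y hx hy => rw [← mul_assoc, hx, mul_assoc, hy, mul_assoc]
    | h3 x y hx hy => rw [mul_add, hx, hy, add_mul]
  induction x using SOq.induction with
  | h0 c => exact Algebra.commutes c _
  | h1 a b => exact hgen' a b y
  | h2 x z hx hz => rw [mul_assoc, hz, ← mul_assoc, hx, mul_assoc]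
  | h3 x z hx hz => rw [add_mul, hx, hz, mul_add]

/-- At `q = 1`, the `q`-antisymmetric tensors are the antisymmetric ones. -/
lemma IsQAntisymm.comp_swap {e : (Fin (2 * n) → Fin (2 * n)) → ℂ} (he : IsQAntisymm n 1 e)
    (k l : Fin (2 * n)) (hkl : (l : ℕ) = (k : ℕ) + 1) (i : Fin (2 * n) → Fin (2 * n)) :
    e (i ∘ Equiv.swap k l) = -e i := by
  have hne : k ≠ l := by
    rintro rfl
    omega
  have h := (isQAntisymm_iff.1 he) k l hkl i
  rw [rMatrix_one, Finset.sum_eq_single (i l, i k)] at h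
  · have h1 : ((1 : Matrix (Fin (2 * n) × Fin (2 * n)) (Fin (2 * n) × Fin (2 * n)) ℂ).submatrix
        Prod.swap id) (i k, i l) (i l, i k) = 1 := Matrix.one_apply_eq _
    rw [h1, one_mul, Units.val_one, inv_one, neg_mul, one_mul] at h
    rw [← h]
    congr 1
    funext r
    rw [Function.comp_apply, Equiv.swap_apply_def, Function.update_apply, Function.update_apply]
    split_ifs <;> simp_all
  · intro x _ hx
    rw [Matrix.submatrix_apply, Prod.swap_prod_mk, id, Matrix.one_apply_ne (Ne.symm hx), zero_mul]
  · simp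

/-- Supplies the complex points at `q = 1`: RTT is commutativity, the determinant relation follows
from the action on antisymmetric tensors of top degree, and `g C gᵗ = C` holds because a one-sided
inverse of a square complex matrix is two-sided. -/
lemma isQOrthogonal_one_of_transpose_mul {g : Matrix (Fin (2 * n)) (Fin (2 * n)) ℂ}
    (hg : gᵀ * metric n 1 * g = metric n 1) (hdet : g.det = 1) : IsQOrthogonal n 1 g := by
  have hs : ∀ M : Matrix (Fin (2 * n)) (Fin (2 * n)) ℂ, scal ℂ M = M := fun M => rfl
  refine ⟨?_, ?_, hg, ?_⟩
  · rw [rMatrix_one, scal_one, one_mul, mul_one]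
    exact leg_comm _ _ fun a b c d => Commute.all _ _
  · rw [hs]
    have h1 : metric n 1 * gᵀ * metric n 1 * g = 1 := by
      rw [mul_assoc, mul_assoc, ← mul_assoc gᵀ, hg, metric_mul_metric]
    have h2 : g * (metric n 1 * gᵀ * metric n 1) = 1 := mul_eq_one_comm.1 h1
    calc g * metric n 1 * gᵀ = g * metric n 1 * gᵀ * (metric n 1 * metric n 1) := by
          rw [metric_mul_metric, mul_one]
      _ = g * (metric n 1 * gᵀ * metric n 1) * metric n 1 := by simp only [mul_assoc]
      _ = metric n 1 := by rw [h2, one_mul]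
  · intro e he
    funext i
    have h1 := sum_prod_mul_antisymm he.comp_swap g i
    rw [hdet, one_mul] at h1
    refine Eq.trans (Finset.sum_congr rfl fun j _ => ?_) h1
    simp only [tpow, Matrix.of_apply, List.prod_ofFn]
    rfl

/-- The permutation that exchanges `a` and `a'` where two sign vectors differ. -/
def signPerm {ε₁ ε₂ : Fin (2 * n) → ℝ} (h₁ : IsSignVector n ε₁) (h₂ : IsSignVector n ε₂) :
    Equiv.Perm (Fin (2 * n)) :=
  Function.Involutive.toPerm (fun a => if ε₁ a = ε₂ a then a else Fin.rev a) fun a => by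
    by_cases h : ε₁ a = ε₂ a
    · simp [h]
    · simp [h, h₁.rev, h₂.rev]

section SignPerm

variable {ε₁ ε₂ : Fin (2 * n) → ℝ} (h₁ : IsSignVector n ε₁) (h₂ : IsSignVector n ε₂)

lemma signPerm_apply (a : Fin (2 * n)) :
    signPerm h₁ h₂ a = if ε₁ a = ε₂ a then a else Fin.rev a := rfl

lemma signPerm_rev (a : Fin (2 * n)) :
    signPerm h₁ h₂ (Fin.rev a) = Fin.rev (signPerm h₁ h₂ a) := by
  rw [signPerm_apply, signPerm_apply]
  simp only [h₁.rev, h₂.rev, neg_inj]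
  split_ifs <;> rfl

lemma dEntry_signPerm (a : Fin (2 * n)) : dEntry n ε₂ (signPerm h₁ h₂ a) = dEntry n ε₁ a := by
  rw [signPerm_apply]
  split_ifs with h
  · rw [dEntry, dEntry, h]
  · rw [h₂.dEntry_rev, dEntry, dEntry]
    have h3 : ε₁ a = -ε₂ a :=
      (sq_eq_sq_iff_eq_or_eq_neg.1 ((h₁.sq a).trans (h₂.sq a).symm)).resolve_left h
    rw [h3]
    push_cast
    ring

/-- At `q = 1` one has `R = 1` and `C_{ab} = δ_{ab'}`, so any permutation commuting with `a ↦ a'`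
qualifies. -/
lemma isMonomialSymmetry_signPerm : IsMonomialSymmetry n 1 1 (signPerm h₁ h₂) := by
  have h3 : ∀ a b, metric n 1 (signPerm h₁ h₂ a) (signPerm h₁ h₂ b) = metric n 1 a b := by
    intro a b
    rw [metric_one_apply, metric_one_apply, ← signPerm_rev]
    simp only [EmbeddingLike.apply_eq_iff_eq]
  refine ⟨fun a => one_ne_zero, fun x y => ?_, fun a b => ?_, fun a b => ?_⟩
  · rw [rMatrix_one, Matrix.one_apply, Matrix.one_apply]
    simp [pairWeight, Prod.ext_iff]
  · rw [h3]
    simp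
  · rw [h3]
    simp

end SignPerm

lemma IsMetricStar.isStarStructure_compStar {q : ℂˣ} {s : SOq n q →ₛₗ[starRingEnd ℂ] SOq n q}
    {φ : SOq n q ≃ₐc[ℂ] SOq n q} {ε : Fin (2 * n) → ℝ} (hs : IsMetricStar n q s)
    (h : IsSignVector n ε) (hφ : IsConjBy n q (dMatrix n ε) φ) :
    IsStarStructure (compStar φ s) :=
  hs.1.compStar (h.involutive hφ) (hs.comm h hφ)

variable {ε : Fin (2 * n) → ℝ} {φ : SOq n 1 ≃ₐc[ℂ] SOq n 1}
  {s : SOq n 1 →ₛₗ[starRingEnd ℂ] SOq n 1}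

lemma compStar_gen_one (hs : IsMetricStar n 1 s) (h : IsSignVector n ε)
    (hφ : IsConjBy n 1 (dMatrix n ε) φ) (a b : Fin (2 * n)) :
    compStar φ s (gen n 1 a b) = (dEntry n ε (Fin.rev a) * (dEntry n ε (Fin.rev b))⁻¹) •
      gen n 1 (Fin.rev a) (Fin.rev b) := by
  rw [isMetricStar_iff] at hs
  rw [isConjBy_iff h] at hφ
  change φ (s (gen n 1 a b)) = _
  rw [hs.2, twist_apply, map_smul, hφ, twist_apply]
  simp [metricWeight]

/-- At `q = 1` all the conjugations `⋆^♮` are equivalent. -/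
lemma IsMetricStar.starEquivalent_compStar {ε₁ ε₂ : Fin (2 * n) → ℝ}
    {φ₁ φ₂ : SOq n 1 ≃ₐc[ℂ] SOq n 1} (hs : IsMetricStar n 1 s)
    (h₁ : IsSignVector n ε₁) (h₂ : IsSignVector n ε₂)
    (hφ₁ : IsConjBy n 1 (dMatrix n ε₁) φ₁) (hφ₂ : IsConjBy n 1 (dMatrix n ε₂) φ₂) :
    StarEquivalent (compStar φ₁ s) (compStar φ₂ s) := by
  have hsym := isMonomialSymmetry_signPerm h₁ h₂
  have hα : ∀ a b, hsym.equiv (gen n 1 a b) =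
      gen n 1 (signPerm h₁ h₂ a) (signPerm h₁ h₂ b) := by
    intro a b
    rw [hsym.equiv_gen, twist_apply]
    simp
  refine starEquivalent_of_gen (hs.isStarStructure_compStar h₁ hφ₁)
    (hs.isStarStructure_compStar h₂ hφ₂) (isHopfAut_of_gen hsym hsym.equiv_gen) fun a b => ?_
  rw [hα, compStar_gen_one hs h₂ hφ₂, compStar_gen_one hs h₁ hφ₁, map_smul, hα, ← signPerm_rev,
    ← signPerm_rev, dEntry_signPerm, dEntry_signPerm]

end Classical

/-! ### The group `SO*(2n)` -/

section SOStar

variable {n : ℕ}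

/-- The permutation `a ↦ a ± n` underlying the matrix `J`. -/
def shift (a : Fin (2 * n)) : Fin (2 * n) :=
  if h : (a : ℕ) < n then ⟨a + n, by omega⟩ else ⟨a - n, by omega⟩

/-- The signs of the entries of `J`. -/
def shiftSign (a : Fin (2 * n)) : ℂ := if (a : ℕ) < n then 1 else -1

lemma shift_val (a : Fin (2 * n)) :
    (shift a : ℕ) = if (a : ℕ) < n then (a : ℕ) + n else (a : ℕ) - n := by
  rw [shift]
  split_ifs <;> rfl

lemma shift_shift (a : Fin (2 * n)) : shift (shift a) = a := by
  have := a.2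
  apply Fin.ext
  rw [shift_val, shift_val]
  split_ifs <;> omega

lemma shift_eq_iff (a b : Fin (2 * n)) : shift a = b ↔ a = shift b :=
  ⟨fun h => by rw [← h, shift_shift], fun h => by rw [h, shift_shift]⟩

lemma shiftSign_shift (a : Fin (2 * n)) : shiftSign (shift a) = -shiftSign a := by
  have := a.2
  rw [shiftSign, shiftSign, shift_val]
  split_ifs <;> first | omega | simp

lemma shiftSign_mul_self (a : Fin (2 * n)) : shiftSign a * shiftSign a = 1 := by
  rw [shiftSign]
  split_ifs <;> norm_num

lemma jMatrix_apply (a b : Fin (2 * n)) :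
    jMatrix n a b = if b = shift a then shiftSign a else 0 := by
  have := a.2
  have := b.2
  simp only [jMatrix, Matrix.of_apply, Fin.ext_iff, shift_val, shiftSign]
  split_ifs <;> first | rfl | omega

lemma jMatrix_mul_apply (X : Matrix (Fin (2 * n)) (Fin (2 * n)) ℂ) (a b : Fin (2 * n)) :
    (jMatrix n * X) a b = shiftSign a * X (shift a) b := by
  rw [Matrix.mul_apply]
  simp only [jMatrix_apply, ite_mul, zero_mul, Finset.sum_ite_eq', Finset.mem_univ, if_true]

lemma jMatrix_mul_jMatrix : jMatrix n * jMatrix n = -1 := by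
  ext a b
  rw [jMatrix_mul_apply, jMatrix_apply, shift_shift, shiftSign_shift, Matrix.neg_apply,
    Matrix.one_apply]
  have := shiftSign_mul_self a
  by_cases h : b = a
  · rw [if_pos h, if_pos h.symm]
    linear_combination -this
  · rw [if_neg h, if_neg (Ne.symm h)]
    simp

lemma jMatrix_inv : (jMatrix n)⁻¹ = -jMatrix n :=
  Matrix.inv_eq_right_inv (by rw [mul_neg, jMatrix_mul_jMatrix, neg_neg])

lemma jMatrix_map_conj : (jMatrix n).map conj = jMatrix n := by
  ext a b
  rw [Matrix.map_apply, jMatrix_apply, shiftSign]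
  split_ifs <;> simp

lemma conj_map_mul {κ : Type*} [Fintype κ] (X Y : Matrix κ κ ℂ) :
    (X * Y).map conj = X.map conj * Y.map conj := Matrix.map_mul (f := starRingEnd ℂ)

lemma conj_map_one {κ : Type*} [DecidableEq κ] :
    (1 : Matrix κ κ ℂ).map conj = 1 := Matrix.map_one _ (map_zero _) (map_one _)

/-- The two descriptions of `SO*(2n)`. -/
lemma mem_SOStar_iff (O : Matrix (Fin (2 * n)) (Fin (2 * n)) ℂ) :
    O ∈ SOStar n ↔ Oᵀ * O = 1 ∧ O.map conj = jMatrix n * O * (jMatrix n)⁻¹ := by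
  refine and_congr_right fun hO => ?_
  have hO' : O * Oᵀ = 1 := mul_eq_one_comm.1 hO
  have hct : Oᴴ = (O.map conj)ᵀ := rfl
  -- The transpose of `Ō` is its inverse, so `Ōᵗ J O = J` becomes `J O = Ō J`.
  have hcc : O.map conj * (O.map conj)ᵀ = 1 := by
    rw [← Matrix.transpose_map, ← conj_map_mul, hO', conj_map_one]
  have hcc' : (O.map conj)ᵀ * O.map conj = 1 := mul_eq_one_comm.1 hcc
  rw [hct, jMatrix_inv]
  constructor
  · intro h
    calc O.map conj = O.map conj * (-(jMatrix n * jMatrix n)) := by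
          rw [jMatrix_mul_jMatrix, neg_neg, mul_one]
      _ = O.map conj * ((O.map conj)ᵀ * jMatrix n * O) * -jMatrix n := by
          rw [h, mul_neg, mul_neg, mul_assoc]
      _ = (O.map conj * (O.map conj)ᵀ) * jMatrix n * O * -jMatrix n := by simp only [mul_assoc]
      _ = jMatrix n * O * -jMatrix n := by rw [hcc, one_mul]
  · intro h
    have h1 : jMatrix n * O = O.map conj * jMatrix n := by
      rw [h, mul_assoc _ _ (jMatrix n), neg_mul, jMatrix_mul_jMatrix, neg_neg, mul_one]
    rw [mul_assoc, h1, ← mul_assoc, hcc', one_mul]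

/-- Orthogonality alone gives only `±1`; the sign is fixed by the quaternionic structure `x ↦ J x̄`,
which commutes with `O`. -/
lemma det_eq_one_of_mem_SOStar {O : Matrix (Fin (2 * n)) (Fin (2 * n)) ℂ} (hO : O ∈ SOStar n) :
    O.det = 1 := by
  rw [mem_SOStar_iff, jMatrix_inv] at hO
  refine det_eq_one_of_quaternionic (J := jMatrix n) ?_ ?_ hO.1
  · rw [jMatrix_map_conj, jMatrix_mul_jMatrix]
  · rw [hO.2, mul_assoc, ← mul_assoc (jMatrix n), jMatrix_mul_jMatrix, mul_neg, mul_neg, neg_mul,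
      one_mul, neg_neg]

/-- The representative `a` or `a'` in the first half of the indices. -/
def half (a : Fin (2 * n)) : Fin (2 * n) := if (a : ℕ) < n then a else Fin.rev a

lemma half_val_lt (a : Fin (2 * n)) : (half a : ℕ) < n := by
  have := a.2
  rw [half]
  split_ifs with h
  · exact h
  · rw [Fin.val_rev]
    omega

lemma half_rev (a : Fin (2 * n)) : half (Fin.rev a) = half a := by
  have := a.2
  rw [half, half, Fin.rev_rev, Fin.val_rev]
  split_ifs <;> first | rfl | omega

lemma half_eq_half_iff (a b : Fin (2 * n)) : half a = half b ↔ b = a ∨ b = Fin.rev a := by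
  constructor
  · intro h
    have h2 : ∀ a : Fin (2 * n), half a = a ∨ half a = Fin.rev a := fun a => by
      rw [half]
      split_ifs <;> simp
    rcases h2 a with ha | ha <;> rcases h2 b with hb | hb <;> rw [ha, hb] at h
    · exact Or.inl h.symm
    · exact Or.inr (by rw [h, Fin.rev_rev])
    · exact Or.inr h.symm
    · exact Or.inl (Fin.rev_injective h.symm)
  · rintro (rfl | rfl)
    · rfl
    · rw [half_rev]

lemma half_ne_shift_half (a b : Fin (2 * n)) : half a ≠ shift (half b) := by
  intro h
  have h1 := congrArg Fin.val h
  have h2 := half_val_lt a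
  have h3 := half_val_lt b
  rw [shift_val, if_pos h3] at h1
  omega

/-- The change of basis that brings `⋆^♮` to the form of the conjugation of `SO*(2n)`. -/
def basisChange (n : ℕ) (ε : Fin (2 * n) → ℝ) : Matrix (Fin (2 * n)) (Fin (2 * n)) ℂ :=
  Matrix.of fun r a => ((Real.sqrt 2 : ℝ) : ℂ)⁻¹ *
    ((if r = half a then 1 else 0) + (if r = shift (half a) then dEntry n ε a else 0))

variable {ε : Fin (2 * n) → ℝ}

/-- On the coordinates `half a` and `shift (half a)`, column `a` is `(1, d_a)/√2`. Columns of one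
pair have product `(1 + d_a d_b)/2`, which is `0` for `b = a` and `1` for `b = a'`. -/
lemma basisChange_transpose_mul (h : IsSignVector n ε) :
    (basisChange n ε)ᵀ * basisChange n ε = metric n 1 := by
  ext a b
  have h2 := ofReal_sqrt_two_mul_self
  have h3 := ofReal_sqrt_two_ne_zero
  have h1 : ∀ r, (basisChange n ε)ᵀ a r * basisChange n ε r b =
      2⁻¹ * ((if r = half a then (if half a = half b then 1 else 0) else 0) +
        (if r = shift (half a) then
          (if half a = half b then dEntry n ε a * dEntry n ε b else 0) else 0)) := by
    intro r
    simp only [Matrix.transpose_apply, basisChange, Matrix.of_apply]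
    rw [mul_mul_mul_comm, ← mul_inv, h2]
    congr 1
    by_cases h4 : r = half a
    · subst h4
      simp [half_ne_shift_half]
    · by_cases h5 : r = shift (half a)
      · subst h5
        simp [(half_ne_shift_half _ _).symm, shift_eq_iff, shift_shift]
      · simp [h4, h5]
  rw [Matrix.mul_apply, Finset.sum_congr rfl fun r _ => h1 r, ← Finset.mul_sum,
    Finset.sum_add_distrib, Finset.sum_ite_eq', if_pos (Finset.mem_univ _), Finset.sum_ite_eq',
    if_pos (Finset.mem_univ _), metric_one_apply]
  by_cases hb : b = Fin.rev a
  · subst hb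
    rw [if_pos (half_rev a).symm, if_pos (half_rev a).symm, h.dEntry_mul_rev, if_pos rfl]
    norm_num
  · rw [if_neg hb]
    by_cases hba : b = a
    · subst hba
      rw [if_pos rfl, if_pos rfl, h.dEntry_mul_self]
      norm_num
    · have h6 : half a ≠ half b := fun h7 => ((half_eq_half_iff a b).1 h7).elim hba hb
      rw [if_neg h6, if_neg h6]
      norm_num

/-- On the two coordinates of column `a`, up to `1/√2`: the conjugate of column `a'` is `(1, d_a)`,
times `d_a` it is `(d_a, -1)`, and this is `J` applied to `(1, d_a)`. -/
lemma basisChange_map_conj_mul (h : IsSignVector n ε) :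
    (basisChange n ε).map conj * metric n 1 * dMatrix n ε = jMatrix n * basisChange n ε := by
  ext r a
  have h1 : ((basisChange n ε).map conj * metric n 1) r a =
      conj (basisChange n ε r (Fin.rev a)) := by
    rw [Matrix.mul_apply, Finset.sum_eq_single (Fin.rev a)]
    · rw [Matrix.map_apply, metric_one_apply, Fin.rev_rev, if_pos rfl, mul_one]
    · intro c _ hc
      rw [metric_one_apply, if_neg fun h2 => hc (by rw [h2, Fin.rev_rev]), mul_zero]
    · simp
  rw [dMatrix_eq, Matrix.mul_diagonal, h1, jMatrix_mul_apply]
  simp only [basisChange, Matrix.of_apply, half_rev, shift_eq_iff, shift_shift, map_mul, map_add,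
    map_inv₀, Complex.conj_ofReal]
  have hd := h.dEntry_mul_self a
  have hlt := half_val_lt a
  by_cases h4 : r = half a
  · subst h4
    have h5 := half_ne_shift_half a a
    rw [if_pos rfl, if_neg h5, if_neg h5, if_pos rfl, shiftSign, if_pos hlt]
    simp only [map_one, map_zero]
    ring
  · by_cases h5 : r = shift (half a)
    · subst h5
      rw [if_neg h4, if_pos rfl, if_pos rfl, if_neg h4, shiftSign_shift, shiftSign, if_pos hlt,
        conj_dEntry, h.dEntry_rev]
      simp only [map_zero]
      linear_combination ((Real.sqrt 2 : ℝ) : ℂ)⁻¹ * hd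
    · rw [if_neg h4, if_neg h5, if_neg h5, if_neg h4]
      simp

end SOStar

/-! ### The real points of `⋆^♮` at `q = 1`. -/

section RealForm

variable {n : ℕ} {ε : Fin (2 * n) → ℝ}

/-- The change of basis as an invertible matrix. -/
def basisChangeUnit (h : IsSignVector n ε) : GL (Fin (2 * n)) ℂ where
  val := basisChange n ε
  inv := metric n 1 * (basisChange n ε)ᵀ
  val_inv := by
    rw [mul_eq_one_comm, mul_assoc, basisChange_transpose_mul h, metric_mul_metric]
  inv_val := by
    rw [mul_assoc, basisChange_transpose_mul h, metric_mul_metric]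

lemma antilinear_map_scal_mul_mul {A κ : Type*} [Ring A] [Algebra ℂ A] [Fintype κ]
    (s : A →ₛₗ[starRingEnd ℂ] A) (M N : Matrix κ κ ℂ) (X : Matrix κ κ A) :
    (scal A M * X * scal A N).map s = scal A (M.map conj) * X.map s * scal A (N.map conj) := by
  ext a b
  simp only [Matrix.map_apply, Matrix.mul_apply, scal, Finset.sum_mul, map_sum]
  refine Finset.sum_congr rfl fun c _ => Finset.sum_congr rfl fun d _ => ?_
  rw [← Algebra.commutes, ← Algebra.commutes, ← Algebra.smul_def, ← Algebra.smul_def,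
    ← Algebra.smul_def, ← Algebra.smul_def, s.map_smulₛₗ, s.map_smulₛₗ]

lemma map_scal_mul_mul {A κ : Type*} [Ring A] [Algebra ℂ A] [Fintype κ]
    (χ : A →ₐ[ℂ] ℂ) (M N : Matrix κ κ ℂ) (X : Matrix κ κ A) :
    (scal A M * X * scal A N).map χ = M * X.map χ * N := by
  rw [mul_map, mul_map, scal_map, scal_map]
  rfl

lemma metric_one_mul_dMatrix_mul_inv (h : IsSignVector n ε) :
    metric n 1 * dMatrix n ε * ((dMatrix n ε)⁻¹ * metric n 1) = 1 := by
  have h1 : dMatrix n ε * (dMatrix n ε)⁻¹ = 1 := by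
    rw [Matrix.inv_eq_right_inv (show dMatrix n ε * (-dMatrix n ε) = 1 by
      rw [mul_neg, h.dMatrix_mul_self, neg_neg]), mul_neg, h.dMatrix_mul_self, neg_neg]
  rw [mul_assoc, ← mul_assoc (dMatrix n ε), h1, one_mul, metric_mul_metric]

variable {M Mi : Matrix (Fin (2 * n)) (Fin (2 * n)) ℂ}

/-- The inverse form of `hJ`: the two sides are a right and a left inverse of `J M`. -/
lemma dMatrix_inv_mul_metric_mul_map_conj (h : IsSignVector n ε) (hM : M * Mi = 1)
    (hJ : M.map conj * metric n 1 * dMatrix n ε = jMatrix n * M) :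
    (dMatrix n ε)⁻¹ * metric n 1 * Mi.map conj = Mi * (jMatrix n)⁻¹ := by
  have h1 : Mi * (jMatrix n)⁻¹ * (jMatrix n * M) = 1 := by
    have h2 : (jMatrix n)⁻¹ * jMatrix n = 1 := by
      rw [jMatrix_inv, neg_mul, jMatrix_mul_jMatrix, neg_neg]
    rw [mul_assoc, ← mul_assoc _ (jMatrix n), h2, one_mul]
    exact mul_eq_one_comm.1 hM
  have h3 : jMatrix n * M * ((dMatrix n ε)⁻¹ * metric n 1 * Mi.map conj) = 1 := by
    rw [← hJ]
    calc M.map conj * metric n 1 * dMatrix n ε * ((dMatrix n ε)⁻¹ * metric n 1 * Mi.map conj)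
        = M.map conj * (metric n 1 * dMatrix n ε * ((dMatrix n ε)⁻¹ * metric n 1)) *
          Mi.map conj := by simp only [mul_assoc]
      _ = 1 := by
        rw [metric_one_mul_dMatrix_mul_inv h, mul_one, ← conj_map_mul, hM, conj_map_one]
  exact (left_inv_eq_right_inv h1 h3).symm

variable {φ : SOq n 1 ≃ₐc[ℂ] SOq n 1} {s : SOq n 1 →ₛₗ[starRingEnd ℂ] SOq n 1}

lemma transpose_mul_self_of_basisChange (hM : M * Mi = 1) (hMC : Mᵀ * M = metric n 1) :
    (scal (SOq n 1) M * gen n 1 * scal _ Mi)ᵀ * (scal (SOq n 1) M * gen n 1 * scal _ Mi) =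
      1 := by
  have ht : ∀ N : Matrix (Fin (2 * n)) (Fin (2 * n)) ℂ, (scal (SOq n 1) N)ᵀ = scal _ Nᵀ :=
    fun N => rfl
  rw [transpose_mul_scal, transpose_scal_mul, ht, ht]
  calc scal (SOq n 1) Miᵀ * ((gen n 1)ᵀ * scal _ Mᵀ) * (scal _ M * gen n 1 * scal _ Mi)
      = scal _ Miᵀ * ((gen n 1)ᵀ * (scal _ Mᵀ * scal _ M) * gen n 1) * scal _ Mi := by
        simp only [mul_assoc]
    _ = scal _ (Miᵀ * metric n 1 * Mi) := by
        rw [← scal_mul, hMC, (gen_isQOrthogonal n 1).ttc, scal_mul, scal_mul]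
    _ = 1 := by
        rw [← hMC, ← mul_assoc, ← Matrix.transpose_mul, hM, Matrix.transpose_one, one_mul, hM,
          scal_one]

lemma IsMetricStar.map_gen_compStar_one (hs : IsMetricStar n 1 s)
    (hφ : IsConjBy n 1 (dMatrix n ε) φ) :
    (gen n 1).map (compStar φ s) = scal _ (metric n 1 * dMatrix n ε) * gen n 1 *
      scal _ ((dMatrix n ε)⁻¹ * metric n 1) := by
  have := hs.map_gen_compStar hφ
  rwa [metric_one_transpose] at this

/-- The antilinear map conjugates `M` and sends `T` to `C 𝒟'' T 𝒟''⁻¹ C`; `hJ` and its inverse form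
then pull `J` out to both sides. -/
lemma map_compStar_of_basisChange (hs : IsMetricStar n 1 s) (h : IsSignVector n ε)
    (hφ : IsConjBy n 1 (dMatrix n ε) φ) (hM : M * Mi = 1)
    (hJ : M.map conj * metric n 1 * dMatrix n ε = jMatrix n * M) :
    (scal (SOq n 1) M * gen n 1 * scal _ Mi).map (compStar φ s) =
      scal _ (jMatrix n) * (scal (SOq n 1) M * gen n 1 * scal _ Mi) * scal _ (jMatrix n)⁻¹ := by
  rw [antilinear_map_scal_mul_mul, hs.map_gen_compStar_one hφ]
  calc scal (SOq n 1) (M.map conj) * (scal _ (metric n 1 * dMatrix n ε) * gen n 1 *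
        scal _ ((dMatrix n ε)⁻¹ * metric n 1)) * scal _ (Mi.map conj)
      = scal _ (M.map conj * metric n 1 * dMatrix n ε) * gen n 1 *
          scal _ ((dMatrix n ε)⁻¹ * metric n 1 * Mi.map conj) := by
        rw [mul_assoc (M.map conj), scal_mul (M.map conj), scal_mul _ (Mi.map conj)]
        simp only [mul_assoc]
    _ = _ := by
        rw [hJ, dMatrix_inv_mul_metric_mul_map_conj h hM hJ, scal_mul, scal_mul]
        simp only [mul_assoc]

/-- The change of basis maps the real points of `⋆^♮` onto `SO*(2n)`. -/
lemma image_realPoints (hs : IsMetricStar n 1 s) (h : IsSignVector n ε)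
    (hφ : IsConjBy n 1 (dMatrix n ε) φ) (hM : M * Mi = 1) (hMC : Mᵀ * M = metric n 1)
    (hJ : M.map conj * metric n 1 * dMatrix n ε = jMatrix n * M) :
    (fun g => M * g * Mi) '' realPoints n (compStar φ s) = SOStar n := by
  have hMi : Mi * M = 1 := mul_eq_one_comm.1 hM
  have hstar := hs.isStarStructure_compStar h hφ
  ext O
  rw [mem_SOStar_iff]
  constructor
  · rintro ⟨g, ⟨χ, hχ, rfl⟩, rfl⟩
    have h3 : (1 : Matrix (Fin (2 * n)) (Fin (2 * n)) (SOq n 1)).map χ = 1 :=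
      Matrix.map_one _ (map_zero _) (map_one _)
    set X := scal (SOq n 1) M * gen n 1 * scal _ Mi with hX
    have hXχ : X.map χ = M * (gen n 1).map χ * Mi := map_scal_mul_mul χ M Mi _
    have h1 : (X.map χ)ᵀ * X.map χ = 1 := by
      rw [← Matrix.transpose_map, ← mul_map, transpose_mul_self_of_basisChange hM hMC, h3]
    have h2 : (X.map χ).map conj = (X.map (compStar φ s)).map χ := by
      ext a b
      exact (hχ _).symm
    rw [map_compStar_of_basisChange hs h hφ hM hJ, map_scal_mul_mul] at h2
    rw [map_scal_mul_mul, map_scal_mul_mul] at h2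
    rw [hXχ] at h1
    exact ⟨h1, h2⟩
  · rintro ⟨hO, hOJ⟩
    set g := Mi * O * M with hg
    have hgO : M * g * Mi = O := by
      rw [hg]
      calc M * (Mi * O * M) * Mi = (M * Mi) * O * (M * Mi) := by simp only [mul_assoc]
        _ = O := by rw [hM, one_mul, mul_one]
    -- A character must satisfy the determinant relation, so the quaternionic determinant argument
    -- is indispensable here.
    have hdet : g.det = 1 := by
      rw [hg, Matrix.det_mul, Matrix.det_mul,
        det_eq_one_of_mem_SOStar ((mem_SOStar_iff O).2 ⟨hO, hOJ⟩), mul_one, ← Matrix.det_mul, hMi,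
        Matrix.det_one]
    have hgC : gᵀ * metric n 1 * g = metric n 1 := by
      rw [hg, ← hMC, Matrix.transpose_mul, Matrix.transpose_mul]
      calc Mᵀ * (Oᵀ * Miᵀ) * (Mᵀ * M) * (Mi * O * M)
          = Mᵀ * (Oᵀ * ((M * Mi)ᵀ * (M * Mi) * O)) * M := by
            rw [Matrix.transpose_mul]
            simp only [mul_assoc]
        _ = Mᵀ * M := by rw [hM, Matrix.transpose_one, one_mul, one_mul, hO, mul_one]
    have hgo := isQOrthogonal_one_of_transpose_mul hgC hdet
    refine ⟨g, ⟨lift g hgo, ?_, ?_⟩, hgO⟩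
    · have hgen : (gen n 1).map (lift g hgo) = g := by
        ext a b
        rw [Matrix.map_apply, lift_gen]
      -- This is reality of the character on the generators: the equation `Ō = J O J⁻¹` written in
      -- the original basis.
      have hbar : g.map conj =
          metric n 1 * dMatrix n ε * g * ((dMatrix n ε)⁻¹ * metric n 1) := by
        have h1 := dMatrix_inv_mul_metric_mul_map_conj h hM hJ
        have h2 : (M.map conj) * g.map conj * (Mi.map conj) = jMatrix n * O * (jMatrix n)⁻¹ := by
          rw [← conj_map_mul, ← conj_map_mul, hgO, hOJ]
        have h3 : Mi.map conj * M.map conj = 1 := by rw [← conj_map_mul, hMi, conj_map_one]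
        calc g.map conj = (Mi.map conj * M.map conj) * g.map conj *
              (Mi.map conj * M.map conj) := by rw [h3, one_mul, mul_one]
          _ = Mi.map conj * (jMatrix n * O * (jMatrix n)⁻¹) * M.map conj := by
              rw [← h2]
              simp only [mul_assoc]
          _ = Mi.map conj * (jMatrix n * M) * g * (Mi * (jMatrix n)⁻¹) * M.map conj := by
              rw [← hgO]
              simp only [mul_assoc]
          _ = (Mi.map conj * M.map conj) * (metric n 1 * dMatrix n ε) * g *
                ((dMatrix n ε)⁻¹ * metric n 1) * (Mi.map conj * M.map conj) := by
              rw [← h1, ← hJ]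
              simp only [mul_assoc]
          _ = _ := by rw [h3, one_mul, mul_one]
      intro f
      induction f using SOq.induction with
      | h0 c =>
        rw [map_algebraMap_of_map_one hstar.map_one, AlgHom.commutes, AlgHom.commutes]
        rfl
      | h1 a b =>
        have h4 := congrArg (fun X => X.map (lift g hgo)) (hs.map_gen_compStar_one hφ)
        simp only [map_scal_mul_mul, hgen, ← hbar] at h4
        have h5 := congrFun (congrFun h4 a) b
        simp only [Matrix.map_apply] at h5
        rw [h5, lift_gen]
      | h2 x y hx hy => rw [hstar.map_mul, map_mul, hx, hy, map_mul, map_mul, mul_comm]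
      | h3 x y hx hy => rw [map_add, map_add, hx, hy, map_add, map_add]
    · ext a b
      rw [Matrix.map_apply, lift_gen]

end RealForm

end QOrth

end

/-! ### Assembly of the statements. -/

theorem mainTheorem5 (n : ℕ) (hn : 2 ≤ n) :
    -- the matrices `𝒟''` and their automorphisms `♮`, for every `q ≠ 0`
    (∀ (q : ℂˣ) (ε : Fin (2 * n) → ℝ), QOrth.IsSignVector n ε →
      (QOrth.rMatrix n q * QOrth.leg₁ (QOrth.dMatrix n ε) * QOrth.leg₂ (QOrth.dMatrix n ε) =
          QOrth.leg₂ (QOrth.dMatrix n ε) * QOrth.leg₁ (QOrth.dMatrix n ε) * QOrth.rMatrix n q ∧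
        (QOrth.dMatrix n ε)ᵀ * QOrth.metric n q * QOrth.dMatrix n ε = QOrth.metric n q ∧
        QOrth.dMatrix n ε * QOrth.metric n q * (QOrth.dMatrix n ε)ᵀ = QOrth.metric n q ∧
        QOrth.dMatrix n ε * QOrth.dMatrix n ε = -1 ∧
        (QOrth.dMatrix n ε).map (starRingEnd ℂ) =
          (QOrth.metric n q)ᵀ * QOrth.dMatrix n ε * (QOrth.metric n q)ᵀ ∧
        (QOrth.dMatrix n ε).map (starRingEnd ℂ) = -QOrth.dMatrix n ε) ∧
      (∃! φ : QOrth.SOq n q ≃ₐc[ℂ] QOrth.SOq n q, QOrth.IsConjBy n q (QOrth.dMatrix n ε) φ) ∧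
      (∀ φ : QOrth.SOq n q ≃ₐc[ℂ] QOrth.SOq n q, QOrth.IsConjBy n q (QOrth.dMatrix n ε) φ →
        QOrth.IsHopfAut φ ∧ ∀ x, φ (φ x) = x)) ∧
    -- the conjugations `⋆^♮`, for `q` real
    (∀ q : ℂˣ, (q : ℂ).im = 0 →
      (∃! s, QOrth.IsMetricStar n q s) ∧
      ∀ (ε : Fin (2 * n) → ℝ) (φ : QOrth.SOq n q ≃ₐc[ℂ] QOrth.SOq n q)
        (s : QOrth.SOq n q →ₛₗ[starRingEnd ℂ] QOrth.SOq n q),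
        QOrth.IsSignVector n ε → QOrth.IsConjBy n q (QOrth.dMatrix n ε) φ →
        QOrth.IsMetricStar n q s →
          (∀ x, φ (s x) = s (φ x)) ∧
          QOrth.IsStarStructure (QOrth.compStar φ s) ∧
          (QOrth.gen n q).map (QOrth.compStar φ s) =
            QOrth.scal _ ((QOrth.metric n q)ᵀ * QOrth.dMatrix n ε) * QOrth.gen n q *
              QOrth.scal _ ((QOrth.dMatrix n ε)⁻¹ * (QOrth.metric n q)ᵀ)) ∧
    -- at `q = 1` the algebra is commutative and all `⋆^♮` are equivalent
    (∀ x y : QOrth.SOq n 1, x * y = y * x) ∧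
    (∀ (ε₁ ε₂ : Fin (2 * n) → ℝ) (φ₁ φ₂ : QOrth.SOq n 1 ≃ₐc[ℂ] QOrth.SOq n 1)
      (s : QOrth.SOq n 1 →ₛₗ[starRingEnd ℂ] QOrth.SOq n 1),
      QOrth.IsSignVector n ε₁ → QOrth.IsSignVector n ε₂ →
      QOrth.IsConjBy n 1 (QOrth.dMatrix n ε₁) φ₁ → QOrth.IsConjBy n 1 (QOrth.dMatrix n ε₂) φ₂ →
      QOrth.IsMetricStar n 1 s →
        QOrth.StarEquivalent (QOrth.compStar φ₁ s) (QOrth.compStar φ₂ s)) ∧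
    -- the two descriptions of `SO*(2n)`
    (∀ O : Matrix (Fin (2 * n)) (Fin (2 * n)) ℂ, O ∈ QOrth.SOStar n ↔
      Oᵀ * O = 1 ∧
        O.map (starRingEnd ℂ) = QOrth.jMatrix n * O * (QOrth.jMatrix n)⁻¹) ∧
    -- at `q = 1`, in a suitable basis, `⋆^♮` is given by the `SO*(2n)` conditions and the
    -- corresponding real form of `SO(2n, ℂ)` is `SO*(2n)`
    (∀ (ε : Fin (2 * n) → ℝ) (φ : QOrth.SOq n 1 ≃ₐc[ℂ] QOrth.SOq n 1)
      (s : QOrth.SOq n 1 →ₛₗ[starRingEnd ℂ] QOrth.SOq n 1),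
      QOrth.IsSignVector n ε → QOrth.IsConjBy n 1 (QOrth.dMatrix n ε) φ →
      QOrth.IsMetricStar n 1 s →
        ∃ M : GL (Fin (2 * n)) ℂ,
          (∀ O : Matrix (Fin (2 * n)) (Fin (2 * n)) (QOrth.SOq n 1),
            O = QOrth.scal _ (M : Matrix (Fin (2 * n)) (Fin (2 * n)) ℂ) * QOrth.gen n 1 *
              QOrth.scal _ ((M⁻¹ : GL (Fin (2 * n)) ℂ) : Matrix (Fin (2 * n)) (Fin (2 * n)) ℂ) →
            Oᵀ * O = 1 ∧
            O.map (QOrth.compStar φ s) =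
              QOrth.scal _ (QOrth.jMatrix n) * O * QOrth.scal _ (QOrth.jMatrix n)⁻¹) ∧
          (fun g => (M : Matrix (Fin (2 * n)) (Fin (2 * n)) ℂ) * g *
              ((M⁻¹ : GL (Fin (2 * n)) ℂ) : Matrix (Fin (2 * n)) (Fin (2 * n)) ℂ)) ''
            QOrth.realPoints n (QOrth.compStar φ s) = QOrth.SOStar n) ∧
    -- the conjugations `×^♮`, for `|q| = 1`
    (∀ q : ℂˣ, ‖(q : ℂ)‖ = 1 →
      (∃! s, QOrth.IsTrivialStar n q s) ∧
      ∀ (ε : Fin (2 * n) → ℝ) (φ : QOrth.SOq n q ≃ₐc[ℂ] QOrth.SOq n q)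
        (s : QOrth.SOq n q →ₛₗ[starRingEnd ℂ] QOrth.SOq n q),
        QOrth.IsSignVector n ε → QOrth.IsConjBy n q (QOrth.dMatrix n ε) φ →
        QOrth.IsTrivialStar n q s →
          (∀ x, φ (s x) = s (φ x)) ∧
          QOrth.IsStarStructure (QOrth.compStar φ s) ∧
          (QOrth.gen n q).map (QOrth.compStar φ s) =
            QOrth.scal _ (QOrth.dMatrix n ε) * QOrth.gen n q *
              QOrth.scal _ (QOrth.dMatrix n ε)⁻¹ ∧
          QOrth.StarEquivalent s (QOrth.compStar φ s)) := by
  refine ⟨fun q ε h => ⟨?_, h.existsUnique_isConjBy q, fun φ hφ => ?_⟩, fun q hq => ?_,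
    QOrth.mul_comm_of_one, fun ε₁ ε₂ φ₁ φ₂ s h₁ h₂ hφ₁ hφ₂ hs =>
      hs.starEquivalent_compStar h₁ h₂ hφ₁ hφ₂, QOrth.mem_SOStar_iff,
    fun ε φ s h hφ hs => ?_, fun q hq => ?_⟩
  · have ht : (QOrth.dMatrix n ε)ᵀ = QOrth.dMatrix n ε := Matrix.diagonal_transpose _
    rw [ht]
    exact ⟨h.rMatrix_mul_leg q, h.diagonal_mul_metric_mul q, h.diagonal_mul_metric_mul q,
      h.dMatrix_mul_self, by rw [QOrth.dMatrix_map_conj, h.metric_mul_dMatrix_mul q],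
      QOrth.dMatrix_map_conj⟩
  · exact ⟨QOrth.isHopfAut_of_gen (h.isMonomialSymmetry q) ((QOrth.isConjBy_iff h φ).1 hφ),
      h.involutive hφ⟩
  · have hq' : starRingEnd ℂ (q : ℂ) = q := Complex.conj_eq_iff_im.2 hq
    exact ⟨QOrth.existsUnique_isMetricStar hq', fun ε φ s h hφ hs =>
      ⟨hs.comm h hφ, hs.isStarStructure_compStar h hφ, hs.map_gen_compStar hφ⟩⟩
  · have hM : QOrth.basisChange n ε * (((QOrth.basisChangeUnit h)⁻¹ : GL (Fin (2 * n)) ℂ) :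
        Matrix (Fin (2 * n)) (Fin (2 * n)) ℂ) = 1 := (QOrth.basisChangeUnit h).mul_inv
    have hMC := QOrth.basisChange_transpose_mul h
    have hJ := QOrth.basisChange_map_conj_mul h
    refine ⟨QOrth.basisChangeUnit h, ?_, QOrth.image_realPoints hs h hφ hM hMC hJ⟩
    rintro O rfl
    exact ⟨QOrth.transpose_mul_self_of_basisChange hM hMC,
      QOrth.map_compStar_of_basisChange hs h hφ hM hJ⟩
  · have hq' : starRingEnd ℂ (q : ℂ) = ((q⁻¹ : ℂˣ) : ℂ) := by
      rw [Units.val_inv_eq_inv_val, Complex.inv_eq_conj hq]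
    refine ⟨QOrth.existsUnique_isTrivialStar hq', fun ε φ s h hφ hs =>
      ⟨hs.comm h hφ, hs.1.compStar (h.involutive hφ) (hs.comm h hφ), ?_,
        hs.starEquivalent h hφ⟩⟩
    -- Since `×` fixes `T`, the composite acts on `T` as `♮` does.
    refine Eq.trans ?_ hφ
    rw [← congrArg (fun X => X.map φ) hs.2]
    rfl
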